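/- Let $\mathcal B$ be a unital $C^*$-algebra. A $C^*$-operator $\mathcal B$-valued probability space $(\mathcal A,\mathbb E)$ is a unital $C^*$-algebra $\mathcal A\supseteq\mathcal B$ (with the same unit) with a positive linear map $\mathbb E:\mathcal A\to\mathcal B$ such that $\mathbb E[b]=b$ and $\mathbb E[b_1ab_2]=b_1\mathbb E[a]b_2$ for $b,b_1,b_2\in\mathcal B$, $a\in\mathcal A$. Let $\mathcal B\langle X\rangle$ be the algebra freely generated by $\mathcal B$ and $X$. The distribution of $a\in\mathcal A$ is the map $\mu_a:\mathcal B\langle X\rangle\to\mathcal B$, $\mu_a(P)=\mathbb E[P(a)]$; write $\Sigma(\mathcal B)$ for the set of all such distributions. Let $\mathrm{alg}_0(x)$ be the non-unital $\mathcal B$-$\mathcal B$-bimodule algebra generated by $x\in\mathcal A$. Elements $x_1,x_2\in\mathcal A$ are Boolean independent if $\mathbb E[a_1\cdots a_k]=\mathbb E[a_1]\cdots\mathbb E[a_k]$ whenever $a_j\in\mathrm{alg}_0(x_{i_j})$ and $i_1\ne i_2\ne\cdots\ne i_k$; they are monotone independent if $\mathbb E[a_1\cdots a_k]=\mathbb E[a_1\cdots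 a_{j-1}\,\mathbb E[a_j]\,a_{j+1}\cdots a_k]$ whenever $a_l\in\mathrm{alg}_0(x_{i_l})$ for all $l$ and $i_j$ is larger than those of the indices $i_{j-1},i_{j+1}$ that exist. If $x_1,x_2$ have distributions $\mu,\nu$, the distribution of $x_1+x_2$ is $\mu\uplus\nu$ in the Boolean independent case and $\mu\rhd\nu$ in the monotone independent case. A pointed bimodule $(\mathcal M,\xi)$ is a $\mathcal B$-$\mathcal B$ Hilbert bimodule with a vector $\xi$ such that $\langle\xi,b\xi\rangle=b$ for $b\in\mathcal B$; put $\mathcal M^\circ=(\mathcal B\xi)^\perp$, let $L(\mathcal M)$ be the algebra of adjointable operators, and $\phi_\xi=\langle\xi,\cdot\,\xi\rangle$. Given $(\mathcal M_1,\xi_1)$ and $(\mathcal M_2,\xi_2)$, let $$\mathcal M=\mathcal B\xi\oplus\bigoplus_{k\ge1}\ \bigoplus_{i_1\neq\cdots\neq i_k}\mathcal M_{i_1}^\circ\otimes_{\mathcal B}\cdots\otimes_{\mathcal B}\mathcal M_{i_k}^\circ$$ be their reduced free product over $\mathcal B$. Let $\mathcal M(i)\subseteq\mathcal M$ be the sum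 of $\mathcal B\xi$ and the summands with $i_1\ne i$, let $V_i:\mathcal M_i\otimes_{\mathcal B}\mathcal M(i)\to\mathcal M$ be the unitary given by $\xi_i\otimes m\mapsto m$, $m_i\otimes\xi\mapsto m_i$ and $m_i\otimes m\mapsto m_i\otimes m$ for $m_i\in\mathcal M_i^\circ$, and let $\lambda_i(a)=V_i(a\otimes1)V_i^{-1}$ for $a\in L(\mathcal M_i)$. For a set $J$ of words $(i_1,\dots,i_k)$ let $P_J$ be the orthogonal projection onto the sum of the corresponding summands ($\emptyset$ corresponds to $\mathcal B\xi$). If $x_1\in L(\mathcal M_1)$ and $x_2\in L(\mathcal M_2)$ have distributions $\mu$ and $\nu$ with respect to $\phi_{\xi_1}$, $\phi_{\xi_2}$, the orthogonal additive convolution $\mu\vdash\nu$ is the distribution of $$P_{\{\emptyset,(1)\}}\lambda_1(x_1)+P_{\{(1),(2,1)\}}\lambda_2(x_2)$$ with respect to $\phi_\xi$. For $n\in\mathbb N$ let $\mathbb H_n^+$ be the set of $b\in M_n(\mathcal B)$ with $(b-b^*)/i\ge\varepsilon 1$ for some $\varepsilon>0$. If $\mu$ is the distribution of a selfadjoint $a\in\mathcal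 A$, put $G_{\mu,n}(b)=(\mathbb E\otimes I_n)[(b-a\otimes I_n)^{-1}]$ and $F_{\mu,n}(b)=G_{\mu,n}(b)^{-1}$ for $b\in\mathbb H_n^+$. Proposition. Let $\mu,\nu\in\Sigma(\mathcal B)$. The convolutions $\mu\vdash\nu$, $\mu\rhd\nu$ and $\nu\uplus(\mu\vdash\nu)$ exist and do not depend on the choices in their definitions, $\mu\vdash\nu\in\Sigma(\mathcal B)$, and $$\mu\rhd\nu=\nu\uplus(\mu\vdash\nu).$$ If $\mu$ and $\nu$ are distributions of selfadjoint elements, then so is $\mu\vdash\nu$, and for all $n\in\mathbb N$ and $b\in\mathbb H_n^+$ the elements $G_{\nu,n}(b)$ and $G_{\mu\vdash\nu,n}(b)$ are invertible, $F_{\nu,n}(b)\in\mathbb H_n^+$, $G_{\mu,n}(F_{\nu,n}(b))$ is invertible, and $$F_{\mu\vdash\nu,n}(b)=F_{\mu,n}(F_{\nu,n}(b))-F_{\nu,n}(b)+b .$$ -/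

import Mathlib

open scoped MulOpposite

universe u

namespace OpValued

section Polynomials

variable (B : Type u) [CStarAlgebra B]

/-- The relations that make the letters `some b` into a copy of the algebra `B`. -/
inductive PolyRel : FreeAlgebra ℂ (Option B) → FreeAlgebra ℂ (Option B) → Prop
  | add (b c : B) : PolyRel (FreeAlgebra.ι ℂ (some (b + c)))
      (FreeAlgebra.ι ℂ (some b) + FreeAlgebra.ι ℂ (some c))
  | mul (b c : B) : PolyRel (FreeAlgebra.ι ℂ (some (b * c)))
      (FreeAlgebra.ι ℂ (some b) * FreeAlgebra.ι ℂ (some c))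
  | scalar (z : ℂ) : PolyRel (FreeAlgebra.ι ℂ (some (algebraMap ℂ B z)))
      (algebraMap ℂ (FreeAlgebra ℂ (Option B)) z)

/-- `B⟨X⟩`: the unital algebra freely generated by the algebra `B` and an indeterminate `X`
(the letter `none`). -/
abbrev NCPoly : Type u := RingQuot (PolyRel B)

/-- `B`-valued distributions are linear maps `B⟨X⟩ → B`. -/
abbrev Distribution : Type u := NCPoly B →ₗ[ℂ] B

variable {B}

/-- Substitution `P ↦ P(a)`, where the coefficients in `B` act through `f : B → A`. -/
noncomputable def evalPoly {A : Type*} [Ring A] [Algebra ℂ A] (f : B →ₐ[ℂ] A) (a : A) :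
    NCPoly B →ₐ[ℂ] A :=
  RingQuot.liftAlgHom ℂ
    ⟨FreeAlgebra.lift ℂ (fun o : Option B => o.elim a f), by
      intro p q h
      cases h with
      | add b c => simp
      | mul b c => simp
      | scalar z => simp⟩

end Polynomials

section Spaces

variable (B : Type u) [CStarAlgebra B] [PartialOrder B] [StarOrderedRing B]

/-- A `C⋆`-operator `B`-valued probability space: a unital `C⋆`-algebra `A` that contains `B`
(through the unital `⋆`-homomorphism `incl`, which is injective because of `expect_incl`) with a
positive conditional expectation onto `B`. -/
structure ProbSpace where
  A : Type u
  [cstar : CStarAlgebra A]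
  incl : B →⋆ₐ[ℂ] A
  expect : A →ₗ[ℂ] B
  expect_bimodule : ∀ (b₁ b₂ : B) (a : A),
    expect (incl b₁ * a * incl b₂) = b₁ * expect a * b₂
  expect_incl : ∀ b : B, expect (incl b) = b
  expect_nonneg : ∀ a : A, 0 ≤ expect (a * star a)

attribute [instance] ProbSpace.cstar

variable {B}

/-- The distribution `P ↦ E[P(a)]` of a random variable `a`. -/
noncomputable def ProbSpace.dist (S : ProbSpace B) (a : S.A) : Distribution B :=
  S.expect ∘ₗ (evalPoly S.incl.toAlgHom a).toLinearMap

/-- `μ` is the distribution of an element of a `C⋆`-operator `B`-valued probability space. -/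
def IsCStarDist (μ : Distribution B) : Prop :=
  ∃ (S : ProbSpace B) (a : S.A), S.dist a = μ

/-- `μ` is the distribution of a selfadjoint element of a `C⋆`-operator `B`-valued probability
space. -/
def IsSelfAdjointDist (μ : Distribution B) : Prop :=
  ∃ (S : ProbSpace B) (a : S.A), IsSelfAdjoint a ∧ S.dist a = μ

/-! ### Boolean and monotone independence -/

/-- The non-unital `B`-`B`-bimodule subalgebra generated by `x`. -/
noncomputable def ProbSpace.alg₀ (S : ProbSpace B) (x : S.A) : NonUnitalSubalgebra ℂ S.A :=
  NonUnitalAlgebra.adjoin ℂ {a | ∃ b c : B, a = S.incl b * x * S.incl c}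

/-- Boolean independence of the random variables `x i`: the expectation is multiplicative on
products of elements of the subalgebras `alg₀ (x i)` in which consecutive factors come from
different subalgebras. -/
def ProbSpace.BooleanIndep (S : ProbSpace B) {I : Type} (x : I → S.A) : Prop :=
  ∀ l : List (I × S.A), (∀ p ∈ l, p.2 ∈ S.alg₀ (x p.1)) →
    l.IsChain (fun p q => p.1 ≠ q.1) →
    S.expect (l.map Prod.snd).prod = (l.map (fun p => S.expect p.2)).prod

/-- Monotone independence of the random variables `x i`: a factor whose index is larger than the
indices of its neighbours (a first or last factor has only one neighbour) can be replaced by its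
expectation. -/
def ProbSpace.MonotoneIndep (S : ProbSpace B) {I : Type} [LinearOrder I] (x : I → S.A) : Prop :=
  ∀ (l r : List (I × S.A)) (i : I) (a : S.A),
    (∀ p ∈ l, p.2 ∈ S.alg₀ (x p.1)) → (∀ p ∈ r, p.2 ∈ S.alg₀ (x p.1)) → a ∈ S.alg₀ (x i) →
    (∀ p ∈ l.getLast?, p.1 < i) → (∀ p ∈ r.head?, p.1 < i) →
    S.expect ((l.map Prod.snd).prod * a * (r.map Prod.snd).prod) =
      S.expect ((l.map Prod.snd).prod * S.incl (S.expect a) * (r.map Prod.snd).prod)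

/-- `τ = μ ⊎ ν`. -/
def IsBooleanConv (μ ν τ : Distribution B) : Prop :=
  ∃ (S : ProbSpace B) (x y : S.A), S.dist x = μ ∧ S.dist y = ν ∧
    S.BooleanIndep ![x, y] ∧ S.dist (x + y) = τ

/-- `τ = μ ▷ ν`. -/
def IsMonotoneConv (μ ν τ : Distribution B) : Prop :=
  ∃ (S : ProbSpace B) (x y : S.A), S.dist x = μ ∧ S.dist y = ν ∧
    S.MonotoneIndep ![x, y] ∧ S.dist (x + y) = τ

/-! ### Matricial Cauchy transforms -/

/-- `H_n⁺`: the matrices `b` over `B` with `(b - b⋆) / i ≥ ε 1` for some `ε > 0`. -/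
def upperHalf (B : Type u) [CStarAlgebra B] [PartialOrder B] [StarOrderedRing B] (n : ℕ) :
    Set (CStarMatrix (Fin n) (Fin n) B) :=
  {b | ∃ ε : ℝ, 0 < ε ∧ (ε : ℂ) • (1 : CStarMatrix (Fin n) (Fin n) B) ≤
    (Complex.I)⁻¹ • (b - star b)}

/-- The `n`-th Cauchy transform `G_{a,n}(b) = (E ⊗ I_n)[(b - a ⊗ I_n)⁻¹]` of the distribution
of `a`. -/
noncomputable def ProbSpace.cauchy (S : ProbSpace B) (a : S.A) (n : ℕ)
    (b : CStarMatrix (Fin n) (Fin n) B) : CStarMatrix (Fin n) (Fin n) B :=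
  (Ring.inverse (b.map S.incl -
    CStarMatrix.ofMatrix (Matrix.diagonal fun _ : Fin n => a))).map S.expect

/-- The `n`-th reciprocal Cauchy transform `F_{a,n}(b) = G_{a,n}(b)⁻¹`. -/
noncomputable def ProbSpace.recipCauchy (S : ProbSpace B) (a : S.A) (n : ℕ)
    (b : CStarMatrix (Fin n) (Fin n) B) : CStarMatrix (Fin n) (Fin n) B :=
  Ring.inverse (S.cauchy a n b)

end Spaces

/-! ### Hilbert bimodules with a specified vector -/

section Bimodules

variable (B : Type u) [CStarAlgebra B] [PartialOrder B]

/-- A `B`-`B` Hilbert bimodule (a right Hilbert `C⋆`-module over `B` on which `B` also acts from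
the left, by adjointable operators) with a specified vector `vac`, called `ξ` below, such that
`⟨ξ, b ξ⟩ = b`. The right action of `b` is the action of `op b`. -/
structure PointedBimodule where
  carrier : Type u
  [group : NormedAddCommGroup carrier]
  [space : NormedSpace ℂ carrier]
  [complete : CompleteSpace carrier]
  [left : Module B carrier]
  [right : Module Bᵐᵒᵖ carrier]
  [comm : SMulCommClass B Bᵐᵒᵖ carrier]
  [towerLeft : IsScalarTower ℂ B carrier]
  [towerRight : IsScalarTower ℂ Bᵐᵒᵖ carrier]
  inner : carrier → carrier → B
  inner_add_left : ∀ x y z, inner (x + y) z = inner x z + inner y z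
  inner_smul_right : ∀ (x y : carrier) (b : B), inner x (MulOpposite.op b • y) = inner x y * b
  star_inner : ∀ x y, star (inner y x) = inner x y
  inner_self_nonneg : ∀ x, 0 ≤ inner x x
  inner_self_eq_zero : ∀ x, inner x x = 0 → x = 0
  inner_smul_left : ∀ (x y : carrier) (b : B), inner (b • x) y = inner x (star b • y)
  norm_eq : ∀ x, ‖x‖ = Real.sqrt ‖inner x x‖
  vac : carrier
  inner_vac : ∀ b : B, inner vac (b • vac) = b

attribute [instance] PointedBimodule.group PointedBimodule.space PointedBimodule.complete
  PointedBimodule.left PointedBimodule.right PointedBimodule.comm PointedBimodule.towerLeft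
  PointedBimodule.towerRight

namespace PointedBimodule

variable {B} (M : PointedBimodule B)

theorem inner_add_right (x y z : M.carrier) :
    M.inner x (y + z) = M.inner x y + M.inner x z := by
  rw [← M.star_inner, M.inner_add_left, star_add, M.star_inner, M.star_inner]

theorem inner_smul_complex_right (x y : M.carrier) (z : ℂ) :
    M.inner x (z • y) = z • M.inner x y := by
  have : z • y = MulOpposite.op (algebraMap ℂ B z) • y := by
    rw [← MulOpposite.algebraMap_apply, algebraMap_smul]
  rw [this, M.inner_smul_right, ← Algebra.commutes, Algebra.smul_def]

theorem inner_zero_right (x : M.carrier) : M.inner x 0 = 0 := by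
  simpa using M.inner_smul_complex_right x 0 0

theorem inner_sub_right (x y z : M.carrier) :
    M.inner x (y - z) = M.inner x y - M.inner x z := by
  rw [eq_sub_iff_add_eq, ← M.inner_add_right, sub_add_cancel]

theorem inner_sub_left (x y z : M.carrier) :
    M.inner (x - y) z = M.inner x z - M.inner y z := by
  rw [eq_sub_iff_add_eq, ← M.inner_add_left, sub_add_cancel]

theorem inner_op_smul_left (x y : M.carrier) (b : B) :
    M.inner (MulOpposite.op b • x) y = star b * M.inner x y := by
  rw [← M.star_inner, M.inner_smul_right, star_mul, M.star_inner]

theorem inner_vac_vac : M.inner M.vac M.vac = 1 := by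
  simpa using M.inner_vac 1

theorem vac_comm (b : B) : MulOpposite.op b • M.vac = b • M.vac := by
  rw [← sub_eq_zero]
  apply M.inner_self_eq_zero
  rw [M.inner_sub_left, M.inner_sub_right, M.inner_sub_right, M.inner_smul_right,
    M.inner_smul_right, M.inner_op_smul_left, M.inner_op_smul_left, M.inner_smul_left,
    M.inner_smul_left, M.inner_vac, M.inner_vac_vac, M.inner_vac, smul_smul, M.inner_vac]
  simp

/-- `M°`, the orthogonal complement of `B ξ`. -/
def circ : Submodule B M.carrier where
  carrier := {m | ∀ b : B, M.inner (b • M.vac) m = 0}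
  add_mem' := by
    intro x y hx hy b
    rw [M.inner_add_right, hx b, hy b, add_zero]
  zero_mem' := fun b => M.inner_zero_right _
  smul_mem' := by
    intro c x hx b
    have h := M.inner_smul_left (b • M.vac) x (star c)
    rw [star_star] at h
    rw [← h, smul_smul]
    exact hx _

/-- The component `y - ξ ⟨ξ, y⟩` of `y` in `M°`. -/
def toCirc (y : M.carrier) : M.circ :=
  ⟨y - MulOpposite.op (M.inner M.vac y) • M.vac, by
    intro b
    rw [M.inner_sub_right, M.inner_smul_right, ← M.vac_comm, M.inner_op_smul_left,
      M.inner_op_smul_left, M.inner_vac_vac, mul_one, sub_self]⟩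

/-- `L(M)`: the adjointable operators on `M`. -/
def adjointable : Subalgebra ℂ (Module.End ℂ M.carrier) where
  carrier := {t | ∃ s : Module.End ℂ M.carrier, ∀ x y, M.inner (t x) y = M.inner x (s y)}
  add_mem' := by
    rintro t t' ⟨s, hs⟩ ⟨s', hs'⟩
    exact ⟨s + s', fun x y => by simp [M.inner_add_left, M.inner_add_right, hs, hs']⟩
  mul_mem' := by
    rintro t t' ⟨s, hs⟩ ⟨s', hs'⟩
    exact ⟨s' * s, fun x y => by simp [hs, hs']⟩
  algebraMap_mem' := by
    intro z
    refine ⟨algebraMap ℂ _ (star z), fun x y => ?_⟩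
    rw [Module.algebraMap_end_apply, Module.algebraMap_end_apply, ← M.star_inner,
      M.inner_smul_complex_right, M.inner_smul_complex_right, star_smul, M.star_inner]

/-- `φ_ξ(t) = ⟨ξ, t ξ⟩`. -/
def vacState : Module.End ℂ M.carrier →ₗ[ℂ] B where
  toFun t := M.inner M.vac (t M.vac)
  map_add' s t := by simp [M.inner_add_right]
  map_smul' z t := by simp [M.inner_smul_complex_right]

/-- The distribution of `x ∈ L(M)` in `(L(M), φ_ξ)`, where `B ⊆ L(M)` acts from the left. -/
noncomputable def dist (x : M.adjointable) : Distribution B :=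
  M.vacState ∘ₗ (evalPoly (Algebra.lsmul ℂ ℂ M.carrier) (x : Module.End ℂ M.carrier)).toLinearMap

end PointedBimodule

end Bimodules

/-! ### The reduced free product -/

namespace FreeProd

variable {B : Type u} [CStarAlgebra B] [PartialOrder B] {I : Type} (M : I → PointedBimodule B)

/-- A tensor factor: an index `i` and a vector of `M_i°`. -/
abbrev Letter : Type u := Σ i : I, (M i).circ

/-- Formal elementary tensors `m₁ ⊗ ⋯ ⊗ m_k` with `m_j ∈ M_{i_j}°` and `i₁ ≠ i₂ ≠ ⋯ ≠ i_k`. The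
empty list stands for the vector `ξ`. -/
abbrev Tensor : Type u := {l : List (Letter M) // l.IsChain (fun p q => p.1 ≠ q.1)}

/-- The word `(i₁, …, i_k)` of an elementary tensor. -/
def word (t : Tensor M) : List I := t.1.map Sigma.fst

/-- Formal sums `∑ t b_t` of elementary tensors with coefficients in `B` on the right. -/
abbrev Formal : Type u := Tensor M →₀ B

/-- The elementary tensor `ξ`. -/
def emptyTensor : Tensor M := ⟨[], List.isChain_nil⟩

variable {M}

/-- The right `B`-linear operator on formal sums with prescribed values on elementary tensors. -/
noncomputable def extend (f : Tensor M → Formal M) : Formal M →ₗ[Bᵐᵒᵖ] Formal M where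
  toFun v := v.sum fun t c => MulOpposite.op c • f t
  map_add' v w := by
    rw [Finsupp.sum_add_index'] <;> intros <;> simp [add_smul]
  map_smul' b v := by
    rw [Finsupp.sum_smul_index' (by simp), RingHom.id_apply, Finsupp.smul_sum]
    refine Finsupp.sum_congr fun t _ => ?_
    rw [smul_smul]
    rfl

theorem extend_single (f : Tensor M → Formal M) (t : Tensor M) (c : B) :
    extend f (Finsupp.single t c) = MulOpposite.op c • f t := by
  simp [extend]

/-- `b ξ = ξ b` and `b (m₁ ⊗ m₂ ⊗ ⋯) = (b m₁) ⊗ m₂ ⊗ ⋯`. -/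
noncomputable def leftTensor (b : B) : Tensor M → Formal M
  | ⟨[], h⟩ => Finsupp.single ⟨[], h⟩ b
  | ⟨⟨i, m⟩ :: t, h⟩ => Finsupp.single ⟨⟨i, b • m⟩ :: t, by
      rw [List.isChain_cons] at h ⊢; exact h⟩ 1

theorem extend_leftTensor (b c : B) (t : Tensor M) :
    extend (leftTensor b) (leftTensor c t) = leftTensor (b * c) t := by
  obtain ⟨t, ht⟩ := t
  cases t with
  | nil => simp [leftTensor, extend_single]
  | cons q t => simp [leftTensor, extend_single, mul_smul]

variable [DecidableEq I]

/-- `kernel s c t = ⟨s, c t⟩`, by the recursion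
`⟨m ⊗ s, c (m' ⊗ t)⟩ = ⟨s, ⟨m, c m'⟩ t⟩` and `⟨ξ, c ξ⟩ = c`; elementary tensors with different
words are orthogonal. -/
def kernel : List (Letter M) → B → List (Letter M) → B
  | [], c, [] => c
  | ⟨i, m⟩ :: s, c, ⟨j, m'⟩ :: t =>
      if h : j = i then
        kernel s ((M i).inner m (c • (h ▸ m' : (M i).circ))) t
      else 0
  | _, _, _ => 0

theorem kernel_cons_same (i : I) (m m' : (M i).circ) (s t : List (Letter M)) (c : B) :
    kernel (⟨i, m⟩ :: s) c (⟨i, m'⟩ :: t) = kernel s ((M i).inner m (c • m')) t := by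
  simp [kernel]

theorem kernel_cons_ne {i j : I} (h : j ≠ i) (m : (M i).circ) (m' : (M j).circ)
    (s t : List (Letter M)) (c : B) : kernel (⟨i, m⟩ :: s) c (⟨j, m'⟩ :: t) = 0 := by
  simp [kernel, h]

@[simp] theorem kernel_nil_nil (c : B) : kernel ([] : List (Letter M)) c [] = c := by
  simp [kernel]

@[simp] theorem kernel_nil_cons (c : B) (p : Letter M) (t : List (Letter M)) :
    kernel [] c (p :: t) = 0 := by
  simp [kernel]

@[simp] theorem kernel_cons_nil (c : B) (p : Letter M) (t : List (Letter M)) :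
    kernel (p :: t) c [] = 0 := by
  simp [kernel]

theorem star_kernel (s t : List (Letter M)) (c : B) :
    star (kernel s c t) = kernel t (star c) s := by
  induction s generalizing c t with
  | nil => cases t <;> simp
  | cons p s ih =>
    cases t with
    | nil => simp
    | cons q t =>
      obtain ⟨i, m⟩ := p
      obtain ⟨j, m'⟩ := q
      by_cases h : j = i
      · subst h
        rw [kernel_cons_same, kernel_cons_same, ih, (M j).star_inner, (M j).inner_smul_left]
      · rw [kernel_cons_ne h, kernel_cons_ne (Ne.symm h), star_zero]

theorem kernel_add (s t : List (Letter M)) (c d : B) :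
    kernel s (c + d) t = kernel s c t + kernel s d t := by
  induction s generalizing c d t with
  | nil => cases t <;> simp
  | cons p s ih =>
    cases t with
    | nil => simp
    | cons q t =>
      obtain ⟨i, m⟩ := p
      obtain ⟨j, m'⟩ := q
      by_cases h : j = i
      · subst h
        simp only [kernel_cons_same, add_smul, (M j).inner_add_right, ih]
      · simp [kernel_cons_ne h]

theorem kernel_zero (s t : List (Letter M)) : kernel s 0 t = 0 := by
  have h := kernel_add s t 0 0
  rw [add_zero] at h
  exact left_eq_add.mp h

theorem kernel_smul (s t : List (Letter M)) (z : ℂ) (c : B) :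
    kernel s (z • c) t = z • kernel s c t := by
  induction s generalizing c t with
  | nil => cases t <;> simp
  | cons p s ih =>
    cases t with
    | nil => simp
    | cons q t =>
      obtain ⟨i, m⟩ := p
      obtain ⟨j, m'⟩ := q
      by_cases h : j = i
      · subst h
        simp only [kernel_cons_same, smul_assoc, (M j).inner_smul_complex_right, ih]
      · simp [kernel_cons_ne h]

theorem kernel_eq_zero_of_word_ne (s t : List (Letter M)) (c : B)
    (h : s.map Sigma.fst ≠ t.map Sigma.fst) : kernel s c t = 0 := by
  induction s generalizing c t with
  | nil => cases t <;> simp_all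
  | cons p s ih =>
    cases t with
    | nil => simp
    | cons q t =>
      obtain ⟨i, m⟩ := p
      obtain ⟨j, m'⟩ := q
      by_cases hji : j = i
      · subst hji
        rw [kernel_cons_same]
        exact ih _ _ (by simpa using h)
      · exact kernel_cons_ne hji ..

/-- The `B`-valued sesquilinear form on formal sums:
`⟨∑ s b_s, ∑ t c_t⟩ = ∑ b_s⋆ ⟨s, t⟩ c_t`. -/
noncomputable def form (v w : Formal M) : B :=
  v.sum fun s b => w.sum fun t c => star b * kernel s.1 1 t.1 * c

theorem form_add_left (v v' w : Formal M) : form (v + v') w = form v w + form v' w := by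
  unfold form
  rw [Finsupp.sum_add_index'] <;> intros <;> simp [add_mul, Finsupp.sum_add]

theorem form_add_right (v w w' : Formal M) : form v (w + w') = form v w + form v w' := by
  unfold form
  rw [← Finsupp.sum_add]
  refine Finsupp.sum_congr fun s _ => ?_
  rw [Finsupp.sum_add_index'] <;> intros <;> simp [mul_add]

@[simp] theorem form_zero_left (w : Formal M) : form 0 w = 0 := by simp [form]

@[simp] theorem form_zero_right (v : Formal M) : form v 0 = 0 := by simp [form]

theorem form_single (s t : Tensor M) (b c : B) :
    form (Finsupp.single s b) (Finsupp.single t c) = star b * kernel s.1 1 t.1 * c := by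
  simp [form]

theorem star_form (v w : Formal M) : star (form v w) = form w v := by
  induction v using Finsupp.induction_linear with
  | zero => simp
  | add v v' h h' => rw [form_add_left, form_add_right, star_add, h, h']
  | single s b =>
    induction w using Finsupp.induction_linear with
    | zero => simp
    | add w w' h h' => rw [form_add_left, form_add_right, star_add, h, h']
    | single t c => simp [form_single, star_kernel, mul_assoc]

theorem form_op_smul_right (v w : Formal M) (b : B) :
    form v (MulOpposite.op b • w) = form v w * b := by
  induction w using Finsupp.induction_linear with
  | zero => simp
  | add w w' h h' => rw [smul_add, form_add_right, form_add_right, h, h', add_mul]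
  | single t c =>
    induction v using Finsupp.induction_linear with
    | zero => simp
    | add v v' h h' => rw [form_add_left, form_add_left, h, h', add_mul]
    | single s d =>
      rw [Finsupp.smul_single, form_single, form_single, op_smul_eq_mul, ← mul_assoc]

variable (M) in
/-- The null vectors of the form. (The form is positive, so that these are the `v` with
`⟨v, v⟩ = 0`.) -/
def null : Submodule Bᵐᵒᵖ (Formal M) where
  carrier := {v | ∀ w, form w v = 0}
  add_mem' hv hv' w := by rw [form_add_right, hv w, hv' w, add_zero]
  zero_mem' w := form_zero_right w
  smul_mem' b v hv w := by
    have h := form_op_smul_right w v b.unop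
    rwa [MulOpposite.op_unop, hv w, zero_mul] at h

variable (M) in
/-- The reduced free product
`B ξ ⊕ ⨁_{k ≥ 1} ⨁_{i₁ ≠ ⋯ ≠ i_k} M_{i₁}° ⊗_B ⋯ ⊗_B M_{i_k}°`: finite sums of elementary tensors
modulo null vectors. The completion of this inner product bimodule is not needed to speak of
distributions, since the operators below leave the span of the elementary tensors invariant. -/
abbrev Space : Type u := Formal M ⧸ null M

theorem form_extend_adjoint (f g : Tensor M → Formal M)
    (h : ∀ s t, form (Finsupp.single s 1) (f t) = form (g s) (Finsupp.single t 1))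
    (v w : Formal M) : form v (extend f w) = form (extend g v) w := by
  induction w using Finsupp.induction_linear with
  | zero => simp
  | add w w' hw hw' => rw [map_add, form_add_right, form_add_right, hw, hw']
  | single t c =>
    induction v using Finsupp.induction_linear with
    | zero => simp
    | add v v' hv hv' => rw [map_add, form_add_left, form_add_left, hv, hv']
    | single s d =>
      have e : ∀ (r : Tensor M) (b : B),
          Finsupp.single r b = MulOpposite.op b • Finsupp.single r (1 : B) := by simp
      rw [extend_single, extend_single, form_op_smul_right, e t c, form_op_smul_right,
        ← star_form _ (Finsupp.single s d), ← star_form _ (MulOpposite.op d • g s), e s d,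
        form_op_smul_right, form_op_smul_right, star_mul, star_mul, star_form, star_form, h]

theorem mk_eq_mk {v w : Formal M}
    (h : ∀ s, form (Finsupp.single s 1) v = form (Finsupp.single s 1) w) :
    (null M).mkQ v = (null M).mkQ w := by
  rw [Submodule.mkQ_apply, Submodule.mkQ_apply, Submodule.Quotient.eq]
  intro u
  have hs : ∀ u, form u (v - w) = form u v - form u w := fun u => by
    rw [eq_sub_iff_add_eq, ← form_add_right, sub_add_cancel]
  rw [hs, sub_eq_zero]
  induction u using Finsupp.induction_linear with
  | zero => simp
  | add u u' hu hu' => rw [form_add_left, form_add_left, hu, hu']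
  | single s d =>
    have e : Finsupp.single s d = MulOpposite.op d • Finsupp.single s (1 : B) := by simp
    rw [e, ← star_form v, ← star_form w, form_op_smul_right, form_op_smul_right, star_mul,
      star_mul, star_form, star_form, h]

theorem form_congr_right {v w : Formal M} (h : (null M).mkQ v = (null M).mkQ w) (u : Formal M) :
    form u v = form u w := by
  rw [Submodule.mkQ_apply, Submodule.mkQ_apply, Submodule.Quotient.eq] at h
  have := h u
  rw [← sub_add_cancel v w, form_add_right, this, zero_add]

theorem form_congr_left {v w : Formal M} (h : (null M).mkQ v = (null M).mkQ w) (u : Formal M) :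
    form v u = form w u := by
  rw [← star_form, form_congr_right h, star_form]

/-- An operator on formal sums that has an adjoint for the form acts on the free product. -/
noncomputable def descend (f : Formal M →ₗ[Bᵐᵒᵖ] Formal M)
    (h : ∃ g : Formal M → Formal M, ∀ v w, form v (f w) = form (g v) w) :
    Module.End Bᵐᵒᵖ (Space M) :=
  (null M).mapQ (null M) f (by
    obtain ⟨g, hg⟩ := h
    intro v hv w
    rw [hg, hv])

/-- The inner product of the free product. -/
noncomputable def inner (x y : Space M) : B :=
  Quotient.liftOn₂' x y form (by
    intro v w v' w' h h'
    have e : (null M).mkQ v = (null M).mkQ v' := Quotient.sound' h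
    have e' : (null M).mkQ w = (null M).mkQ w' := Quotient.sound' h'
    rw [form_congr_left e, form_congr_right e'])

theorem form_leftTensor (b : B) (s t : Tensor M) :
    form (Finsupp.single s 1) (leftTensor b t) = kernel s.1 b t.1 := by
  obtain ⟨s, hs⟩ := s
  obtain ⟨t, ht⟩ := t
  cases t with
  | nil => cases s <;> simp [leftTensor, form_single]
  | cons q t =>
    obtain ⟨j, m'⟩ := q
    cases s with
    | nil => simp [leftTensor, form_single]
    | cons p s =>
      obtain ⟨i, m⟩ := p
      by_cases h : j = i
      · subst h
        simp [leftTensor, form_single, kernel_cons_same]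
      · simp [leftTensor, form_single, kernel_cons_ne h]

theorem leftTensor_adjoint (b : B) (s t : Tensor M) :
    form (Finsupp.single s 1) (leftTensor b t) =
      form (leftTensor (star b) s) (Finsupp.single t 1) := by
  rw [form_leftTensor, ← star_form, form_leftTensor, star_kernel, star_star]

theorem form_leftTensor_leftTensor (b c : B) (s t : Tensor M) :
    form (leftTensor b s) (leftTensor c t) = kernel s.1 (star b * c) t.1 := by
  have h := form_extend_adjoint (leftTensor (star b)) (leftTensor b)
    (fun s t => by rw [leftTensor_adjoint, star_star]) (Finsupp.single s 1) (leftTensor c t)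
  rw [extend_leftTensor, form_leftTensor, extend_single] at h
  simpa using h.symm

/-- The operator of left multiplication by `b`. -/
noncomputable def leftMul (b : B) : Module.End Bᵐᵒᵖ (Space M) :=
  descend (extend (leftTensor b))
    ⟨extend (leftTensor (star b)), form_extend_adjoint _ _ (leftTensor_adjoint b)⟩

theorem end_ext {f g : Module.End Bᵐᵒᵖ (Space M)}
    (h : ∀ t, f ((null M).mkQ (Finsupp.single t 1)) = g ((null M).mkQ (Finsupp.single t 1))) :
    f = g := by
  apply Submodule.linearMap_qext
  apply LinearMap.ext
  intro v
  induction v using Finsupp.induction_linear with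
  | zero => simp
  | add v w hv hw => rw [map_add, map_add, hv, hw]
  | single t c =>
    have e : Finsupp.single t c = MulOpposite.op c • Finsupp.single t (1 : B) := by simp
    rw [e, map_smul, map_smul]
    exact congrArg _ (h t)

theorem leftMul_mk (b : B) (v : Formal M) :
    leftMul b ((null M).mkQ v) = (null M).mkQ (extend (leftTensor b) v) := rfl

theorem smul_mk (z : ℂ) (v : Formal M) :
    z • (null M).mkQ v = (null M).mkQ (MulOpposite.op (algebraMap ℂ B z) • v) := by
  rw [map_smul, ← MulOpposite.algebraMap_apply, algebraMap_smul]

theorem kernel_algebraMap (s t : List (Letter M)) (z : ℂ) :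
    kernel s (algebraMap ℂ B z) t = kernel s 1 t * algebraMap ℂ B z := by
  rw [Algebra.algebraMap_eq_smul_one, kernel_smul, mul_smul_comm, mul_one]

/-- The left action of `B` on the free product. -/
noncomputable def leftHom : B →ₐ[ℂ] Module.End Bᵐᵒᵖ (Space M) where
  toFun := leftMul
  map_one' := end_ext fun t => by
    rw [leftMul_mk, extend_single]
    refine mk_eq_mk fun s => ?_
    simp [form_leftTensor, form_single]
  map_mul' b c := end_ext fun t => by
    rw [Module.End.mul_apply, leftMul_mk, leftMul_mk, leftMul_mk, extend_single, extend_single]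
    simp [extend_leftTensor]
  map_zero' := end_ext fun t => by
    rw [leftMul_mk, extend_single, LinearMap.zero_apply, ← map_zero (null M).mkQ]
    refine mk_eq_mk fun s => ?_
    simp [form_leftTensor, kernel_zero]
  map_add' b c := end_ext fun t => by
    rw [LinearMap.add_apply, leftMul_mk, leftMul_mk, leftMul_mk, extend_single, extend_single,
      extend_single, ← map_add]
    refine mk_eq_mk fun s => ?_
    simp [form_leftTensor, kernel_add, form_add_right]
  commutes' z := end_ext fun t => by
    rw [leftMul_mk, extend_single, Module.algebraMap_end_apply, smul_mk]
    refine mk_eq_mk fun s => ?_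
    rw [form_op_smul_right, form_op_smul_right, form_leftTensor, form_single,
      kernel_algebraMap]
    simp

/-! #### The embeddings of the operators on the factors -/

/-- Elementary tensors whose first factor is not in `M_i°`. They span `M(i)`. -/
abbrev TensorOff (M : I → PointedBimodule B) (i : I) : Type u :=
  {t : Tensor M // ∀ p ∈ t.1.head?, i ≠ p.1}

/-- `V_i⁻¹` on elementary tensors: `t ↦ y ⊗ t'` with `y ∈ M_i` and `t' ∈ M(i)`, where `y = m₁` if
`t = m₁ ⊗ t'` with `m₁ ∈ M_i°`, and `y = ξ_i`, `t' = t` otherwise. -/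
def split (i : I) : Tensor M → (M i).carrier × TensorOff M i
  | ⟨[], h⟩ => ((M i).vac, ⟨⟨[], h⟩, by simp⟩)
  | ⟨⟨j, m⟩ :: t, h⟩ =>
      if e : j = i then
        (((e ▸ m : (M i).circ) : (M i).carrier), ⟨⟨t, (List.isChain_cons.mp h).2⟩, by
          subst e; exact (List.isChain_cons.mp h).1⟩)
      else ((M i).vac, ⟨⟨⟨j, m⟩ :: t, h⟩, by simpa using Ne.symm e⟩)

/-- `V_i`: `y ⊗ t ↦ ⟨ξ_i, y⟩ t + y° ⊗ t`, where `y = ξ_i ⟨ξ_i, y⟩ + y°` with `y° ∈ M_i°`. -/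
noncomputable def join (i : I) (y : (M i).carrier) (t : TensorOff M i) : Formal M :=
  leftTensor ((M i).inner (M i).vac y) t.1 +
    Finsupp.single ⟨⟨i, (M i).toCirc y⟩ :: t.1.1, List.isChain_cons.mpr ⟨t.2, t.1.2⟩⟩ 1

theorem kernel_eq_zero_of_off (i : I) (m : (M i).circ) (s t : List (Letter M)) (c : B)
    (ht : ∀ p ∈ t.head?, i ≠ p.1) : kernel (⟨i, m⟩ :: s) c t = 0 := by
  cases t with
  | nil => simp
  | cons q t => exact kernel_cons_ne (Ne.symm (ht q (by simp))) ..

theorem form_single_leftTensor (i : I) (m : (M i).circ) (s : List (Letter M)) (h) (c d : B)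
    (t : TensorOff M i) :
    form (Finsupp.single ⟨⟨i, m⟩ :: s, h⟩ d) (leftTensor c t.1) = 0 := by
  have e : Finsupp.single (⟨⟨i, m⟩ :: s, h⟩ : Tensor M) d =
    MulOpposite.op d • Finsupp.single (⟨⟨i, m⟩ :: s, h⟩ : Tensor M) (1 : B) := by simp
  rw [e, ← star_form, form_op_smul_right, ← star_form, form_leftTensor,
    kernel_eq_zero_of_off i m s _ _ t.2]
  simp

theorem form_join (i : I) (y y' : (M i).carrier) (s t : TensorOff M i) :
    form (join i y s) (join i y' t) = kernel s.1.1 ((M i).inner y y') t.1.1 := by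
  have h : (M i).inner y y' = star ((M i).inner (M i).vac y) * (M i).inner (M i).vac y' +
      (M i).inner ((M i).toCirc y) ((M i).toCirc y') := by
    simp only [PointedBimodule.toCirc, PointedBimodule.inner_sub_left,
      PointedBimodule.inner_sub_right, PointedBimodule.inner_smul_right,
      PointedBimodule.inner_op_smul_left, PointedBimodule.inner_vac_vac,
      PointedBimodule.star_inner]
    simp
  rw [join, join, form_add_left, form_add_right, form_add_right, form_leftTensor_leftTensor,
    form_single_leftTensor, ← star_form (Finsupp.single _ _) (leftTensor _ _),
    form_single_leftTensor, form_single, h, kernel_add]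
  simp [kernel_cons_same]

theorem mk_join_split (i : I) (t : Tensor M) :
    (null M).mkQ (join i (split i t).1 (split i t).2) = (null M).mkQ (Finsupp.single t 1) := by
  have h0 : ∀ (s t : List (Letter M)) (c : B), kernel s c (⟨i, 0⟩ :: t) = 0 := by
    intro s t c
    cases s with
    | nil => simp
    | cons p s =>
      obtain ⟨j, m⟩ := p
      by_cases h : i = j
      · subst h
        simp [kernel_cons_same, PointedBimodule.inner_zero_right, kernel_zero]
      · exact kernel_cons_ne h ..
  have hv : (M i).toCirc (M i).vac = 0 := by
    ext
    simp [PointedBimodule.toCirc, PointedBimodule.inner_vac_vac]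
  refine mk_eq_mk fun s => ?_
  obtain ⟨t, ht⟩ := t
  cases t with
  | nil =>
    simp [split, join, form_add_right, form_leftTensor, form_single, hv, h0,
      PointedBimodule.inner_vac_vac]
  | cons q t =>
    obtain ⟨j, m⟩ := q
    by_cases e : j = i
    · subst e
      have hm : (M j).inner (M j).vac m = 0 := by simpa using m.2 1
      have hc : (M j).toCirc (m : (M j).carrier) = m := by
        ext
        simp [PointedBimodule.toCirc, hm]
      simp [split, join, form_add_right, form_leftTensor, form_single, hm, hc, kernel_zero]
    · simp [split, e, join, form_add_right, form_leftTensor, form_single, hv, h0,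
        PointedBimodule.inner_vac_vac]

/-- `V_i (a ⊗ 1) V_i⁻¹` on elementary tensors. -/
noncomputable def lambdaTensor (i : I) (a : Module.End ℂ (M i).carrier) (t : Tensor M) :
    Formal M :=
  join i (a (split i t).1) (split i t).2

theorem lambdaTensor_adjoint (i : I) (a a' : Module.End ℂ (M i).carrier)
    (h : ∀ x y, (M i).inner (a x) y = (M i).inner x (a' y)) (s t : Tensor M) :
    form (Finsupp.single s 1) (lambdaTensor i a t) =
      form (lambdaTensor i a' s) (Finsupp.single t 1) := by
  rw [← form_congr_left (mk_join_split i s), ← form_congr_right (mk_join_split i t),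
    lambdaTensor, lambdaTensor, form_join, form_join, ← (M i).star_inner, h, (M i).star_inner]

/-- The embedding `λ_i(a) = V_i (a ⊗ 1) V_i⁻¹` of `a ∈ L(M_i)`. -/
noncomputable def lambda (i : I) (a : (M i).adjointable) : Module.End Bᵐᵒᵖ (Space M) :=
  descend (extend (lambdaTensor i a)) (by
    obtain ⟨a, a', h⟩ := a
    exact ⟨extend (lambdaTensor i a'), form_extend_adjoint _ _ (lambdaTensor_adjoint i a a' h)⟩)

/-! #### Projections, distributions and convolutions -/

open Classical in
/-- The orthogonal projection `P_J` onto the sum of the summands with words in `J`. -/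
noncomputable def proj (J : Set (List I)) : Module.End Bᵐᵒᵖ (Space M) :=
  descend (extend fun t => if word M t ∈ J then Finsupp.single t 1 else 0)
    ⟨extend fun t => if word M t ∈ J then Finsupp.single t 1 else 0,
      form_extend_adjoint _ _ fun s t => by
        by_cases h : word M s = word M t
        · rw [h]; split_ifs <;> simp
        · have := kernel_eq_zero_of_word_ne s.1 t.1 1 h
          split_ifs <;> simp [form_single, this]⟩

variable (M) in
/-- The specified vector `ξ` of the free product. -/
noncomputable def vac : Space M := (null M).mkQ (Finsupp.single (emptyTensor M) 1)

/-- `φ_ξ(T) = ⟨ξ, T ξ⟩`. -/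
noncomputable def vacState : Module.End Bᵐᵒᵖ (Space M) →ₗ[ℂ] B where
  toFun T := inner (vac M) (T (vac M))
  map_add' S T := by
    rw [LinearMap.add_apply]
    obtain ⟨v, hv⟩ := (null M).mkQ_surjective (S (vac M))
    obtain ⟨w, hw⟩ := (null M).mkQ_surjective (T (vac M))
    rw [← hv, ← hw, ← map_add]
    exact form_add_right _ _ _
  map_smul' z T := by
    rw [LinearMap.smul_apply]
    obtain ⟨v, hv⟩ := (null M).mkQ_surjective (T (vac M))
    rw [← hv, smul_mk, RingHom.id_apply, Algebra.smul_def, Algebra.commutes]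
    exact form_op_smul_right _ _ _

/-- The distribution of an operator on the free product with respect to `φ_ξ`. -/
noncomputable def dist (X : Module.End Bᵐᵒᵖ (Space M)) : Distribution B :=
  vacState ∘ₗ (evalPoly leftHom X).toLinearMap

end FreeProd

section Convolution

variable {B : Type u} [CStarAlgebra B] [PartialOrder B]

/-- `ρ` is the `J`-additive convolution of the distributions `μ i`: the distribution of
`∑ i, P_{J i} λ_i(x i)` on the reduced free product of pointed bimodules `M i`, where `x i ∈ L(M i)`
has distribution `μ i`. -/
def IsJConv {I : Type} [Fintype I] [DecidableEq I] (J : I → Set (List I))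
    (μ : I → Distribution B) (ρ : Distribution B) : Prop :=
  ∃ (M : I → PointedBimodule B) (x : ∀ i, (M i).adjointable),
    (∀ i, (M i).dist (x i) = μ i) ∧
    FreeProd.dist (∑ i, FreeProd.proj (J i) * FreeProd.lambda i (x i)) = ρ

/-- `ρ = μ ⊢ ν`: the index set is `{0, 1}` with `J 0 = {∅, (0)}` and `J 1 = {(0), (1, 0)}`. -/
def IsOrthogonalConv (μ ν ρ : Distribution B) : Prop :=
  IsJConv ![{[], [0]}, {[0], [1, 0]}] ![μ, ν] ρ

end Convolution

end OpValued

open OpValued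

/-! All the convolutions are realized by operators on one Hilbert bimodule. Let $x\in\mathcal A_1$
and $y\in\mathcal A_2$ have distributions $\mu$ and $\nu$. Complete $\mathcal A_2\otimes\mathcal
A_1$ for the form $\langle a\otimes c,a'\otimes c'\rangle=\mathbb E_1[c^*\,\mathbb E_2[a^*a']\,c']$,
with $\xi=1\otimes1$. Let $Y$ be left multiplication by $\mathcal A_2$ on the first leg. Let $X$ be
left multiplication by $\mathcal A_1$ on the second leg, cut down by the projection $P=X(1)$ onto
$1\otimes\mathcal A_1$. Let $Q$ be the projection onto $\mathcal A_2\otimes\mathcal B$, which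
commutes with $Y$ and $P$. Two relations carry everything: $P\,Y(a)\,P=\mathbb E_2[a]\,P$, and
$e=PQ$ is the projection onto $\mathcal B\xi$. The form is positive because conditional expectations
are completely positive (`exists_gram`).

The compression relation makes $X(x),Y(y)$ monotone independent. Regroup their sum as
$X(x)+Y(y)=Y(y)Q+z$ with $z=X(x)+Y(y)(1-Q)$. The two summands live under the projections $Q$ and
$1-Q+e$, whose product is $e$, so they are Boolean independent. Since $Q$ fixes $\xi$, the first one
still has distribution $\nu$. It remains to see that $z$ has distribution $\mu\vdash\nu$.

For this, `IsOrthogonalModel` isolates the algebra shared by $z$ and by the operators on the free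
product: the first variable lives under $p$, the second one is killed by $e$, and
$p\,r(x_1)\,p=\nu(r)(p-e)$ for every $r$ without constant term. Alternating moments are then
computed recursively from $\mu$ and $\nu$, so any two models give the same distribution.
Independence of choices for $\uplus$ and $\rhd$ follows by the same reduction to alternating
products.

The formula for the reciprocal Cauchy transforms is a block computation for the resolvent of $z$
compressed to $P$ (`resolvent_compression`), carried out in matrices over the joint model. It passes
to arbitrary representatives because the Cauchy transform is a series in the moments
(`cauchy_congr`). -/

namespace OpValued

/-! ### Positivity and half-planes in `C⋆`-algebras -/

section CStar

set_option linter.unusedSectionVars false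

variable {D : Type*} [CStarAlgebra D] [PartialOrder D] [StarOrderedRing D]

/-- For a $*$-representation $\pi$, positivity of $\pi(r^*r)$ turns this factorization into a norm
bound for $\pi(d)$; see `mem_bounded_of_rep`. -/
theorem exists_star_mul_self_eq_norm_sub (d : D) :
    ∃ r : D, star r * r = ((‖d‖ ^ 2 : ℝ) : ℂ) • (1 : D) - star d * d := by
  have h := CStarAlgebra.star_mul_le_algebraMap_norm_sq (a := d)
  rw [← sub_nonneg, CStarAlgebra.nonneg_iff_eq_star_mul_self] at h
  obtain ⟨r, hr⟩ := h
  refine ⟨r, hr.symm.trans ?_⟩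
  rw [Algebra.algebraMap_eq_smul_one, Complex.coe_smul]

theorem exists_nonneg_sub_nonneg {a : D} (ha : IsSelfAdjoint a) :
    ∃ p q : D, 0 ≤ p ∧ 0 ≤ q ∧ p - q = a ∧ q * p = 0 :=
  ⟨a⁺, a⁻, CFC.posPart_nonneg a, CFC.negPart_nonneg a, CFC.posPart_sub_negPart a,
    CFC.negPart_mul_posPart a⟩

theorem exists_eq_star_mul_self {a : D} (ha : 0 ≤ a) : ∃ s : D, a = star s * s :=
  CStarAlgebra.nonneg_iff_eq_star_mul_self.mp ha

/-- Elements whose imaginary part is bounded below by a positive scalar. -/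
def ImPos (u : D) : Prop :=
  ∃ ε : ℝ, 0 < ε ∧ (ε : ℂ) • (1 : D) ≤ (Complex.I)⁻¹ • (u - star u)

theorem ofReal_smul_one_le {a b : ℝ} (h : a ≤ b) : (a : ℂ) • (1 : D) ≤ (b : ℂ) • (1 : D) := by
  rw [Complex.coe_smul, Complex.coe_smul]
  exact smul_le_smul_of_nonneg_right h zero_le_one

/-- With $t=1+iru$ one has $t^*t=1-r\,(u-u^*)/i+r^2u^*u\le 1-r\varepsilon+r^2\|u\|^2$, and this is
below $1$ as soon as $r(\|u\|^2+1)<\varepsilon$. Both the invertibility of $u$ and a geometric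
series for $u^{-1}$ come from this estimate. -/
theorem ImPos.norm_lt_one {u : D} (hu : ImPos u) :
    ∃ r₀ : ℝ, 0 < r₀ ∧ ∀ r : ℝ, 0 < r → r < r₀ → ‖1 + (Complex.I * r) • u‖ < 1 := by
  obtain ⟨ε, hε, h⟩ := hu
  refine ⟨ε / (‖u‖ ^ 2 + 1), by positivity, fun r hr hr0 => ?_⟩
  set t := 1 + (Complex.I * r) • u with ht
  have e : star t * t = 1 - (r : ℂ) • ((Complex.I)⁻¹ • (u - star u)) +
      ((r ^ 2 : ℝ) : ℂ) • (star u * u) := by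
    simp only [ht, star_add, star_one, star_smul, add_mul, mul_add, one_mul, mul_one,
      smul_mul_smul_comm, Complex.inv_I, smul_sub, smul_smul]
    have h1 : star (Complex.I * (r : ℂ)) = -(Complex.I * r) := by simp
    have h2 : star (Complex.I * (r : ℂ)) * (Complex.I * r) = ((r ^ 2 : ℝ) : ℂ) := by
      rw [h1]
      push_cast
      linear_combination -(r : ℂ) ^ 2 * Complex.I_sq
    rw [h2, h1]
    module
  have h3 : star u * u ≤ ((‖u‖ ^ 2 : ℝ) : ℂ) • (1 : D) := by
    rw [Complex.coe_smul, ← Algebra.algebraMap_eq_smul_one]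
    exact CStarAlgebra.star_mul_le_algebraMap_norm_sq
  -- The norm criterion needs a nonnegative bound. Without the maximum this could fail in the zero
  -- algebra, which occurs for matrices of size $0$.
  set c : ℝ := max (1 - r * ε + r ^ 2 * ‖u‖ ^ 2) 0
  have h4 : star t * t ≤ algebraMap ℝ D c := by
    have h5 : (r : ℂ) • ((ε : ℂ) • (1 : D)) ≤ (r : ℂ) • ((Complex.I)⁻¹ • (u - star u)) := by
      rw [Complex.coe_smul r, Complex.coe_smul r]
      exact smul_le_smul_of_nonneg_left h hr.le
    have h6 : ((r ^ 2 : ℝ) : ℂ) • (star u * u) ≤ ((r ^ 2 : ℝ) : ℂ) • ((‖u‖ ^ 2 : ℝ) : ℂ) • (1 : D) := by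
      rw [Complex.coe_smul (r ^ 2), Complex.coe_smul (r ^ 2)]
      exact smul_le_smul_of_nonneg_left h3 (by positivity)
    calc star t * t ≤ 1 - (r : ℂ) • ((ε : ℂ) • (1 : D)) +
          ((r ^ 2 : ℝ) : ℂ) • ((‖u‖ ^ 2 : ℝ) : ℂ) • (1 : D) := by
          rw [e]; exact add_le_add (sub_le_sub_left h5 1) h6
      _ = ((1 - r * ε + r ^ 2 * ‖u‖ ^ 2 : ℝ) : ℂ) • (1 : D) := by
          push_cast
          module
      _ ≤ (c : ℂ) • (1 : D) := ofReal_smul_one_le (le_max_left _ _)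
      _ = _ := by rw [Complex.coe_smul, Algebra.algebraMap_eq_smul_one]
  have h7 : ‖star t * t‖ ≤ c :=
    (CStarAlgebra.norm_le_iff_le_algebraMap _ (le_max_right _ _) (star_mul_self_nonneg t)).mpr h4
  rw [CStarRing.norm_star_mul_self] at h7
  have hc : c < 1 := by
    refine max_lt ?_ one_pos
    rw [lt_div_iff₀ (by positivity)] at hr0
    nlinarith [sq_nonneg ‖u‖]
  by_contra! h8
  nlinarith

theorem ImPos.isUnit {u : D} (hu : ImPos u) : IsUnit u := by
  obtain ⟨r₀, h0, h⟩ := hu.norm_lt_one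
  have h1 := h (r₀ / 2) (by positivity) (by linarith)
  have h2 := isUnit_one_sub_of_norm_lt_one h1
  have h3 : -(Complex.I * ((r₀ / 2 : ℝ) : ℂ)) ≠ 0 := by simp [h0.ne']
  have h4 : u = (Units.mk0 _ h3)⁻¹ • (1 - (1 + (Complex.I * ((r₀ / 2 : ℝ) : ℂ)) • u)) := by
    rw [Units.smul_def, Units.val_inv_eq_inv_val, Units.val_mk0]
    rw [sub_add_cancel_left, ← neg_smul, smul_smul, inv_mul_cancel₀ h3, one_smul]
  rw [h4]
  exact h2.smul _

/-- The inverse of an element of the half-plane as a series of polynomials in it. -/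
theorem ImPos.hasSum_inverse {u : D} {r : ℝ} (hr : 0 < r)
    (h : ‖1 + (Complex.I * r) • u‖ < 1) :
    HasSum (fun k : ℕ => (-(Complex.I * r)) • (1 + (Complex.I * r) • u) ^ k) (Ring.inverse u) := by
  have h3 : -(Complex.I * (r : ℂ)) ≠ 0 := by simp [hr.ne']
  set t := 1 + (Complex.I * (r : ℂ)) • u with ht
  have hs : Summable fun k : ℕ => t ^ k := summable_geometric_of_norm_lt_one h
  have e1 : (1 - t) * ∑' k, t ^ k = 1 := mul_neg_geom_series t h
  have e2 : (∑' k, t ^ k) * (1 - t) = 1 := geom_series_mul_neg t h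
  have e3 : 1 - t = -(Complex.I * (r : ℂ)) • u := by rw [ht, sub_add_cancel_left, neg_smul]
  rw [e3] at e1 e2
  have hu : Ring.inverse u = -(Complex.I * (r : ℂ)) • ∑' k, t ^ k := by
    rw [smul_mul_assoc] at e1
    rw [mul_smul_comm] at e2
    let U : Dˣ := ⟨u, -(Complex.I * (r : ℂ)) • ∑' k, t ^ k, by rw [mul_smul_comm, e1],
      by rw [smul_mul_assoc, e2]⟩
    exact Ring.inverse_unit U
  rw [hu]
  exact hs.hasSum.const_smul _

/-- With $R=u^{-1}$, conjugation gives $(-R+R^*)/i=R\,\bigl((u-u^*)/i\bigr)R^*\ge\varepsilon RR^*$.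
Conjugating $uu^*\le\|u\|^2$ by $R$ gives $1\le\|u\|^2RR^*$, which bounds $RR^*$ below. The added
$1$ keeps the denominator positive. -/
theorem ImPos.neg_inverse {u : D} (hu : ImPos u) : ImPos (-Ring.inverse u) := by
  obtain ⟨U, rfl⟩ := hu.isUnit
  obtain ⟨ε, hε, h⟩ := hu
  rw [Ring.inverse_unit]
  set R : D := ↑U⁻¹ with hR
  have hUR : (U : D) * R = 1 := U.mul_inv
  have hRU : R * (U : D) = 1 := U.inv_mul
  have hs : star (U : D) * star R = 1 := by rw [← star_mul, hRU, star_one]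
  have key : (Complex.I)⁻¹ • (-R - star (-R)) = R * ((Complex.I)⁻¹ • ((U : D) - star (U : D))) * star R := by
    rw [mul_smul_comm, smul_mul_assoc, mul_sub, sub_mul, hRU, one_mul, mul_assoc, hs, mul_one,
      star_neg]
    congr 1
    abel
  refine ⟨ε / (‖(U : D)‖ ^ 2 + 1), by positivity, ?_⟩
  rw [key]
  have h1 : R * ((ε : ℂ) • (1 : D)) * star R ≤ _ := star_right_conjugate_le_conjugate h R
  refine le_trans ?_ h1
  rw [mul_smul_comm, mul_one, smul_mul_assoc]
  have h2 : (U : D) * star (U : D) ≤ ((‖(U : D)‖ ^ 2 : ℝ) : ℂ) • (1 : D) := by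
    rw [Complex.coe_smul, ← Algebra.algebraMap_eq_smul_one]
    exact CStarAlgebra.mul_star_le_algebraMap_norm_sq
  have h3 : R * ((U : D) * star (U : D)) * star R ≤ _ := star_right_conjugate_le_conjugate h2 R
  rw [← mul_assoc, hRU, one_mul, hs, mul_smul_comm, mul_one, smul_mul_assoc] at h3
  have h4 : 0 ≤ R * star R := mul_star_self_nonneg R
  have h5 : (1 : D) ≤ ((‖(U : D)‖ ^ 2 + 1 : ℝ) : ℂ) • (R * star R) := by
    refine h3.trans ?_
    rw [Complex.coe_smul, Complex.coe_smul]
    exact smul_le_smul_of_nonneg_right (by linarith) h4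
  have h6 : ((ε / (‖(U : D)‖ ^ 2 + 1) : ℝ) : ℂ) • (1 : D) ≤ ((ε / (‖(U : D)‖ ^ 2 + 1) : ℝ) : ℂ) •
      ((‖(U : D)‖ ^ 2 + 1 : ℝ) : ℂ) • (R * star R) := by
    rw [Complex.coe_smul (ε / _), Complex.coe_smul (ε / _)]
    exact smul_le_smul_of_nonneg_left h5 (by positivity)
  refine h6.trans (le_of_eq ?_)
  rw [smul_smul, ← Complex.ofReal_mul, div_mul_cancel₀ _ (by positivity)]

theorem ImPos.sub_of_isSelfAdjoint {u a : D} (hu : ImPos u) (ha : IsSelfAdjoint a) :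
    ImPos (u - a) := by
  obtain ⟨ε, hε, h⟩ := hu
  refine ⟨ε, hε, ?_⟩
  rwa [star_sub, ha.star_eq, sub_sub_sub_cancel_right]

theorem ImPos.map {D' : Type*} [CStarAlgebra D'] [PartialOrder D'] [StarOrderedRing D']
    (f : D →ₗ[ℂ] D') (h1 : f 1 = 1) (hs : ∀ d, f (star d) = star (f d))
    (hp : ∀ d, 0 ≤ d → 0 ≤ f d) {u : D} (hu : ImPos u) : ImPos (f u) := by
  obtain ⟨ε, hε, h⟩ := hu
  refine ⟨ε, hε, ?_⟩
  have := hp _ (sub_nonneg.mpr h)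
  rwa [map_sub, map_smul, map_smul, map_sub, hs, h1, sub_nonneg] at this

end CStar

/-! ### Positivity in $M_n(\mathcal B)$ -/

section Matrices

set_option linter.unusedSectionVars false

variable {B : Type*} [CStarAlgebra B] [PartialOrder B] [StarOrderedRing B]
  {n : Type*} [Fintype n] [DecidableEq n]

theorem star_vecMul_mul_star (M : CStarMatrix n n B) (v : n → B) :
    ∑ i, ∑ j, v i * (M * star M) i j * star (v j) =
      ∑ k, (∑ i, v i * M i k) * star (∑ i, v i * M i k) := by
  simp only [CStarMatrix.mul_apply, CStarMatrix.star_apply, star_sum, star_mul, Finset.sum_mul,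
    Finset.mul_sum]
  rw [Finset.sum_comm_cycle]
  refine Finset.sum_congr rfl fun k _ => ?_
  rw [Finset.sum_comm]
  simp only [mul_assoc]

theorem sum_conj_mul (M N : CStarMatrix n n B) (v : n → B) :
    ∑ i, ∑ j, v i * (N * M * star N) i j * star (v j) =
      ∑ i, ∑ j, (∑ k, v k * N k i) * M i j * star (∑ k, v k * N k j) := by
  simp only [CStarMatrix.mul_apply, CStarMatrix.star_apply, star_sum, star_mul, Finset.sum_mul,
    Finset.mul_sum, mul_assoc]
  calc _ = ∑ a, ∑ d, ∑ b, ∑ c, v a * (N a b * (M b c * (star (N d c) * star (v d)))) := by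
        refine Finset.sum_congr rfl fun a _ => Finset.sum_congr rfl fun d _ => ?_
        rw [Finset.sum_comm]
    _ = ∑ a, ∑ b, ∑ d, ∑ c, v a * (N a b * (M b c * (star (N d c) * star (v d)))) :=
        Finset.sum_congr rfl fun a _ => Finset.sum_comm
    _ = ∑ b, ∑ a, ∑ d, ∑ c, v a * (N a b * (M b c * (star (N d c) * star (v d)))) :=
        Finset.sum_comm
    _ = ∑ b, ∑ a, ∑ c, ∑ d, v a * (N a b * (M b c * (star (N d c) * star (v d)))) :=
        Finset.sum_congr rfl fun b _ => Finset.sum_congr rfl fun a _ => Finset.sum_comm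
    _ = ∑ b, ∑ c, ∑ a, ∑ d, v a * (N a b * (M b c * (star (N d c) * star (v d)))) :=
        Finset.sum_congr rfl fun b _ => Finset.sum_comm
    _ = _ := by
        refine Finset.sum_congr rfl fun b _ => Finset.sum_congr rfl fun c _ => ?_
        rw [Finset.sum_comm]

/-- A selfadjoint matrix is positive if its quadratic form is. -/
theorem cstarMatrix_nonneg {M : CStarMatrix n n B} (hM : IsSelfAdjoint M)
    (h : ∀ v : n → B, 0 ≤ ∑ i, ∑ j, v i * M i j * star (v j)) : 0 ≤ M := by
  obtain ⟨p, N, hp, hN0, hpos, hNp⟩ := exists_nonneg_sub_nonneg hM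
  have hNs : star N = N := (IsSelfAdjoint.of_nonneg hN0).star_eq
  -- Write $M=p-N$ with $Np=0$ and test the form on the rows of $N$. Each diagonal entry of $-N^3$
  -- is then $\ge0$, while $N^3=(Ns^*)(Ns^*)^*$ for $N=s^*s$. Hence $Ns^*=0$, then $N^2=0$ and
  -- $N=0$.
  have hNM : N * M * N = -(N * N * N) := by
    rw [← hpos, mul_sub, sub_mul, hNp]
    simp
  obtain ⟨s, hs⟩ := exists_eq_star_mul_self hN0
  have hc : N * N * N = (N * star s) * star (N * star s) := by
    rw [star_mul, star_star, hNs]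
    nth_rewrite 2 [hs]
    simp only [mul_assoc]
  have h0 : N * star s = 0 := by
    ext i k
    let v : n → B := Pi.single i 1
    have h1 := h (fun j => ∑ k, v k * N k j)
    rw [← sum_conj_mul, hNs, hNM] at h1
    have h2 : 0 ≤ -∑ k, (∑ i, v i * (N * star s) i k) * star (∑ i, v i * (N * star s) i k) := by
      rw [← star_vecMul_mul_star, ← hc]
      simpa using h1
    have h3 : ∀ k ∈ Finset.univ, 0 ≤ (∑ i, v i * (N * star s) i k) * star (∑ i, v i * (N * star s) i k) :=
      fun k _ => mul_star_self_nonneg _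
    have h4 := le_antisymm (neg_nonneg.mp h2) (Finset.sum_nonneg h3)
    rw [Finset.sum_eq_zero_iff_of_nonneg h3] at h4
    have h5 := h4 k (Finset.mem_univ k)
    rw [CStarRing.mul_star_self_eq_zero_iff] at h5
    simpa [v, Pi.single_apply] using h5
  have h1 : N * N = 0 := by
    nth_rewrite 2 [hs]
    rw [← mul_assoc, h0, zero_mul]
  have h2 : N = 0 := by
    rw [← CStarRing.star_mul_self_eq_zero_iff, hNs, h1]
  rw [← hpos, h2, sub_zero]
  exact hp

end Matrices

end OpValued

namespace OpValued

/-! ### Completion of semi-inner product bimodules -/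

section Completion

set_option linter.unusedSectionVars false

variable (B : Type u) [CStarAlgebra B] [PartialOrder B]

/-- A bimodule over `B` with a positive semidefinite `B`-valued form and a specified vector. -/
structure PreBimodule where
  V : Type u
  [group : AddCommGroup V]
  [space : Module ℂ V]
  form : V →ₗ⋆[ℂ] V →ₗ[ℂ] B
  star_form : ∀ x y, star (form y x) = form x y
  form_nonneg : ∀ x, 0 ≤ form x x
  left : B →ₐ[ℂ] Module.End ℂ V
  right : Bᵐᵒᵖ →ₐ[ℂ] Module.End ℂ V
  left_right : ∀ b c v, left b (right c v) = right c (left b v)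
  form_right : ∀ x y b, form x (right (MulOpposite.op b) y) = form x y * b
  form_left : ∀ x y b, form (left b x) y = form x (left (star b) y)
  vac : V
  form_vac : ∀ b, form vac (left b vac) = b

attribute [instance] PreBimodule.group PreBimodule.space

namespace PreBimodule

variable {B} [StarOrderedRing B] (N : PreBimodule B)

theorem form_right_left (x y : N.V) (b : B) :
    N.form (N.right (MulOpposite.op b) x) y = star b * N.form x y := by
  rw [← N.star_form, N.form_right, star_mul, N.star_form]

/-- Cauchy–Schwarz from positivity of the form at $xc-ty$ with $c=\langle x,y\rangle$: since
$\langle x,x\rangle\le t$, expanding gives $c^*c\le t\langle y,y\rangle$. The strict inequality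
makes $t>0$, so that it can be cancelled even when $x$ is a null vector. -/
theorem norm_form_sq_le_of_lt (x y : N.V) {t : ℝ} (ht : ‖N.form x x‖ < t) :
    ‖N.form x y‖ ^ 2 ≤ t * ‖N.form y y‖ := by
  have t0 : 0 < t := (norm_nonneg _).trans_lt ht
  set c := N.form x y with hc
  have hyx : N.form y x = star c := by rw [hc, N.star_form]
  have h := N.form_nonneg (N.right (MulOpposite.op c) x - (t : ℂ) • y)
  have e : N.form (N.right (MulOpposite.op c) x - (t : ℂ) • y)
      (N.right (MulOpposite.op c) x - (t : ℂ) • y) =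
      star c * N.form x x * c - (t : ℂ) • (star c * c) - (t : ℂ) • (star c * c) +
        (t : ℂ) • (t : ℂ) • N.form y y := by
    simp only [map_sub, LinearMap.sub_apply, N.form_right, N.form_right_left, map_smul,
      LinearMap.map_smulₛₗ, LinearMap.smul_apply, Complex.conj_ofReal, hyx,
      smul_sub, ← hc, mul_assoc]
    abel
  rw [e] at h
  have h1 : star c * N.form x x * c ≤ (t : ℂ) • (star c * c) := by
    have h2 : N.form x x ≤ algebraMap ℝ B t :=
      (IsSelfAdjoint.of_nonneg (N.form_nonneg x)).le_algebraMap_norm_self.trans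
        (algebraMap_mono B ht.le)
    refine (star_left_conjugate_le_conjugate h2 c).trans (le_of_eq ?_)
    rw [Algebra.algebraMap_eq_smul_one, mul_smul_comm, mul_one, smul_mul_assoc, Complex.coe_smul]
  have h3 : (t : ℂ) • (star c * c) ≤ (t : ℂ) • (t : ℂ) • N.form y y := by
    rw [← sub_nonneg]
    refine h.trans ?_
    rw [← sub_nonneg] at h1 ⊢
    convert h1 using 1
    abel
  have h4 : star c * c ≤ (t : ℂ) • N.form y y := by
    rw [Complex.coe_smul, Complex.coe_smul t (_ • _)] at h3
    have h5 := smul_le_smul_of_nonneg_left h3 (inv_nonneg.mpr t0.le)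
    rwa [smul_smul, smul_smul, inv_mul_cancel₀ t0.ne', one_smul, one_smul] at h5
  have h6 := CStarAlgebra.norm_le_norm_of_nonneg_of_le (star_mul_self_nonneg c) h4
  rw [CStarRing.norm_star_mul_self, norm_smul, Complex.norm_real, Real.norm_of_nonneg t0.le] at h6
  rw [sq]
  exact h6

theorem norm_form_sq_le (x y : N.V) :
    ‖N.form x y‖ ^ 2 ≤ ‖N.form x x‖ * ‖N.form y y‖ := by
  refine le_of_forall_gt_imp_ge_of_dense fun s hs => ?_
  -- Given $s>\|\langle x,x\rangle\|\,\|\langle y,y\rangle\|$, the choice $t=s/\|\langle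
  -- y,y\rangle\|$ is admissible. If $y$ is a null vector, any admissible $t$ forces $\langle
  -- x,y\rangle=0$.
  by_cases hy : ‖N.form y y‖ = 0
  · have := N.norm_form_sq_le_of_lt x y (lt_add_one _)
    rw [hy, mul_zero] at this hs
    exact this.trans hs.le
  · have hy' : 0 < ‖N.form y y‖ := lt_of_le_of_ne (norm_nonneg _) (Ne.symm hy)
    have := N.norm_form_sq_le_of_lt x y ((lt_div_iff₀ hy').mpr hs)
    rwa [div_mul_cancel₀ _ hy] at this

theorem norm_form_le (x y : N.V) :
    ‖N.form x y‖ ≤ Real.sqrt ‖N.form x x‖ * Real.sqrt ‖N.form y y‖ := by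
  rw [← Real.sqrt_mul (norm_nonneg _)]
  exact Real.le_sqrt_of_sq_le (N.norm_form_sq_le x y)

/-- The seminorm `‖v‖ = ‖⟨v, v⟩‖ ^ (1 / 2)`. -/
noncomputable def seminorm : AddGroupSeminorm N.V where
  toFun v := Real.sqrt ‖N.form v v‖
  map_zero' := by simp
  add_le' x y := by
    refine Real.sqrt_le_iff.mpr ⟨by positivity, ?_⟩
    have h1 := N.norm_form_le x y
    have h2 := N.norm_form_le y x
    have e : N.form (x + y) (x + y) =
        N.form x x + N.form x y + (N.form y x + N.form y y) := by
      simp only [map_add, LinearMap.add_apply]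
      abel
    rw [e]
    have h3 := norm_add_le (N.form x x + N.form x y) (N.form y x + N.form y y)
    have h4 := norm_add_le (N.form x x) (N.form x y)
    have h5 := norm_add_le (N.form y x) (N.form y y)
    have h6 := Real.sq_sqrt (norm_nonneg (N.form x x))
    have h7 := Real.sq_sqrt (norm_nonneg (N.form y y))
    nlinarith
  neg' x := by simp

noncomputable instance : SeminormedAddCommGroup N.V :=
  N.seminorm.toSeminormedAddCommGroup

theorem norm_def (v : N.V) : ‖v‖ = Real.sqrt ‖N.form v v‖ := rfl

theorem norm_sq (v : N.V) : ‖v‖ ^ 2 = ‖N.form v v‖ := Real.sq_sqrt (norm_nonneg _)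

noncomputable instance : NormedSpace ℂ N.V where
  norm_smul_le z v := by
    rw [N.norm_def, N.norm_def]
    simp only [map_smul, LinearMap.map_smulₛₗ, LinearMap.smul_apply, norm_smul, RCLike.norm_conj]
    rw [← mul_assoc, ← sq, Real.sqrt_mul (sq_nonneg _), Real.sqrt_sq (norm_nonneg _)]

theorem norm_form_le_mul (x y : N.V) : ‖N.form x y‖ ≤ ‖x‖ * ‖y‖ := N.norm_form_le x y

/-- The bounded operators. -/
noncomputable def bounded : Subalgebra ℂ (Module.End ℂ N.V) where
  carrier := {T | ∃ C : ℝ, 0 ≤ C ∧ ∀ v, ‖T v‖ ≤ C * ‖v‖}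
  add_mem' := by
    rintro S T ⟨C, hC, h⟩ ⟨C', hC', h'⟩
    refine ⟨C + C', by positivity, fun v => ?_⟩
    rw [add_mul]
    exact (norm_add_le _ _).trans (add_le_add (h v) (h' v))
  mul_mem' := by
    rintro S T ⟨C, hC, h⟩ ⟨C', hC', h'⟩
    refine ⟨C * C', by positivity, fun v => ?_⟩
    rw [mul_assoc]
    exact (h _).trans (mul_le_mul_of_nonneg_left (h' v) hC)
  algebraMap_mem' z := ⟨‖z‖, norm_nonneg _, fun v => (norm_smul z v).le⟩

theorem mem_bounded_of_form_le {T : Module.End ℂ N.V} {C : ℝ} (hC : 0 ≤ C)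
    (h : ∀ v, N.form (T v) (T v) ≤ ((C ^ 2 : ℝ) : ℂ) • N.form v v) : T ∈ N.bounded := by
  refine ⟨C, hC, fun v => ?_⟩
  have h1 := CStarAlgebra.norm_le_norm_of_nonneg_of_le (N.form_nonneg (T v)) (h v)
  rw [norm_smul, Complex.norm_real, Real.norm_of_nonneg (sq_nonneg C), ← N.norm_sq,
    ← N.norm_sq, ← mul_pow] at h1
  exact (pow_le_pow_iff_left₀ (norm_nonneg _) (by positivity) two_ne_zero).mp h1

/-- A `⋆`-representation of a unital `C⋆`-algebra, not necessarily unital, is bounded. -/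
theorem mem_bounded_of_rep {D : Type*} [CStarAlgebra D] (π : D →ₗ[ℂ] Module.End ℂ N.V)
    (hm : ∀ d d', π (d * d') = π d * π d')
    (hs : ∀ d v w, N.form (π d v) w = N.form v (π (star d) w)) (d : D) : π d ∈ N.bounded := by
  let _ := CStarAlgebra.spectralOrder D
  have := CStarAlgebra.spectralOrderedRing D
  refine N.mem_bounded_of_form_le (norm_nonneg d) fun v => ?_
  have hp : ∀ r : D, 0 ≤ N.form v (π (star r * r) v) := fun r => by
    rw [hm, Module.End.mul_apply, ← hs]
    exact N.form_nonneg _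
  -- $\pi(1)$ need not be the identity, only a selfadjoint idempotent. Positivity at $v-\pi(1)v$
  -- shows that it is dominated by $1$.
  have h1 : N.form v (π 1 v) ≤ N.form v v := by
    have h2 := N.form_nonneg (v - π 1 v)
    have h3 : N.form (π 1 v) v = N.form v (π 1 v) := by rw [hs, star_one]
    have h4 : N.form (π 1 v) (π 1 v) = N.form v (π 1 v) := by
      rw [hs, star_one, ← Module.End.mul_apply, ← hm, one_mul]
    rw [map_sub, map_sub, LinearMap.sub_apply, LinearMap.sub_apply, h3, h4, sub_self, sub_zero] at h2
    exact sub_nonneg.mp h2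
  -- Positivity of $\pi(r^*r)$ reads $\langle\pi(d)v,\pi(d)v\rangle\le\|d\|^2\langle
  -- v,\pi(1)v\rangle$.
  obtain ⟨r, hr⟩ := exists_star_mul_self_eq_norm_sub d
  have h5 := hp r
  rw [hr, map_sub, map_smul, LinearMap.sub_apply, LinearMap.smul_apply, map_sub, map_smul, hm,
    Module.End.mul_apply, ← hs, sub_nonneg] at h5
  refine h5.trans ?_
  rw [Complex.coe_smul, Complex.coe_smul]
  exact smul_le_smul_of_nonneg_left h1 (sq_nonneg _)

theorem left_mem_bounded (b : B) : N.left b ∈ N.bounded :=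
  N.mem_bounded_of_rep N.left.toLinearMap (map_mul N.left) (fun b v w => N.form_left v w b) b

/-- Right multiplication is in general not adjointable, so the argument for representations is
replaced by the estimate $\|b^*\langle v,v\rangle b\|\le\|b\|^2\|\langle v,v\rangle\|$. -/
theorem right_mem_bounded (b : Bᵐᵒᵖ) : N.right b ∈ N.bounded := by
  refine ⟨‖b.unop‖, norm_nonneg _, fun v => ?_⟩
  refine (pow_le_pow_iff_left₀ (norm_nonneg _) (by positivity) two_ne_zero).mp ?_
  have e : N.form (N.right b v) (N.right b v) = star b.unop * N.form v v * b.unop := by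
    conv_lhs => rw [← MulOpposite.op_unop b]
    rw [N.form_right, N.form_right_left]
  rw [mul_pow, N.norm_sq, N.norm_sq, e, sq, mul_right_comm]
  refine (norm_mul_le _ _).trans ?_
  refine mul_le_mul_of_nonneg_right ((norm_mul_le _ _).trans ?_) (norm_nonneg _)
  rw [norm_star]

/-- The continuous extension of a bounded operator to the completion. -/
noncomputable def extendBounded (T : N.bounded) :
    UniformSpace.Completion N.V →L[ℂ] UniformSpace.Completion N.V :=
  ContinuousLinearMap.completion
    (LinearMap.mkContinuousOfExistsBound (T : Module.End ℂ N.V) (by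
      obtain ⟨T, C, _, h⟩ := T
      exact ⟨C, h⟩))

theorem extendBounded_coe (T : N.bounded) (v : N.V) :
    N.extendBounded T (v : UniformSpace.Completion N.V) =
      ((T : Module.End ℂ N.V) v : UniformSpace.Completion N.V) :=
  UniformSpace.Completion.map_coe (ContinuousLinearMap.uniformContinuous _) v

theorem clm_ext {f g : UniformSpace.Completion N.V →L[ℂ] UniformSpace.Completion N.V}
    (h : ∀ v : N.V, f v = g v) : f = g := by
  ext x
  induction x using UniformSpace.Completion.induction_on with
  | hp =>
    exact isClosed_eq f.continuous g.continuous
  | ih v => exact h v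

noncomputable def extendBoundedHom :
    N.bounded →ₐ[ℂ] (UniformSpace.Completion N.V →L[ℂ] UniformSpace.Completion N.V) where
  toFun := N.extendBounded
  map_one' := N.clm_ext fun v => by simp [extendBounded_coe]
  map_mul' S T := N.clm_ext fun v => by simp [extendBounded_coe]
  map_zero' := N.clm_ext fun v => (N.extendBounded_coe 0 v).trans UniformSpace.Completion.coe_zero
  map_add' S T := N.clm_ext fun v => by
    rw [add_apply]
    simp only [extendBounded_coe]
    rw [← UniformSpace.Completion.coe_add]
    rfl
  commutes' z := N.clm_ext fun v => by
    rw [extendBounded_coe]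
    exact UniformSpace.Completion.coe_smul z v

/-- The continuous extension of the form to the completion. -/
noncomputable def completionForm (x y : UniformSpace.Completion N.V) : B :=
  (UniformSpace.Completion.isDenseInducing_coe.prodMap
    UniformSpace.Completion.isDenseInducing_coe).extend
      (fun p : N.V × N.V => N.form p.1 p.2) (x, y)

theorem continuous_form : Continuous fun p : N.V × N.V => N.form p.1 p.2 := by
  let f := LinearMap.mkContinuous₂ N.form 1 fun x y => by
    simpa using N.norm_form_le_mul x y
  exact isBoundedBilinearMap_apply.continuous.comp
    ((f.continuous.comp continuous_fst).prodMk continuous_snd)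

theorem completionForm_coe (x y : N.V) : N.completionForm x y = N.form x y :=
  (UniformSpace.Completion.isDenseInducing_coe.prodMap
    UniformSpace.Completion.isDenseInducing_coe).extend_eq N.continuous_form (x, y)

theorem continuous_completionForm :
    Continuous fun p : UniformSpace.Completion N.V × UniformSpace.Completion N.V =>
      N.completionForm p.1 p.2 := by
  let φ : N.V →+ N.V →+ B :=
    { toFun := fun x => (N.form x).toAddMonoidHom
      map_zero' := by ext; simp
      map_add' := fun x y => by ext; simp }
  have : Continuous fun p : N.V × N.V => φ p.1 p.2 := N.continuous_form
  exact (UniformSpace.Completion.isDenseInducing_toCompl N.V).extend_Z_bilin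
    (UniformSpace.Completion.isDenseInducing_toCompl N.V) this

theorem continuous_completionForm_comp {α : Type*} [TopologicalSpace α]
    {f g : α → UniformSpace.Completion N.V} (hf : Continuous f) (hg : Continuous g) :
    Continuous fun a => N.completionForm (f a) (g a) :=
  N.continuous_completionForm.comp (hf.prodMk hg)

theorem norm_completion (x : UniformSpace.Completion N.V) :
    ‖x‖ = Real.sqrt ‖N.completionForm x x‖ := by
  induction x using UniformSpace.Completion.induction_on with
  | hp =>
    exact isClosed_eq continuous_norm
      (Real.continuous_sqrt.comp (N.continuous_completionForm_comp continuous_id continuous_id).norm)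
  | ih v => rw [UniformSpace.Completion.norm_coe, completionForm_coe, N.norm_def]

theorem completionForm_extendBounded {T S : N.bounded}
    (h : ∀ v w, N.form ((T : Module.End ℂ N.V) v) w = N.form v ((S : Module.End ℂ N.V) w))
    (x y : UniformSpace.Completion N.V) :
    N.completionForm (N.extendBounded T x) y = N.completionForm x (N.extendBounded S y) := by
  induction x, y using UniformSpace.Completion.induction_on₂ with
  | hp =>
    exact isClosed_eq
      (N.continuous_completionForm_comp
        ((N.extendBounded T).continuous.comp continuous_fst) continuous_snd)
      (N.continuous_completionForm_comp continuous_fst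
        ((N.extendBounded S).continuous.comp continuous_snd))
  | ih v w => simp only [extendBounded_coe, completionForm_coe, h]

noncomputable def leftHom :
    B →ₐ[ℂ] (UniformSpace.Completion N.V →L[ℂ] UniformSpace.Completion N.V) :=
  N.extendBoundedHom.comp (N.left.codRestrict N.bounded N.left_mem_bounded)

noncomputable def rightHom :
    Bᵐᵒᵖ →ₐ[ℂ] (UniformSpace.Completion N.V →L[ℂ] UniformSpace.Completion N.V) :=
  N.extendBoundedHom.comp (N.right.codRestrict N.bounded N.right_mem_bounded)

theorem leftHom_coe (b : B) (v : N.V) :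
    N.leftHom b (v : UniformSpace.Completion N.V) = (N.left b v : UniformSpace.Completion N.V) :=
  N.extendBounded_coe _ v

theorem rightHom_coe (b : Bᵐᵒᵖ) (v : N.V) :
    N.rightHom b (v : UniformSpace.Completion N.V) = (N.right b v : UniformSpace.Completion N.V) :=
  N.extendBounded_coe _ v

/-- The Hilbert bimodule obtained by completing a semi-inner product bimodule. -/
noncomputable def completion : PointedBimodule B :=
  letI l : Module B (UniformSpace.Completion N.V) := Module.compHom _ N.leftHom.toRingHom
  letI r : Module Bᵐᵒᵖ (UniformSpace.Completion N.V) := Module.compHom _ N.rightHom.toRingHom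
  { carrier := UniformSpace.Completion N.V
    left := l
    right := r
    comm := ⟨fun b c x => by
      have : N.leftHom b * N.rightHom c = N.rightHom c * N.leftHom b :=
        N.clm_ext fun v => by simp [leftHom_coe, rightHom_coe, N.left_right]
      exact DFunLike.congr_fun this x⟩
    towerLeft := ⟨fun z b x => DFunLike.congr_fun (map_smul N.leftHom z b) x⟩
    towerRight := ⟨fun z b x => DFunLike.congr_fun (map_smul N.rightHom z b) x⟩
    inner := N.completionForm
    inner_add_left := fun x y z => by
      induction x, y, z using UniformSpace.Completion.induction_on₃ with
      | hp =>
        exact isClosed_eq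
          (N.continuous_completionForm_comp (by fun_prop) (by fun_prop))
          ((N.continuous_completionForm_comp (by fun_prop) (by fun_prop)).add
            (N.continuous_completionForm_comp (by fun_prop) (by fun_prop)))
      | ih x y z =>
        rw [← UniformSpace.Completion.coe_add]
        simp only [completionForm_coe, map_add, LinearMap.add_apply]
    inner_smul_right := fun x y b => by
      change N.completionForm x (N.rightHom (MulOpposite.op b) y) = _
      induction x, y using UniformSpace.Completion.induction_on₂ with
      | hp =>
        exact isClosed_eq
          (N.continuous_completionForm_comp (by fun_prop) (by fun_prop))
          ((N.continuous_completionForm_comp (by fun_prop) (by fun_prop)).mul continuous_const)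
      | ih x y => simp only [rightHom_coe, completionForm_coe, N.form_right]
    star_inner := fun x y => by
      induction x, y using UniformSpace.Completion.induction_on₂ with
      | hp =>
        exact isClosed_eq
          (N.continuous_completionForm_comp (by fun_prop) (by fun_prop)).star
          (N.continuous_completionForm_comp (by fun_prop) (by fun_prop))
      | ih x y => simp only [completionForm_coe, N.star_form]
    inner_self_nonneg := fun x => by
      induction x using UniformSpace.Completion.induction_on with
      | hp =>
        exact CStarAlgebra.isClosed_nonneg.preimage
          (N.continuous_completionForm_comp continuous_id continuous_id)
      | ih x => simpa only [completionForm_coe] using N.form_nonneg x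
    inner_self_eq_zero := fun x h => by
      rw [← norm_eq_zero, N.norm_completion, h, norm_zero, Real.sqrt_zero]
    inner_smul_left := fun x y b => N.completionForm_extendBounded (fun v w => N.form_left v w b) x y
    norm_eq := N.norm_completion
    vac := (N.vac : UniformSpace.Completion N.V)
    inner_vac := fun b => by
      change N.completionForm _ (N.leftHom b _) = _
      rw [leftHom_coe, completionForm_coe, N.form_vac] }

end PreBimodule

end Completion

end OpValued

namespace OpValued

/-! ### The `C⋆`-algebra of adjointable operators -/

namespace PointedBimodule

set_option linter.unusedSectionVars false

variable {B : Type u} [CStarAlgebra B] [PartialOrder B] [StarOrderedRing B]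
  (M : PointedBimodule B)

/-- A pointed Hilbert bimodule as a semi-inner product bimodule. -/
noncomputable def toPreBimodule : PreBimodule B where
  V := M.carrier
  form := LinearMap.mk₂'ₛₗ (starRingEnd ℂ) (RingHom.id ℂ) M.inner
    M.inner_add_left
    (fun z x y => by
      rw [← M.star_inner, M.inner_smul_complex_right, star_smul, M.star_inner]; rfl)
    M.inner_add_right
    (fun z x y => M.inner_smul_complex_right x y z)
  star_form := M.star_inner
  form_nonneg := M.inner_self_nonneg
  left := Algebra.lsmul ℂ ℂ M.carrier
  right := Algebra.lsmul ℂ ℂ M.carrier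
  left_right := fun b c v => smul_comm b c v
  form_right := fun x y b => M.inner_smul_right x y b
  form_left := fun x y b => M.inner_smul_left x y b
  vac := M.vac
  form_vac := M.inner_vac

theorem norm_inner_le (x y : M.carrier) : ‖M.inner x y‖ ≤ ‖x‖ * ‖y‖ := by
  rw [M.norm_eq, M.norm_eq]
  exact M.toPreBimodule.norm_form_le x y

theorem norm_sq_eq (x : M.carrier) : ‖x‖ * ‖x‖ = ‖M.inner x x‖ := by
  rw [M.norm_eq, Real.mul_self_sqrt (norm_nonneg _)]

theorem ext_inner {x y : M.carrier} (h : ∀ w, M.inner w x = M.inner w y) : x = y := by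
  rw [← sub_eq_zero]
  apply M.inner_self_eq_zero
  rw [M.inner_sub_right, h, sub_self]

theorem exists_norm_smul_le (b : B) : ∃ C : ℝ, ∀ x : M.carrier, ‖b • x‖ ≤ C * ‖x‖ := by
  obtain ⟨C, _, h⟩ := M.toPreBimodule.left_mem_bounded b
  refine ⟨C, fun x => ?_⟩
  rw [M.norm_eq, M.norm_eq]
  exact h x

/-- The bounded adjointable operators. -/
def operators : Subalgebra ℂ (M.carrier →L[ℂ] M.carrier) where
  carrier := {T | ∃ S : M.carrier →L[ℂ] M.carrier, ∀ x y, M.inner (T x) y = M.inner x (S y)}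
  add_mem' := by
    rintro t t' ⟨s, hs⟩ ⟨s', hs'⟩
    exact ⟨s + s', fun x y => by simp [M.inner_add_left, M.inner_add_right, hs, hs']⟩
  mul_mem' := by
    rintro t t' ⟨s, hs⟩ ⟨s', hs'⟩
    exact ⟨s' * s, fun x y => by simp [hs, hs']⟩
  algebraMap_mem' := by
    intro z
    refine ⟨algebraMap ℂ _ (star z), fun x y => ?_⟩
    rw [Algebra.algebraMap_eq_smul_one, Algebra.algebraMap_eq_smul_one]
    simp only [smul_apply, one_apply_eq_self]
    rw [← M.star_inner, M.inner_smul_complex_right, M.inner_smul_complex_right, star_smul,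
      M.star_inner]

/-- $\|Sy\|^2=\|\langle TSy,y\rangle\|\le\|T\|\,\|Sy\|\,\|y\|$. Applied to differences, it makes the
passage to adjoints continuous. -/
theorem norm_le_of_adjoint {T S : M.carrier →L[ℂ] M.carrier}
    (h : ∀ x y, M.inner (T x) y = M.inner x (S y)) : ‖S‖ ≤ ‖T‖ := by
  refine S.opNorm_le_bound (norm_nonneg _) fun y => ?_
  by_cases h0 : ‖S y‖ = 0
  · rw [h0]; positivity
  have h1 : ‖S y‖ * ‖S y‖ ≤ ‖T‖ * ‖y‖ * ‖S y‖ := by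
    rw [M.norm_sq_eq, ← h]
    refine (M.norm_inner_le _ _).trans ?_
    rw [mul_right_comm]
    exact mul_le_mul_of_nonneg_right (T.le_opNorm _) (norm_nonneg _)
  exact le_of_mul_le_mul_right h1 (lt_of_le_of_ne (norm_nonneg _) (Ne.symm h0))

theorem adjoint_symm {T S : M.carrier →L[ℂ] M.carrier}
    (h : ∀ x y, M.inner (T x) y = M.inner x (S y)) (x y : M.carrier) :
    M.inner (S x) y = M.inner x (T y) := by
  rw [← M.star_inner, ← h, M.star_inner]

noncomputable instance : Star M.operators where
  star T := ⟨T.2.choose, T, M.adjoint_symm T.2.choose_spec⟩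

theorem inner_star (T : M.operators) (x y : M.carrier) :
    M.inner (T.1 x) y = M.inner x ((star T).1 y) := T.2.choose_spec x y

theorem eq_star_iff {T S : M.operators} :
    S = star T ↔ ∀ x y, M.inner (T.1 x) y = M.inner x (S.1 y) := by
  constructor
  · rintro rfl
    exact M.inner_star T
  · intro h
    ext y
    exact M.ext_inner fun w => by rw [← h, ← M.inner_star]

noncomputable instance : StarRing M.operators where
  star_involutive T := by
    symm
    rw [M.eq_star_iff]
    exact M.adjoint_symm (M.inner_star T)
  star_mul S T := by
    symm
    rw [M.eq_star_iff]
    intro x y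
    change M.inner (S.1 (T.1 x)) y = M.inner x ((star T).1 ((star S).1 y))
    rw [M.inner_star, M.inner_star]
  star_add S T := by
    symm
    rw [M.eq_star_iff]
    intro x y
    change M.inner (S.1 x + T.1 x) y = M.inner x ((star S).1 y + (star T).1 y)
    rw [M.inner_add_left, M.inner_add_right, M.inner_star, M.inner_star]

noncomputable instance : StarModule ℂ M.operators where
  star_smul z T := by
    symm
    rw [M.eq_star_iff]
    intro x y
    change M.inner (z • T.1 x) y = M.inner x (star z • (star T).1 y)
    rw [M.inner_smul_complex_right, ← M.inner_star, ← M.star_inner, M.inner_smul_complex_right,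
      star_smul, M.star_inner]

/-- If $T_n\to T$, then the adjoints of the $T_n$ form a Cauchy sequence by `norm_le_of_adjoint`,
and their limit is an adjoint of $T$ by continuity of the inner product. -/
theorem isClosed_operators : IsClosed (M.operators : Set (M.carrier →L[ℂ] M.carrier)) := by
  refine isClosed_of_closure_subset fun T hT => ?_
  obtain ⟨t, ht, hlim⟩ := mem_closure_iff_seq_limit.mp hT
  choose s hs using ht
  have hc : CauchySeq s := by
    have h1 := hlim.cauchySeq
    rw [Metric.cauchySeq_iff'] at h1 ⊢
    intro ε hε
    obtain ⟨N, hN⟩ := h1 ε hε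
    refine ⟨N, fun n hn => lt_of_le_of_lt ?_ (hN n hn)⟩
    rw [dist_eq_norm, dist_eq_norm]
    refine M.norm_le_of_adjoint fun x y => ?_
    simp [M.inner_sub_left, M.inner_sub_right, hs]
  obtain ⟨S, hS⟩ := cauchySeq_tendsto_of_complete hc
  refine ⟨S, fun x y => ?_⟩
  have hcont : Continuous fun p : M.carrier × M.carrier => M.inner p.1 p.2 := by
    have e : (fun p : M.carrier × M.carrier => M.inner p.1 p.2) = fun p =>
      LinearMap.mkContinuous₂ M.toPreBimodule.form 1
        (E := M.carrier) (F := M.carrier) (fun x y => by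
          rw [one_mul]; exact M.norm_inner_le x y) p.1 p.2 := rfl
    rw [e]
    exact isBoundedBilinearMap_apply.continuous.comp
      (((ContinuousLinearMap.continuous _).comp continuous_fst).prodMk continuous_snd)
  have h1 : Filter.Tendsto (fun n => M.inner (t n x) y) Filter.atTop (nhds (M.inner (T x) y)) :=
    (hcont.tendsto (T x, y)).comp
      ((((ContinuousLinearMap.apply ℂ M.carrier x).continuous.tendsto T).comp hlim).prodMk_nhds
        tendsto_const_nhds)
  have h2 : Filter.Tendsto (fun n => M.inner x (s n y)) Filter.atTop (nhds (M.inner x (S y))) :=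
    (hcont.tendsto (x, S y)).comp (tendsto_const_nhds.prodMk_nhds
      (((ContinuousLinearMap.apply ℂ M.carrier y).continuous.tendsto S).comp hS))
  simp only [hs] at h1
  exact tendsto_nhds_unique h1 h2

/-- The $C^*$-inequality comes from $\|Tx\|^2=\|\langle x,T^*Tx\rangle\|\le\|T^*T\|\,\|x\|^2$. -/
noncomputable instance : CStarAlgebra M.operators where
  toCompleteSpace := M.isClosed_operators.completeSpace_coe
  norm_mul_self_le T := by
    have h : ‖T.1‖ ≤ Real.sqrt ‖(star T * T).1‖ := by
      refine T.1.opNorm_le_bound (Real.sqrt_nonneg _) fun x => ?_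
      refine (pow_le_pow_iff_left₀ (norm_nonneg _) (by positivity) two_ne_zero).mp ?_
      rw [mul_pow, Real.sq_sqrt (norm_nonneg _), sq, sq, M.norm_sq_eq, M.inner_star]
      refine (M.norm_inner_le _ _).trans ?_
      rw [mul_comm, ← mul_assoc]
      exact mul_le_mul_of_nonneg_right ((star T * T).1.le_opNorm x) (norm_nonneg _)
    have h2 := mul_self_le_mul_self (norm_nonneg _) h
    rwa [Real.mul_self_sqrt (norm_nonneg _)] at h2

/-- The left action of `B` by bounded adjointable operators. -/
noncomputable def leftOperator : B →⋆ₐ[ℂ] M.operators where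
  toFun b := ⟨LinearMap.mkContinuousOfExistsBound (Algebra.lsmul ℂ ℂ M.carrier b)
      (M.exists_norm_smul_le b),
    LinearMap.mkContinuousOfExistsBound (Algebra.lsmul ℂ ℂ M.carrier (star b))
      (M.exists_norm_smul_le _), fun x y => M.inner_smul_left x y b⟩
  map_one' := by ext x; exact one_smul B x
  map_mul' b c := by ext x; exact mul_smul b c x
  map_zero' := by ext x; exact zero_smul B x
  map_add' b c := by ext x; exact add_smul b c x
  commutes' z := by ext x; exact algebraMap_smul B z x
  map_star' b := by
    rw [M.eq_star_iff]
    exact fun x y => M.inner_smul_left x y b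

/-- The adjointable operators on a pointed Hilbert bimodule with the vector state. -/
noncomputable def probSpace : ProbSpace B where
  A := M.operators
  incl := M.leftOperator
  expect :=
    { toFun := fun T => M.inner M.vac (T.1 M.vac)
      map_add' := fun S T => M.inner_add_right _ _ _
      map_smul' := fun z T => M.inner_smul_complex_right _ _ _ }
  expect_bimodule b₁ b₂ T := by
    change M.inner M.vac (b₁ • T.1 (b₂ • M.vac)) = b₁ * M.inner M.vac (T.1 M.vac) * b₂
    -- An operator with an adjoint is right $\mathcal B$-linear. Since $b_2\xi=\xi b_2$, the element
    -- $b_2$ passes through $T$ as a right factor.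
    have h : T.1 (MulOpposite.op b₂ • M.vac) = MulOpposite.op b₂ • T.1 M.vac :=
      M.ext_inner fun w => by
        rw [← M.adjoint_symm (M.inner_star T), M.inner_smul_right, M.inner_smul_right,
          ← M.adjoint_symm (M.inner_star T)]
    have h2 : M.inner M.vac (b₁ • T.1 M.vac) = b₁ * M.inner M.vac (T.1 M.vac) := by
      have := M.inner_smul_left M.vac (T.1 M.vac) (star b₁)
      rw [star_star] at this
      rw [← this, ← M.vac_comm, M.inner_op_smul_left, star_star]
    rw [← M.vac_comm, h, smul_comm, M.inner_smul_right, h2]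
  expect_incl := M.inner_vac
  expect_nonneg T := by
    change 0 ≤ M.inner M.vac (T.1 ((star T).1 M.vac))
    rw [← M.adjoint_symm (M.inner_star T)]
    exact M.inner_self_nonneg _

end PointedBimodule

end OpValued

namespace OpValued

/-! ### Noncommutative polynomials -/

section Polynomials

set_option linter.unusedSectionVars false

variable {B : Type u} [CStarAlgebra B]

/-- The inclusion `B → B⟨X⟩`. -/
noncomputable def polyC : B →ₐ[ℂ] NCPoly B where
  toFun b := RingQuot.mkAlgHom ℂ (PolyRel B) (FreeAlgebra.ι ℂ (some b))
  map_one' := by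
    have := RingQuot.mkAlgHom_rel ℂ (PolyRel.scalar (B := B) 1)
    simpa using this
  map_mul' b c := by
    have := RingQuot.mkAlgHom_rel ℂ (PolyRel.mul (B := B) b c)
    rwa [map_mul] at this
  map_zero' := by
    have := RingQuot.mkAlgHom_rel ℂ (PolyRel.scalar (B := B) 0)
    simpa using this
  map_add' b c := by
    have := RingQuot.mkAlgHom_rel ℂ (PolyRel.add (B := B) b c)
    rwa [map_add] at this
  commutes' z := by
    have := RingQuot.mkAlgHom_rel ℂ (PolyRel.scalar (B := B) z)
    rwa [AlgHom.commutes] at this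

variable (B) in
/-- The indeterminate. -/
noncomputable def polyX : NCPoly B := RingQuot.mkAlgHom ℂ (PolyRel B) (FreeAlgebra.ι ℂ none)

@[simp] theorem evalPoly_polyC {A : Type*} [Ring A] [Algebra ℂ A] (f : B →ₐ[ℂ] A) (a : A) (b : B) :
    evalPoly f a (polyC b) = f b := by
  change evalPoly f a (RingQuot.mkAlgHom ℂ (PolyRel B) (FreeAlgebra.ι ℂ (some b))) = f b
  rw [evalPoly, RingQuot.liftAlgHom_mkAlgHom_apply]
  simp

@[simp] theorem evalPoly_polyX {A : Type*} [Ring A] [Algebra ℂ A] (f : B →ₐ[ℂ] A) (a : A) :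
    evalPoly f a (polyX B) = a := by
  rw [polyX, evalPoly, RingQuot.liftAlgHom_mkAlgHom_apply]
  simp

theorem poly_induction {C : NCPoly B → Prop} (hC : ∀ b, C (polyC b)) (hX : C (polyX B))
    (hadd : ∀ p q, C p → C q → C (p + q)) (hmul : ∀ p q, C p → C q → C (p * q)) (p : NCPoly B) :
    C p := by
  obtain ⟨p, rfl⟩ := RingQuot.mkAlgHom_surjective ℂ (PolyRel B) p
  induction p using FreeAlgebra.induction with
  | grade0 z =>
    rw [AlgHom.commutes, ← AlgHom.commutes polyC]
    exact hC _
  | grade1 o =>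
    cases o with
    | none => exact hX
    | some b => exact hC b
  | mul p q hp hq => rw [map_mul]; exact hmul _ _ hp hq
  | add p q hp hq => rw [map_add]; exact hadd _ _ hp hq

theorem evalPoly_map {A A' : Type*} [Ring A] [Algebra ℂ A] [Ring A'] [Algebra ℂ A']
    (f : B →ₐ[ℂ] A) (f' : B →ₐ[ℂ] A') (g : A →ₐ[ℂ] A') (h : ∀ b, g (f b) = f' b) (a : A)
    (p : NCPoly B) : evalPoly f' (g a) p = g (evalPoly f a p) := by
  induction p using poly_induction with
  | hC b => simp [h]
  | hX => simp
  | hadd p q hp hq => simp only [map_add, hp, hq]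
  | hmul p q hp hq => simp only [map_mul, hp, hq]

/-- Substitution commutes with maps that intertwine the operators. -/
theorem evalPoly_intertwine {V W : Type*} [AddCommGroup V] [Module ℂ V] [AddCommGroup W]
    [Module ℂ W] {A A' : Type*} [Ring A] [Algebra ℂ A] [Ring A'] [Algebra ℂ A']
    [Module A V] [Module A' W] (f : B →ₐ[ℂ] A) (f' : B →ₐ[ℂ] A') (J : V → W)
    (hJ : ∀ v w, J (v + w) = J v + J w) {a : A} {a' : A'}
    (hb : ∀ b v, J (f b • v) = f' b • J v) (ha : ∀ v, J (a • v) = a' • J v) (p : NCPoly B) :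
    ∀ v, J (evalPoly f a p • v) = evalPoly f' a' p • J v := by
  induction p using poly_induction with
  | hC b => simpa using hb b
  | hX => simpa using ha
  | hadd p q hp hq => intro v; simp only [map_add, add_smul, hJ, hp, hq]
  | hmul p q hp hq => intro v; simp only [map_mul, mul_smul, hp, hq]

variable (B) in
/-- The polynomials without constant term. -/
noncomputable def polyIdeal : NonUnitalSubalgebra ℂ (NCPoly B) :=
  NonUnitalAlgebra.adjoin ℂ {a | ∃ b c : B, a = polyC b * polyX B * polyC c}

theorem polyC_mul_polyX_mul_mem (b c : B) : polyC b * polyX B * polyC c ∈ polyIdeal B :=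
  NonUnitalAlgebra.subset_adjoin ℂ ⟨b, c, rfl⟩

theorem polyIdeal_induction {C : NCPoly B → Prop}
    (hX : ∀ b c : B, C (polyC b * polyX B * polyC c))
    (hadd : ∀ p q, C p → C q → C (p + q)) (hsmul : ∀ (z : ℂ) p, C p → C (z • p))
    (hmul : ∀ p q, C p → C q → C (p * q)) {p : NCPoly B} (hp : p ∈ polyIdeal B) : C p := by
  unfold polyIdeal at hp
  induction hp using NonUnitalAlgebra.adjoin_induction with
  | mem x hx => obtain ⟨b, c, rfl⟩ := hx; exact hX b c
  | add x y _ _ h h' => exact hadd _ _ h h'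
  | zero => simpa using hX 0 0
  | mul x y hx hy h h' => exact hmul _ _ h h'
  | smul z x hx h => exact hsmul z x h

theorem mul_polyC_mem (b : B) {p : NCPoly B} (hp : p ∈ polyIdeal B) :
    p * polyC b ∈ polyIdeal B := by
  unfold polyIdeal at hp
  induction hp using NonUnitalAlgebra.adjoin_induction with
  | mem x hx =>
    obtain ⟨c, d, rfl⟩ := hx
    rw [mul_assoc, ← map_mul]
    exact polyC_mul_polyX_mul_mem _ _
  | add x y _ _ h h' => rw [add_mul]; exact add_mem h h'
  | zero => simp
  | mul x y hx hy h h' => rw [mul_assoc]; exact mul_mem hx h'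
  | smul z x hx h => rw [smul_mul_assoc]; exact SMulMemClass.smul_mem z h

end Polynomials

/-! ### Mixed moments of two random variables -/

section Mixed

set_option linter.unusedSectionVars false

variable {B : Type u} [CStarAlgebra B]

/-- Alternating products of polynomials without constant term in the variables `x 0` and `x 1`. -/
def IsBlockList (l : List (Fin 2 × NCPoly B)) : Prop :=
  l.IsChain (fun p q => p.1 ≠ q.1) ∧ ∀ p ∈ l, p.2 ∈ polyIdeal B

theorem IsBlockList.tail {p : Fin 2 × NCPoly B} {l : List (Fin 2 × NCPoly B)}
    (h : IsBlockList (p :: l)) : IsBlockList l :=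
  ⟨(List.isChain_cons.mp h.1).2, fun q hq => h.2 q (List.mem_cons_of_mem p hq)⟩

/-- The value of an alternating product. -/
noncomputable def blockProd {A : Type*} [Ring A] [Algebra ℂ A] (f : B →ₐ[ℂ] A) (x : Fin 2 → A)
    (l : List (Fin 2 × NCPoly B)) : A :=
  (l.map fun p => evalPoly f (x p.1) p.2).prod

@[simp] theorem blockProd_nil {A : Type*} [Ring A] [Algebra ℂ A] (f : B →ₐ[ℂ] A) (x : Fin 2 → A) :
    blockProd f x [] = 1 := rfl

@[simp] theorem blockProd_cons {A : Type*} [Ring A] [Algebra ℂ A] (f : B →ₐ[ℂ] A) (x : Fin 2 → A)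
    (p : Fin 2 × NCPoly B) (l : List (Fin 2 × NCPoly B)) :
    blockProd f x (p :: l) = evalPoly f (x p.1) p.2 * blockProd f x l := by
  simp [blockProd]

/-- Multiplication by a variable from the left sends an alternating product to one. -/
theorem exists_block_mul (i : Fin 2) (b : B) (l : List (Fin 2 × NCPoly B)) (hl : IsBlockList l) :
    ∃ l', IsBlockList l' ∧ ∀ (A : Type u) [Ring A] [Algebra ℂ A] (f : B →ₐ[ℂ] A) (x : Fin 2 → A),
      x i * (f b * blockProd f x l) = f 1 * blockProd f x l' := by
  have key : ∀ l, IsBlockList l → (∀ p ∈ l.head?, i ≠ p.1) →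
      IsBlockList ((i, polyC 1 * polyX B * polyC b) :: l) := by
    intro l hl h
    refine ⟨List.isChain_cons.mpr ⟨h, hl.1⟩, ?_⟩
    intro p hp
    rcases List.mem_cons.mp hp with rfl | hp
    · exact polyC_mul_polyX_mul_mem _ _
    · exact hl.2 p hp
  -- The factor $x_ib$ is absorbed by the first block if that block has index $i$. Otherwise it
  -- forms a new block. The list stays alternating in both cases, and no constant term appears.
  cases l with
  | nil => exact ⟨_, key [] hl (by simp), fun A _ _ f x => by simp⟩
  | cons p t =>
    obtain ⟨j, q⟩ := p
    by_cases h : i = j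
    · subst h
      refine ⟨(i, polyC 1 * polyX B * polyC b * q) :: t, ⟨?_, ?_⟩, fun A _ _ f x => ?_⟩
      · exact List.isChain_cons.mpr (List.isChain_cons.mp hl.1)
      · intro p hp
        rcases List.mem_cons.mp hp with rfl | hp
        · exact mul_mem (polyC_mul_polyX_mul_mem _ _) (hl.2 _ List.mem_cons_self)
        · exact hl.2 p (List.mem_cons_of_mem _ hp)
      · simp [mul_assoc]
    · exact ⟨_, key _ hl (by simpa using h), fun A _ _ f x => by simp [mul_assoc]⟩

/-- The distribution of a sum is determined by the values of the functional on alternating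
products. -/
theorem eval_add_eq_of_blocks {A A' : Type u} [Ring A] [Algebra ℂ A] [Ring A'] [Algebra ℂ A']
    {f : B →ₐ[ℂ] A} {f' : B →ₐ[ℂ] A'} {φ : A →ₗ[ℂ] B} {φ' : A' →ₗ[ℂ] B}
    {x : Fin 2 → A} {x' : Fin 2 → A'}
    (hφ : ∀ b a, φ (f b * a) = b * φ a) (hφ' : ∀ b a, φ' (f' b * a) = b * φ' a)
    (h : ∀ l, IsBlockList l → φ (blockProd f x l) = φ' (blockProd f' x' l)) (p : NCPoly B) :
    φ (evalPoly f (x 0 + x 1) p) = φ' (evalPoly f' (x' 0 + x' 1) p) := by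
  -- Both models are treated at once in $A\times A'$. The span of the pairs of corresponding
  -- alternating products contains $(1,1)$ and is stable under left multiplication by the pairs of
  -- variables and of coefficients. It therefore contains the two evaluations of every polynomial,
  -- and $\varphi,\varphi'$ agree on it.
  let N : Submodule ℂ (A × A') := Submodule.span ℂ
    {w | ∃ b l, IsBlockList l ∧ w = (f b * blockProd f x l, f' b * blockProd f' x' l)}
  have hX : ∀ i, ∀ w ∈ N, (x i, x' i) * w ∈ N := by
    intro i w hw
    induction hw using Submodule.span_induction with
    | mem w hw =>
      obtain ⟨b, l, hl, rfl⟩ := hw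
      obtain ⟨l', hl', e⟩ := exists_block_mul i b l hl
      refine Submodule.subset_span ⟨1, l', hl', ?_⟩
      rw [Prod.mk_mul_mk, e A f x, e A' f' x']
    | zero => rw [mul_zero]; exact N.zero_mem
    | add v w _ _ hv hw => rw [mul_add]; exact N.add_mem hv hw
    | smul z w _ hw => rw [mul_smul_comm]; exact N.smul_mem z hw
  have hC : ∀ c, ∀ w ∈ N, (f c, f' c) * w ∈ N := by
    intro c w hw
    induction hw using Submodule.span_induction with
    | mem w hw =>
      obtain ⟨b, l, hl, rfl⟩ := hw
      refine Submodule.subset_span ⟨c * b, l, hl, ?_⟩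
      rw [Prod.mk_mul_mk, map_mul, map_mul, mul_assoc, mul_assoc]
    | zero => rw [mul_zero]; exact N.zero_mem
    | add v w _ _ hv hw => rw [mul_add]; exact N.add_mem hv hw
    | smul z w _ hw => rw [mul_smul_comm]; exact N.smul_mem z hw
  have hp : ∀ w ∈ N, (evalPoly f (x 0 + x 1) p, evalPoly f' (x' 0 + x' 1) p) * w ∈ N := by
    induction p using poly_induction with
    | hC b => simpa using hC b
    | hX =>
      intro w hw
      rw [evalPoly_polyX, evalPoly_polyX, ← Prod.mk_add_mk, add_mul]
      exact N.add_mem (hX 0 w hw) (hX 1 w hw)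
    | hadd p q hp hq =>
      intro w hw
      rw [map_add, map_add, ← Prod.mk_add_mk, add_mul]
      exact N.add_mem (hp w hw) (hq w hw)
    | hmul p q hp hq =>
      intro w hw
      rw [map_mul, map_mul, ← Prod.mk_mul_mk, mul_assoc]
      exact hp _ (hq w hw)
  have h1 : ((1 : A), (1 : A')) ∈ N :=
    Submodule.subset_span ⟨1, [], ⟨List.isChain_nil, by simp⟩, by simp⟩
  have h2 : ∀ w ∈ N, φ w.1 = φ' w.2 := by
    intro w hw
    induction hw using Submodule.span_induction with
    | mem w hw =>
      obtain ⟨b, l, hl, rfl⟩ := hw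
      rw [hφ, hφ', h l hl]
    | zero => simp
    | add v w _ _ hv hw => simp [hv, hw]
    | smul z w _ hw => simp [hw]
  simpa using h2 _ (hp _ h1)

end Mixed

/-! ### Boolean and monotone convolutions depend only on the marginal distributions -/

section Uniqueness

set_option linter.unusedSectionVars false

variable {B : Type u} [CStarAlgebra B] [PartialOrder B] [StarOrderedRing B]

namespace ProbSpace

theorem expect_incl_mul (S : ProbSpace B) (b : B) (a : S.A) :
    S.expect (S.incl b * a) = b * S.expect a := by
  simpa using S.expect_bimodule b 1 a

theorem expect_mul_incl (S : ProbSpace B) (b : B) (a : S.A) :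
    S.expect (a * S.incl b) = S.expect a * b := by
  simpa using S.expect_bimodule 1 b a

theorem expect_one (S : ProbSpace B) : S.expect 1 = 1 := by
  simpa using S.expect_incl 1

theorem dist_apply (S : ProbSpace B) (a : S.A) (p : NCPoly B) :
    S.dist a p = S.expect (evalPoly S.incl.toAlgHom a p) := rfl

theorem incl_mul_mul_incl_mem (S : ProbSpace B) (x : S.A) (b c : B) :
    S.incl b * x * S.incl c ∈ S.alg₀ x :=
  NonUnitalAlgebra.subset_adjoin ℂ ⟨b, c, rfl⟩

theorem evalPoly_mem_alg₀ (S : ProbSpace B) (x : S.A) {p : NCPoly B} (hp : p ∈ polyIdeal B) :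
    evalPoly S.incl.toAlgHom x p ∈ S.alg₀ x := by
  refine polyIdeal_induction (C := fun p => evalPoly S.incl.toAlgHom x p ∈ S.alg₀ x)
    ?_ ?_ ?_ ?_ hp
  · intro b c
    simpa using S.incl_mul_mul_incl_mem x b c
  · intro p q hp hq
    rw [map_add]; exact add_mem hp hq
  · intro z p hp
    rw [map_smul]; exact SMulMemClass.smul_mem z hp
  · intro p q hp hq
    rw [map_mul]; exact mul_mem hp hq

/-- The list of random variables of an alternating product. -/
noncomputable def blockValues (S : ProbSpace B) (x : Fin 2 → S.A) (l : List (Fin 2 × NCPoly B)) :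
    List (Fin 2 × S.A) :=
  l.map fun p => (p.1, evalPoly S.incl.toAlgHom (x p.1) p.2)

theorem blockValues_mem (S : ProbSpace B) (x : Fin 2 → S.A) {l : List (Fin 2 × NCPoly B)}
    (hl : IsBlockList l) : ∀ p ∈ S.blockValues x l, p.2 ∈ S.alg₀ (x p.1) := by
  intro p hp
  obtain ⟨q, hq, rfl⟩ := List.mem_map.mp hp
  exact S.evalPoly_mem_alg₀ _ (hl.2 q hq)

theorem prod_blockValues (S : ProbSpace B) (x : Fin 2 → S.A) (l : List (Fin 2 × NCPoly B)) :
    ((S.blockValues x l).map Prod.snd).prod = blockProd S.incl.toAlgHom x l := by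
  rw [blockValues, List.map_map]
  rfl

theorem dist_add_eq_of_blocks {S S' : ProbSpace B} {x : Fin 2 → S.A} {x' : Fin 2 → S'.A}
    (h : ∀ l, IsBlockList l → S.expect (blockProd S.incl.toAlgHom x l) =
      S'.expect (blockProd S'.incl.toAlgHom x' l)) :
    S.dist (x 0 + x 1) = S'.dist (x' 0 + x' 1) := by
  ext p
  exact eval_add_eq_of_blocks S.expect_incl_mul S'.expect_incl_mul h p

/-- Independence factors the expectation of an alternating product into the expectations of its
blocks, and these are values of the marginal distributions. -/
theorem BooleanIndep.dist_add {S S' : ProbSpace B} {x : Fin 2 → S.A} {x' : Fin 2 → S'.A}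
    (h : S.BooleanIndep x) (h' : S'.BooleanIndep x') (hx : ∀ i, S.dist (x i) = S'.dist (x' i)) :
    S.dist (x 0 + x 1) = S'.dist (x' 0 + x' 1) := by
  refine dist_add_eq_of_blocks fun l hl => ?_
  have hc : ∀ (T : ProbSpace B) (y : Fin 2 → T.A),
      (T.blockValues y l).IsChain fun p q => p.1 ≠ q.1 := fun T y => by
    rw [blockValues, List.isChain_map]
    exact hl.1
  rw [← prod_blockValues, ← prod_blockValues, h _ (S.blockValues_mem x hl) (hc S x),
    h' _ (S'.blockValues_mem x' hl) (hc S' x')]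
  simp only [blockValues, List.map_map]
  congr 1
  refine List.map_congr_left fun p _ => ?_
  exact DFunLike.congr_fun (hx p.1) p.2

theorem MonotoneIndep.expect_blockProd {S : ProbSpace B} {x : Fin 2 → S.A} (h : S.MonotoneIndep x)
    {l r : List (Fin 2 × NCPoly B)} {q : NCPoly B} (hl : IsBlockList l) (hr : IsBlockList r)
    (hq : q ∈ polyIdeal B) (hl' : ∀ p ∈ l.getLast?, p.1 < 1) (hr' : ∀ p ∈ r.head?, p.1 < 1) :
    S.expect (blockProd S.incl.toAlgHom x l * evalPoly S.incl.toAlgHom (x 1) q *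
        blockProd S.incl.toAlgHom x r) =
      S.expect (blockProd S.incl.toAlgHom x l * S.incl (S.dist (x 1) q) *
        blockProd S.incl.toAlgHom x r) := by
  have := h (S.blockValues x l) (S.blockValues x r) 1 _ (S.blockValues_mem x hl)
    (S.blockValues_mem x hr) (S.evalPoly_mem_alg₀ (x 1) hq)
    (by
      intro p hp
      rw [blockValues, List.getLast?_map] at hp
      obtain ⟨q, hq, rfl⟩ := Option.mem_map.mp hp
      exact hl' q hq)
    (by
      intro p hp
      rw [blockValues, List.head?_map] at hp
      obtain ⟨q, hq, rfl⟩ := Option.mem_map.mp hp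
      exact hr' q hq)
  rwa [prod_blockValues, prod_blockValues] at this

/-- Induction on the number of blocks. A block in $x_1$, the variable with the larger index, may be
replaced by its expectation in $\mathcal B$. At an end this is a scalar pulled out of $\mathbb E$.
Between two blocks in $x_0$ it glues them into one. -/
theorem MonotoneIndep.dist_add {S S' : ProbSpace B} {x : Fin 2 → S.A} {x' : Fin 2 → S'.A}
    (h : S.MonotoneIndep x) (h' : S'.MonotoneIndep x') (hx : ∀ i, S.dist (x i) = S'.dist (x' i)) :
    S.dist (x 0 + x 1) = S'.dist (x' 0 + x' 1) := by
  refine dist_add_eq_of_blocks fun l hl => ?_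
  induction hn : l.length using Nat.strong_induction_on generalizing l with
  | _ n ih =>
  subst hn
  match l, hl with
  | [], _ => simp [expect_one]
  | (1, r) :: t, hl =>
    have ht : ∀ p ∈ t.head?, p.1 < 1 := fun p hp => by
      have := (List.isChain_cons.mp hl.1).1 p hp
      simp only at this
      omega
    have hr := hl.2 _ List.mem_cons_self
    have e := h.expect_blockProd (l := []) ⟨List.isChain_nil, by simp⟩ hl.tail hr (by simp) ht
    have e' := h'.expect_blockProd (l := []) ⟨List.isChain_nil, by simp⟩ hl.tail hr (by simp) ht
    simp only [blockProd_nil, one_mul, expect_incl_mul] at e e'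
    rw [blockProd_cons, blockProd_cons, e, e', hx, ih t.length (by simp) t hl.tail rfl]
  | [(0, q)], hl =>
    simpa [dist_apply] using DFunLike.congr_fun (hx 0) q
  | [(0, q), (1, r)], hl =>
    have hr := hl.2 (1, r) (by simp)
    have hq : IsBlockList [((0 : Fin 2), q)] := ⟨by simp, fun p hp => hl.2 p (by simp_all)⟩
    have e := h.expect_blockProd (r := []) hq ⟨List.isChain_nil, by simp⟩ hr (by simp) (by simp)
    have e' := h'.expect_blockProd (r := []) hq ⟨List.isChain_nil, by simp⟩ hr (by simp) (by simp)
    simp only [blockProd_nil, mul_one, expect_mul_incl, blockProd_cons] at e e'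
    have h0 := DFunLike.congr_fun (hx 0) q
    rw [dist_apply, dist_apply] at h0
    simp only [blockProd_cons, blockProd_nil, mul_one]
    rw [e, e', hx, h0]
  | (0, q) :: (1, r) :: (0, q') :: t, hl =>
    have hr := hl.2 (1, r) (by simp)
    have hq : IsBlockList [((0 : Fin 2), q)] := ⟨by simp, fun p hp => hl.2 p (by simp_all)⟩
    have e := h.expect_blockProd hq hl.tail.tail hr (by simp) (by simp)
    have e' := h'.expect_blockProd hq hl.tail.tail hr (by simp) (by simp)
    -- The glued block has no constant term since $q$ and $q'$ have none, so the shorter word is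
    -- again alternating and induction applies.
    have hl2 : IsBlockList ((0, q * polyC (S'.dist (x' 1) r) * q') :: t) := by
      refine ⟨List.isChain_cons.mpr (List.isChain_cons.mp hl.tail.tail.1), ?_⟩
      intro p hp
      rcases List.mem_cons.mp hp with rfl | hp
      · exact mul_mem (mul_polyC_mem _ (hl.2 (0, q) (by simp))) (hl.2 (0, q') (by simp))
      · exact hl.2 p (by simp [hp])
    have e3 := ih _ (by simp) _ hl2 rfl
    simp only [blockProd_cons, map_mul, evalPoly_polyC, blockProd_nil, mul_one, mul_assoc] at e e' e3 ⊢
    rw [e, e', hx]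
    exact e3
  | (0, q) :: (0, q') :: t, hl => exact absurd hl.1 (by simp)
  | (0, q) :: (1, r) :: (1, q') :: t, hl => exact absurd hl.1 (by simp)

end ProbSpace

end Uniqueness

end OpValued

namespace OpValued

/-! ### Algebraic characterization of the orthogonal convolution -/

section Orthogonal

set_option linter.unusedSectionVars false

variable {B : Type u} [CStarAlgebra B] {A : Type u} [Ring A] [Algebra ℂ A]

/-- Two elements `x 0`, `x 1` of an algebra with a `B`-valued functional `φ` are in orthogonal
position: `e` plays the role of the projection onto the specified vector, and `p` that of the
projection onto the space on which `x 0` acts. -/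
structure IsOrthogonalModel (μ ν : Distribution B) (f : B →ₐ[ℂ] A) (φ : A →ₗ[ℂ] B)
    (x : Fin 2 → A) (p e : A) : Prop where
  map_left : ∀ b a, φ (f b * a) = b * φ a
  map_mul_mul : ∀ a a', φ (a * e * a') = φ a * φ a'
  map_one : φ 1 = 1
  left_mul : p * x 0 = x 0
  mul_right : x 0 * p = x 0
  comm : ∀ b, p * f b = f b * p
  comm_vac : ∀ b, e * f b = f b * e
  vac_mul : e * x 1 = 0
  mul_vac : x 1 * e = 0
  compress : ∀ r ∈ polyIdeal B, p * evalPoly f (x 1) r * p = f (ν r) * (p - e)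
  dist : ∀ q ∈ polyIdeal B, φ (evalPoly f (x 0) q) = μ q

/-- Every monomial without constant term ends in $x$ times a coefficient, and $p$ commutes with
coefficients. Constants would violate this, hence the restriction to `polyIdeal`. The three variants
below rest on the same observation. -/
theorem evalPoly_mul_eq_self {f : B →ₐ[ℂ] A} {x p : A} (hx : x * p = x)
    (hp : ∀ b, p * f b = f b * p) {q : NCPoly B} (hq : q ∈ polyIdeal B) :
    evalPoly f x q * p = evalPoly f x q := by
  refine polyIdeal_induction (C := fun q => evalPoly f x q * p = evalPoly f x q) ?_ ?_ ?_ ?_ hq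
  · intro b c
    simp only [map_mul, evalPoly_polyC, evalPoly_polyX]
    rw [mul_assoc, ← hp, ← mul_assoc, mul_assoc (f b), hx]
  · intro r s hr hs
    rw [map_add, add_mul, hr, hs]
  · intro z r hr
    rw [map_smul, smul_mul_assoc, hr]
  · intro r s hr hs
    rw [map_mul, mul_assoc, hs]

theorem mul_evalPoly_eq_self {f : B →ₐ[ℂ] A} {x p : A} (hx : p * x = x)
    (hp : ∀ b, p * f b = f b * p) {q : NCPoly B} (hq : q ∈ polyIdeal B) :
    p * evalPoly f x q = evalPoly f x q := by
  refine polyIdeal_induction (C := fun q => p * evalPoly f x q = evalPoly f x q) ?_ ?_ ?_ ?_ hq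
  · intro b c
    simp only [map_mul, evalPoly_polyC, evalPoly_polyX]
    rw [← mul_assoc, ← mul_assoc, hp, mul_assoc (f b), hx]
  · intro r s hr hs
    rw [map_add, mul_add, hr, hs]
  · intro z r hr
    rw [map_smul, mul_smul_comm, hr]
  · intro r s hr hs
    rw [map_mul, ← mul_assoc, hr]

theorem evalPoly_mul_eq_zero {f : B →ₐ[ℂ] A} {x p : A} (hx : x * p = 0)
    (hp : ∀ b, p * f b = f b * p) {q : NCPoly B} (hq : q ∈ polyIdeal B) :
    evalPoly f x q * p = 0 := by
  refine polyIdeal_induction (C := fun q => evalPoly f x q * p = 0) ?_ ?_ ?_ ?_ hq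
  · intro b c
    simp only [map_mul, evalPoly_polyC, evalPoly_polyX]
    rw [mul_assoc, ← hp, ← mul_assoc, mul_assoc (f b), hx, mul_zero, zero_mul]
  · intro r s hr hs
    rw [map_add, add_mul, hr, hs, add_zero]
  · intro z r hr
    rw [map_smul, smul_mul_assoc, hr, smul_zero]
  · intro r s hr hs
    rw [map_mul, mul_assoc, hs, mul_zero]

theorem mul_evalPoly_eq_zero {f : B →ₐ[ℂ] A} {x p : A} (hx : p * x = 0)
    (hp : ∀ b, p * f b = f b * p) {q : NCPoly B} (hq : q ∈ polyIdeal B) :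
    p * evalPoly f x q = 0 := by
  refine polyIdeal_induction (C := fun q => p * evalPoly f x q = 0) ?_ ?_ ?_ ?_ hq
  · intro b c
    simp only [map_mul, evalPoly_polyC, evalPoly_polyX]
    rw [← mul_assoc, ← mul_assoc, hp, mul_assoc (f b), hx, mul_zero, zero_mul]
  · intro r s hr hs
    rw [map_add, mul_add, hr, hs, add_zero]
  · intro z r hr
    rw [map_smul, mul_smul_comm, hr, smul_zero]
  · intro r s hr hs
    rw [map_mul, ← mul_assoc, hr, zero_mul]

namespace IsOrthogonalModel

variable {μ ν : Distribution B} {f : B →ₐ[ℂ] A} {φ : A →ₗ[ℂ] B} {x : Fin 2 → A} {p e : A}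

theorem map_vac_mul (h : IsOrthogonalModel μ ν f φ x p e) (a : A) : φ (e * a) = φ a := by
  simpa [h.map_one] using h.map_mul_mul 1 a

theorem map_mul_vac (h : IsOrthogonalModel μ ν f φ x p e) (a : A) : φ (a * e) = φ a := by
  simpa [h.map_one] using h.map_mul_mul a 1

/-- $\varphi$ does not change when $e$ is put in front, and $e$ annihilates $x_1$. So a word that
begins with a block in $x_1$ has moment zero; `map_mul_one` is the mirror image. -/
theorem map_cons_one (h : IsOrthogonalModel μ ν f φ x p e) {r : NCPoly B}
    (hr : r ∈ polyIdeal B) (a : A) : φ (evalPoly f (x 1) r * a) = 0 := by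
  rw [← h.map_vac_mul, ← mul_assoc, mul_evalPoly_eq_zero h.vac_mul h.comm_vac hr, zero_mul, map_zero]

theorem map_mul_one (h : IsOrthogonalModel μ ν f φ x p e) {r : NCPoly B}
    (hr : r ∈ polyIdeal B) (a : A) : φ (a * evalPoly f (x 1) r) = 0 := by
  rw [← h.map_mul_vac, mul_assoc, evalPoly_mul_eq_zero h.mul_vac h.comm_vac hr, mul_zero, map_zero]

/-- The outer blocks carry $p$ on the inside, so the middle block is compressed to $\nu(r)(p-e)$.
The term with $p$ glues the outer blocks, and the term with $e$ splits $\varphi$ into a product.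
Both results involve shorter words, which drives the recursion in `eval_add_eq`. -/
theorem map_zero_one_zero (h : IsOrthogonalModel μ ν f φ x p e) {q r q' : NCPoly B}
    (hq : q ∈ polyIdeal B) (hr : r ∈ polyIdeal B) (hq' : q' ∈ polyIdeal B) (a : A) :
    φ (evalPoly f (x 0) q * (evalPoly f (x 1) r * (evalPoly f (x 0) q' * a))) =
      φ (evalPoly f (x 0) (q * polyC (ν r) * q') * a) -
        μ (q * polyC (ν r)) * φ (evalPoly f (x 0) q' * a) := by
  have h1 : evalPoly f (x 0) q * evalPoly f (x 1) r * evalPoly f (x 0) q' =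
      evalPoly f (x 0) (q * polyC (ν r) * q') -
        evalPoly f (x 0) (q * polyC (ν r)) * e * evalPoly f (x 0) q' := by
    conv_lhs =>
      rw [← evalPoly_mul_eq_self h.mul_right h.comm hq, ← mul_evalPoly_eq_self h.left_mul h.comm hq']
    have e1 : evalPoly f (x 0) q * p * evalPoly f (x 1) r * (p * evalPoly f (x 0) q') =
        evalPoly f (x 0) q * (p * evalPoly f (x 1) r * p) * evalPoly f (x 0) q' := by
      simp only [mul_assoc]
    rw [e1, h.compress r hr]
    simp only [map_mul, evalPoly_polyC, mul_sub, sub_mul, mul_assoc,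
      mul_evalPoly_eq_self h.left_mul h.comm hq']
  rw [← mul_assoc, ← mul_assoc, h1, sub_mul, map_sub, mul_assoc _ (evalPoly f (x 0) q') a,
    h.map_mul_mul, h.dist _ (mul_polyC_mem _ hq)]

/-- The moments of `x 0 + x 1` are determined by `μ` and `ν`. -/
theorem eval_add_eq {A' : Type u} [Ring A'] [Algebra ℂ A'] {f' : B →ₐ[ℂ] A'} {φ' : A' →ₗ[ℂ] B}
    {x' : Fin 2 → A'} {p' e' : A'} (h : IsOrthogonalModel μ ν f φ x p e)
    (h' : IsOrthogonalModel μ ν f' φ' x' p' e') (P : NCPoly B) :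
    φ (evalPoly f (x 0 + x 1) P) = φ' (evalPoly f' (x' 0 + x' 1) P) := by
  refine eval_add_eq_of_blocks h.map_left h'.map_left (fun l hl => ?_) P
  induction hn : l.length using Nat.strong_induction_on generalizing l with
  | _ n ih =>
  subst hn
  match l, hl with
  | [], _ => simp [h.map_one, h'.map_one]
  | (1, r) :: t, hl =>
    have hr := hl.2 (1, r) (by simp)
    simp only [blockProd_cons]
    rw [h.map_cons_one hr, h'.map_cons_one hr]
  | [(0, q)], hl =>
    have hq := hl.2 (0, q) (by simp)
    simp only [blockProd_cons, blockProd_nil, mul_one]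
    rw [h.dist q hq, h'.dist q hq]
  | [(0, q), (1, r)], hl =>
    have hr := hl.2 (1, r) (by simp)
    simp only [blockProd_cons, blockProd_nil, mul_one]
    rw [h.map_mul_one hr, h'.map_mul_one hr]
  | (0, q) :: (1, r) :: (0, q') :: t, hl =>
    have hr := hl.2 (1, r) (by simp)
    have hq := hl.2 (0, q) (by simp)
    have hq' := hl.2 (0, q') (by simp)
    have hl2 : IsBlockList ((0, q * polyC (ν r) * q') :: t) := by
      refine ⟨List.isChain_cons.mpr (List.isChain_cons.mp hl.tail.tail.1), ?_⟩
      intro p hp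
      rcases List.mem_cons.mp hp with rfl | hp
      · exact mul_mem (mul_polyC_mem _ hq) hq'
      · exact hl.2 p (by simp [hp])
    have e2 := ih _ (by simp) _ hl2 rfl
    have e3 := ih _ (by simp) _ hl.tail.tail rfl
    simp only [blockProd_cons] at e2 e3 ⊢
    rw [h.map_zero_one_zero hq hr hq', h'.map_zero_one_zero hq hr hq', e2, e3]
  | (0, q) :: (0, q') :: t, hl => exact absurd hl.1 (by simp)
  | (0, q) :: (1, r) :: (1, q') :: t, hl => exact absurd hl.1 (by simp)

end IsOrthogonalModel

end Orthogonal

end OpValued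

namespace OpValued

/-! ### The orthogonal convolution on the reduced free product -/

namespace FreeProd

set_option linter.unusedSectionVars false

variable {B : Type u} [CStarAlgebra B] [PartialOrder B] {I : Type} {M : I → PointedBimodule B}
  [DecidableEq I]

variable (M) in
/-- The class of an elementary tensor. -/
noncomputable def tensor (t : Tensor M) : Space M := (null M).mkQ (Finsupp.single t 1)

/-- The image of `y ⊗ t` under `V_i`. -/
noncomputable def joinVec (i : I) (t : TensorOff M i) (y : (M i).carrier) : Space M :=
  (null M).mkQ (join i y t)

/-- Modulo null vectors each elementary tensor is some $V_i(y'\otimes s)$, so these vectors suffice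
to test equality. The test is needed because `join` is additive in $y$ only modulo null vectors. -/
theorem mk_join_eq_mk {i : I} {y : (M i).carrier} {t : TensorOff M i} {v : Formal M}
    (h : ∀ (y' : (M i).carrier) (s : TensorOff M i),
      form (join i y' s) v = form (join i y' s) (join i y t)) :
    (null M).mkQ v = (null M).mkQ (join i y t) := by
  refine mk_eq_mk fun s => ?_
  rw [← form_congr_left (mk_join_split i s), h, form_congr_left (mk_join_split i s)]

theorem joinVec_add (i : I) (t : TensorOff M i) (y y' : (M i).carrier) :
    joinVec i t (y + y') = joinVec i t y + joinVec i t y' := by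
  rw [joinVec, joinVec, joinVec, ← map_add]
  refine (mk_join_eq_mk fun z s => ?_).symm
  rw [form_add_right, form_join, form_join, form_join, (M i).inner_add_right, kernel_add]

theorem split_off (i : I) (t : TensorOff M i) : split i t.1 = ((M i).vac, t) := by
  obtain ⟨⟨t, h⟩, ht⟩ := t
  cases t with
  | nil => rfl
  | cons q t =>
    obtain ⟨j, m⟩ := q
    have : j ≠ i := by simpa using (ht ⟨j, m⟩ (by simp)).symm
    simp [split, this]

theorem joinVec_split (i : I) (t : Tensor M) :
    joinVec i (split i t).2 (split i t).1 = tensor M t := mk_join_split i t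

theorem joinVec_vac (i : I) (t : TensorOff M i) : joinVec i t (M i).vac = tensor M t.1 := by
  have := joinVec_split i t.1
  rwa [split_off] at this

/-- The operator is defined on elementary tensors, where $y$ is $\xi_i$ or lies in $M_i^\circ$. For
general $y$ the formula follows by moving the operator to the other side of the form through its
adjoint. -/
theorem lambda_joinVec (i : I) (a : (M i).adjointable) (t : TensorOff M i) (y : (M i).carrier) :
    lambda i a (joinVec i t y) = joinVec i t (a.1 y) := by
  obtain ⟨a, a', h⟩ := a
  change (null M).mkQ (extend (lambdaTensor i a) (join i y t)) = (null M).mkQ (join i (a y) t)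
  refine mk_eq_mk fun s => ?_
  rw [form_extend_adjoint _ _ (lambdaTensor_adjoint i a a' h), extend_single, MulOpposite.op_one,
    one_smul, lambdaTensor, form_join, ← form_congr_left (mk_join_split i s), form_join,
    ← (M i).star_inner, ← h, (M i).star_inner]

theorem inner_vac_smul (N : PointedBimodule B) (b : B) (y : N.carrier) :
    N.inner N.vac (b • y) = b * N.inner N.vac y := by
  have := N.inner_smul_left N.vac y (star b)
  rw [star_star] at this
  rw [← this, ← N.vac_comm, N.inner_op_smul_left, star_star]

theorem toCirc_smul (N : PointedBimodule B) (b : B) (y : N.carrier) :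
    N.toCirc (b • y) = b • N.toCirc y := by
  ext
  simp only [PointedBimodule.toCirc, Submodule.coe_smul, smul_sub, inner_vac_smul]
  rw [MulOpposite.op_mul, mul_smul, N.vac_comm b, ← smul_comm b]

theorem leftHom_joinVec (i : I) (b : B) (t : TensorOff M i) (y : (M i).carrier) :
    leftHom b (joinVec i t y) = joinVec i t (b • y) := by
  change (null M).mkQ (extend (leftTensor b) (join i y t)) = (null M).mkQ (join i (b • y) t)
  simp only [join, map_add, extend_leftTensor, inner_vac_smul, extend_single, toCirc_smul]
  simp [leftTensor]

theorem leftHom_tensor (b : B) (t : Tensor M) :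
    leftHom b (tensor M t) = (null M).mkQ (leftTensor b t) := by
  change (null M).mkQ (extend (leftTensor b) (Finsupp.single t 1)) = _
  rw [extend_single, MulOpposite.op_one, one_smul]

open Classical in
theorem proj_tensor (J : Set (List I)) (t : Tensor M) :
    proj J (tensor M t) = if word M t ∈ J then tensor M t else 0 := by
  change (null M).mkQ (extend _ (Finsupp.single t 1)) = _
  rw [extend_single, MulOpposite.op_one, one_smul]
  split_ifs
  · rfl
  · exact map_zero _

theorem proj_tensor_of_mem {J : Set (List I)} {t : Tensor M} (h : word M t ∈ J) :
    proj J (tensor M t) = tensor M t := by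
  rw [proj_tensor, if_pos h]

theorem proj_tensor_of_notMem {J : Set (List I)} {t : Tensor M} (h : word M t ∉ J) :
    proj J (tensor M t) = 0 := by
  rw [proj_tensor, if_neg h]

theorem proj_mul_proj (J J' : Set (List I)) :
    (proj J * proj J' : Module.End Bᵐᵒᵖ (Space M)) = proj (J ∩ J') := by
  refine end_ext fun t => ?_
  change proj J (proj J' (tensor M t)) = proj (J ∩ J') (tensor M t)
  by_cases h : word M t ∈ J'
  · by_cases h' : word M t ∈ J
    · rw [proj_tensor_of_mem h, proj_tensor_of_mem h', proj_tensor_of_mem (Set.mem_inter h' h)]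
    · rw [proj_tensor_of_mem h, proj_tensor_of_notMem h', proj_tensor_of_notMem fun hh => h' hh.1]
  · rw [proj_tensor_of_notMem h, map_zero, proj_tensor_of_notMem fun hh => h hh.2]

theorem proj_empty : (proj ∅ : Module.End Bᵐᵒᵖ (Space M)) = 0 :=
  end_ext fun _ => proj_tensor_of_notMem (Set.notMem_empty _)

/-- Left multiplication preserves words, so it commutes with every $P_J$. The right coefficient
matters only for $\xi$, where $b\xi=\xi b$. -/
theorem exists_leftTensor (b : B) (t : Tensor M) :
    ∃ (s : Tensor M) (c : B), word M s = word M t ∧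
      (null M).mkQ (leftTensor b t) = MulOpposite.op c • tensor M s := by
  obtain ⟨t, h⟩ := t
  cases t with
  | nil =>
    refine ⟨⟨[], h⟩, b, rfl, ?_⟩
    rw [tensor, ← map_smul]
    simp [leftTensor]
  | cons q t =>
    refine ⟨⟨⟨q.1, b • q.2⟩ :: t, by rw [List.isChain_cons] at h ⊢; exact h⟩, 1, rfl, ?_⟩
    simp [leftTensor, tensor]

theorem proj_comm_leftHom (J : Set (List I)) (b : B) :
    (proj J * leftHom b : Module.End Bᵐᵒᵖ (Space M)) = leftHom b * proj J := by
  refine end_ext fun t => ?_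
  change proj J (leftHom b (tensor M t)) = leftHom b (proj J (tensor M t))
  obtain ⟨s, c, hs, e⟩ := exists_leftTensor b t
  by_cases h : word M t ∈ J
  · rw [proj_tensor_of_mem h, leftHom_tensor, e, map_smul, proj_tensor_of_mem (by rwa [hs])]
  · rw [proj_tensor_of_notMem h, map_zero, leftHom_tensor, e, map_smul,
      proj_tensor_of_notMem (by rwa [hs]), smul_zero]

/-- The elementary tensor `m ⊗ t`. -/
def consTensor (i : I) (m : (M i).circ) (t : TensorOff M i) : Tensor M :=
  ⟨⟨i, m⟩ :: t.1.1, List.isChain_cons.mpr ⟨t.2, t.1.2⟩⟩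

theorem joinVec_eq (i : I) (t : TensorOff M i) (y : (M i).carrier) :
    joinVec i t y = leftHom ((M i).inner (M i).vac y) (tensor M t.1) +
      tensor M (consTensor i ((M i).toCirc y) t) := by
  rw [leftHom_tensor, joinVec, join, map_add]
  rfl

theorem proj_leftHom_tensor (J : Set (List I)) (b : B) (t : Tensor M) :
    proj J (leftHom b (tensor M t)) = leftHom b (proj J (tensor M t)) :=
  DFunLike.congr_fun (proj_comm_leftHom (M := M) J b) (tensor M t)

/-- If $t$ has word $w$, then $V_i(M_i\otimes t)$ involves only the words $w$ and $iw$. The action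
of $P_J$ on it depends only on which of these two lie in $J$. -/
theorem proj_joinVec_of_mem {J : Set (List I)} {i : I} {t : TensorOff M i}
    (h : word M t.1 ∈ J) (h' : i :: word M t.1 ∈ J) (y : (M i).carrier) :
    proj J (joinVec i t y) = joinVec i t y := by
  rw [joinVec_eq, map_add, proj_leftHom_tensor, proj_tensor_of_mem h, proj_tensor_of_mem h']

theorem proj_joinVec_of_notMem {J : Set (List I)} {i : I} {t : TensorOff M i}
    (h : word M t.1 ∉ J) (h' : i :: word M t.1 ∉ J) (y : (M i).carrier) :
    proj J (joinVec i t y) = 0 := by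
  rw [joinVec_eq, map_add, proj_leftHom_tensor, proj_tensor_of_notMem h,
    proj_tensor_of_notMem h', map_zero, add_zero]

theorem proj_joinVec_of_mem_of_notMem {J : Set (List I)} {i : I} {t : TensorOff M i}
    (h : word M t.1 ∈ J) (h' : i :: word M t.1 ∉ J) (y : (M i).carrier) :
    proj J (joinVec i t y) = leftHom ((M i).inner (M i).vac y) (tensor M t.1) := by
  rw [joinVec_eq, map_add, proj_leftHom_tensor, proj_tensor_of_mem h,
    proj_tensor_of_notMem h', add_zero]

theorem word_split (i : I) (t : Tensor M) :
    word M t = word M (split i t).2.1 ∨ word M t = i :: word M (split i t).2.1 := by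
  obtain ⟨t, h⟩ := t
  cases t with
  | nil => left; rfl
  | cons q t =>
    obtain ⟨j, m⟩ := q
    by_cases e : j = i
    · subst e
      right
      simp [split, word]
    · left
      simp [split, word, e]

theorem inner_mk (v w : Formal M) : inner ((null M).mkQ v) ((null M).mkQ w) = form v w := rfl

theorem inner_smul_right (v w : Space M) (b : B) :
    inner v (MulOpposite.op b • w) = inner v w * b := by
  obtain ⟨v, rfl⟩ := (null M).mkQ_surjective v
  obtain ⟨w, rfl⟩ := (null M).mkQ_surjective w
  rw [← map_smul, inner_mk, inner_mk, form_op_smul_right]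

theorem inner_vac_leftHom (b : B) (v : Space M) :
    inner (vac M) (leftHom b v) = b * inner (vac M) v := by
  obtain ⟨v, rfl⟩ := (null M).mkQ_surjective v
  change form (Finsupp.single (emptyTensor M) 1) (extend (leftTensor b) v) =
    b * form (Finsupp.single (emptyTensor M) 1) v
  rw [form_extend_adjoint _ _ (leftTensor_adjoint b), extend_single, MulOpposite.op_one, one_smul]
  have e : (leftTensor (star b) (emptyTensor M) : Formal M) =
      MulOpposite.op (star b) • Finsupp.single (emptyTensor M) 1 := by
    simp [leftTensor, emptyTensor]
  rw [e, ← star_form, form_op_smul_right, star_mul, star_star, star_form]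

/-- This is the source of the factorization $\varphi(aea')=\varphi(a)\varphi(a')$ required of an
orthogonal model. -/
theorem proj_vac_apply (v : Space M) :
    proj {[]} v = MulOpposite.op (inner (vac M) v) • vac M := by
  obtain ⟨v, rfl⟩ := (null M).mkQ_surjective v
  change _ = MulOpposite.op (form (Finsupp.single (emptyTensor M) 1) v) • vac M
  induction v using Finsupp.induction_linear with
  | zero => simp
  | add v w hv hw => rw [map_add, map_add, hv, hw, form_add_right, MulOpposite.op_add, add_smul]
  | single t c =>
    have e : Finsupp.single t c = MulOpposite.op c • Finsupp.single t (1 : B) := by simp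
    rw [e, map_smul, map_smul, form_op_smul_right, MulOpposite.op_mul, mul_smul]
    congr 1
    change proj {[]} (tensor M t) = _
    obtain ⟨t, h⟩ := t
    cases t with
    | nil =>
      rw [proj_tensor_of_mem (by rfl), form_single]
      simp [emptyTensor, vac, tensor]
    | cons q t =>
      rw [proj_tensor_of_notMem (by simp [word]), form_single]
      simp [emptyTensor]

theorem inner_vac_joinVec (i : I) (y : (M i).carrier) (h) :
    inner (vac M) (joinVec i ⟨emptyTensor M, h⟩ y) = (M i).inner (M i).vac y := by
  change inner (tensor M (emptyTensor M)) _ = _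
  rw [← joinVec_vac i ⟨emptyTensor M, h⟩]
  change form _ _ = _
  rw [form_join]
  simp [emptyTensor]

variable {M : Fin 2 → PointedBimodule B}

/-- $\lambda_1(x_1)\xi$ lies in the summands with words $\emptyset$ and $(1)$, and neither belongs
to $\{(0),(1,0)\}$. -/
theorem orthogonal_mul_vac (x : ∀ i, (M i).adjointable) :
    (proj {[0], [1, 0]} * lambda 1 (x 1) : Module.End Bᵐᵒᵖ (Space M)) * proj {[]} = 0 := by
  refine end_ext fun t => ?_
  change proj _ (lambda 1 (x 1) (proj _ (tensor M t))) = 0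
  obtain ⟨t, ht⟩ := t
  cases t with
  | nil =>
    have hoff : ∀ p ∈ (emptyTensor M).1.head?, 1 ≠ p.1 := by simp [emptyTensor]
    rw [proj_tensor_of_mem (by rfl)]
    change proj _ (lambda 1 (x 1) (tensor M (emptyTensor M))) = 0
    rw [← joinVec_vac 1 ⟨emptyTensor M, hoff⟩, lambda_joinVec,
      proj_joinVec_of_notMem (by simp [emptyTensor, word]) (by simp [emptyTensor, word])]
  | cons q t => rw [proj_tensor_of_notMem (by simp [word]), map_zero, map_zero]

/-- The operators that define the orthogonal convolution are in orthogonal position. -/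
theorem isOrthogonalModel (x : ∀ i, (M i).adjointable) :
    IsOrthogonalModel ((M 0).dist (x 0)) ((M 1).dist (x 1)) leftHom (vacState (M := M))
      ![proj {[], [0]} * lambda 0 (x 0), proj {[0], [1, 0]} * lambda 1 (x 1)]
      (proj {[], [0]}) (proj {[]}) where
  map_left b a := inner_vac_leftHom b _
  map_mul_mul a a' := by
    change inner (vac M) (a (proj {[]} (a' (vac M)))) = _
    rw [proj_vac_apply, map_smul, inner_smul_right]
    rfl
  map_one := by
    change form _ _ = _
    rw [form_single]
    simp [emptyTensor]
  left_mul := by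
    simp only [Matrix.cons_val_zero]
    rw [← mul_assoc, proj_mul_proj, Set.inter_self]
  mul_right := by
    simp only [Matrix.cons_val_zero]
    refine end_ext fun t => ?_
    change proj _ (lambda 0 (x 0) (proj _ (tensor M t))) = proj _ (lambda 0 (x 0) (tensor M t))
    by_cases h : word M t ∈ ({[], [0]} : Set (List (Fin 2)))
    · rw [proj_tensor_of_mem h]
    -- Write $t=V_0(y\otimes t')$; the operator keeps $t'$. The projection could be nonzero only if
    -- $t'$ had word $(0)$ or $\emptyset$. The first is impossible since $t'$ does not start with
    -- $0$. The second would make the word of $t$ equal to $\emptyset$ or $(0)$.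
    · rw [proj_tensor_of_notMem h, map_zero, map_zero, ← joinVec_split 0 t, lambda_joinVec,
        proj_joinVec_of_notMem]
      · intro h1
        have h2 := word_split 0 t
        have h3 := (split 0 t).2.2
        rcases h1 with h1 | h1
        · rw [h1] at h2; rcases h2 with h2 | h2 <;> simp [h2] at h
        · have h1' : word M (split 0 t).2.1 = [0] := h1
          generalize (split 0 t).2.1 = s at h1' h3
          obtain ⟨s, hs⟩ := s
          cases s with
          | nil => simp [word] at h1'
          | cons q s =>
            have h4 := h3 q (by simp)
            simp only [word, List.map_cons, List.cons.injEq] at h1'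
            exact h4 h1'.1.symm
      · intro h1
        have h2 := word_split 0 t
        have h1' : word M (split 0 t).2.1 = [] := by simpa using h1
        rw [h1'] at h2
        rcases h2 with h2 | h2 <;> simp [h2] at h
  comm := proj_comm_leftHom _
  comm_vac := proj_comm_leftHom _
  vac_mul := by
    simp only [Matrix.cons_val_one, Matrix.cons_val_zero]
    rw [← mul_assoc, proj_mul_proj]
    have : ({[]} ∩ {[0], [1, 0]} : Set (List (Fin 2))) = ∅ := by
      ext l
      simp only [Set.mem_inter_iff, Set.mem_singleton_iff, Set.mem_insert_iff]
      constructor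
      · rintro ⟨rfl, h⟩; simp at h
      · simp
    rw [this, proj_empty, zero_mul]
  mul_vac := orthogonal_mul_vac x
  compress r hr := by
    have h0 := evalPoly_mul_eq_zero (orthogonal_mul_vac x) (proj_comm_leftHom _) hr
    simp only [Matrix.cons_val_one, Matrix.cons_val_zero]
    refine end_ext fun t => ?_
    set Y := proj {[0], [1, 0]} * lambda 1 (x 1) with hY
    change proj _ (evalPoly leftHom Y r (proj _ (tensor M t))) =
      leftHom _ (proj _ (tensor M t) - proj _ (tensor M t))
    by_cases h1 : word M t = []
    · have h2 : evalPoly leftHom Y r (proj {[]} (tensor M t)) = 0 := DFunLike.congr_fun h0 _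
      rw [proj_tensor_of_mem (by simp [h1])] at h2
      rw [proj_tensor_of_mem (by simp [h1]), proj_tensor_of_mem (by simp [h1]), h2, sub_self,
        map_zero, map_zero]
    · rw [proj_tensor_of_notMem (J := {[]}) (by simpa using h1), sub_zero]
      by_cases h2 : word M t = [0]
      · rw [proj_tensor_of_mem (by simp [h2])]
        have hoff : ∀ p ∈ t.1.head?, 1 ≠ p.1 := by
          intro p hp
          have h3 : p.1 ∈ (word M t).head? := by
            rw [word, List.head?_map]
            exact Option.mem_map_of_mem _ hp
          rw [h2] at h3
          have h4 : (0 : Fin 2) = p.1 := by simpa using h3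
          simp [← h4]
        -- For $t$ of word $(0)$ the space $V_1(M_1\otimes t)$ has words $(0)$ and $(1,0)$, so it is
        -- invariant under the second operator, which acts there as $x_1\otimes1$. Thus $r$ sends
        -- $t$ to $V_1(r(x_1)\xi_1\otimes t)$, whose component of word $(0)$ is $\nu(r)t$.
        have h5 := evalPoly_intertwine (Algebra.lsmul ℂ ℂ (M 1).carrier)
          (leftHom (M := M)) (joinVec 1 ⟨t, hoff⟩) (joinVec_add 1 ⟨t, hoff⟩) (a := (x 1).1)
          (a' := Y) (fun b v => (leftHom_joinVec 1 b ⟨t, hoff⟩ v).symm)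
          (fun v => by
            change _ = proj _ (lambda 1 (x 1) (joinVec 1 ⟨t, hoff⟩ v))
            rw [lambda_joinVec, proj_joinVec_of_mem (by simp [h2]) (by simp [h2])]
            rfl) r (M 1).vac
        rw [joinVec_vac] at h5
        have h6 : evalPoly leftHom Y r (tensor M t) = _ := h5.symm
        rw [h6, proj_joinVec_of_mem_of_notMem (by simp [h2]) (by simp [h2])]
        rfl
      · rw [proj_tensor_of_notMem (by simp [h1, h2]), map_zero, map_zero, map_zero]
  dist q _ := by
    have hoff : ∀ p ∈ (emptyTensor M).1.head?, 0 ≠ p.1 := by simp [emptyTensor]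
    -- $V_0(M_0\otimes\xi)$ has words $\emptyset$ and $(0)$, so the first operator acts on it as
    -- $x_0\otimes1$.
    have h5 := evalPoly_intertwine (Algebra.lsmul ℂ ℂ (M 0).carrier)
      (leftHom (M := M)) (joinVec 0 ⟨emptyTensor M, hoff⟩) (joinVec_add 0 _) (a := (x 0).1)
      (a' := proj {[], [0]} * lambda 0 (x 0)) (fun b v => (leftHom_joinVec 0 b _ v).symm)
      (fun v => by
        change _ = proj _ (lambda 0 (x 0) (joinVec 0 ⟨emptyTensor M, hoff⟩ v))
        rw [lambda_joinVec, proj_joinVec_of_mem (by simp [emptyTensor, word])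
          (by simp [emptyTensor, word])]
        rfl) q (M 0).vac
    rw [joinVec_vac] at h5
    change inner (vac M) (evalPoly leftHom (proj {[], [0]} * lambda 0 (x 0)) q (vac M)) = _
    have h6 : evalPoly leftHom (proj {[], [0]} * lambda 0 (x 0)) q (vac M) = _ := h5.symm
    rw [h6, inner_vac_joinVec]
    rfl

end FreeProd

end OpValued

namespace OpValued

/-! ### A joint model for the monotone, Boolean and orthogonal convolutions -/

section Model

set_option linter.unusedSectionVars false

variable {B : Type u} [CStarAlgebra B] [PartialOrder B] [StarOrderedRing B]

namespace ProbSpace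

/-- Positivity at $1+a$ and at $a$ shows that $\mathbb E[a]+\mathbb E[a^*]$ is selfadjoint. The same
statement for $ia$ separates the two terms. -/
theorem expect_star (S : ProbSpace B) (a : S.A) : S.expect (star a) = star (S.expect a) := by
  have h : ∀ a : S.A, S.expect a + S.expect (star a) =
      star (S.expect a) + star (S.expect (star a)) := fun a => by
    have h1 := (IsSelfAdjoint.of_nonneg (S.expect_nonneg (1 + a))).star_eq
    have h2 := (IsSelfAdjoint.of_nonneg (S.expect_nonneg a)).star_eq
    have e : (1 + a) * star (1 + a) = 1 + (a + star a) + a * star a := by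
      rw [star_add, star_one]; noncomm_ring
    rw [e, map_add, map_add, map_add, expect_one, star_add, star_add, star_add, star_one, h2] at h1
    exact (add_left_cancel (add_right_cancel h1)).symm
  have h1 := h a
  have h2 := h (Complex.I • a)
  have hI : star Complex.I = -Complex.I := by simp
  rw [star_smul, map_smul, map_smul, star_smul, star_smul, hI, star_neg, hI, neg_neg,
    neg_smul] at h2
  have h3 : S.expect a - S.expect (star a) = -star (S.expect a) + star (S.expect (star a)) := by
    have := congrArg (fun b => (-Complex.I) • b) h2
    simp only [smul_add, smul_neg, smul_smul, neg_mul, Complex.I_mul_I, neg_neg, one_smul,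
      neg_smul] at this
    rw [sub_eq_add_neg]
    exact this
  have h4 : (2 : ℂ) • S.expect (star a) = (2 : ℂ) • star (S.expect a) := by
    rw [two_smul, two_smul]
    have : S.expect (star a) + S.expect (star a) = (S.expect a + S.expect (star a)) -
      (S.expect a - S.expect (star a)) := by abel
    rw [this, h1, h3]
    abel
  have h5 := congrArg (fun b => (2 : ℂ)⁻¹ • b) h4
  simpa [smul_smul] using h5

theorem expect_star_mul_self_nonneg (S : ProbSpace B) (a : S.A) :
    0 ≤ S.expect (star a * a) := by
  simpa using S.expect_nonneg (star a)

/-- Complete positivity of $\mathbb E$: the quadratic form of the matrix $(\mathbb E[a_i^*a_j])$ at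
$v$ is $\mathbb E[c^*c]$ with $c=\sum_ja_jv_j^*$. The matrix is therefore positive and equals
$C^*C$. -/
theorem exists_gram (S : ProbSpace B) {n : Type*} [Fintype n] [DecidableEq n] (a : n → S.A) :
    ∃ C : n → n → B, ∀ i j, S.expect (star (a i) * a j) = ∑ k, star (C k i) * C k j := by
  let G : CStarMatrix n n B := CStarMatrix.ofMatrix fun i j => S.expect (star (a i) * a j)
  have hG : ∀ i j, G i j = S.expect (star (a i) * a j) := fun i j => rfl
  have h0 : 0 ≤ G := by
    refine cstarMatrix_nonneg ?_ fun v => ?_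
    · ext i j
      rw [CStarMatrix.star_apply, hG, hG, ← S.expect_star, star_mul, star_star]
    · have h1 := S.expect_star_mul_self_nonneg (∑ i, a i * S.incl (star (v i)))
      refine h1.trans_eq ?_
      rw [star_sum, Finset.sum_mul_sum, map_sum]
      refine Finset.sum_congr rfl fun i _ => ?_
      rw [map_sum]
      refine Finset.sum_congr rfl fun j _ => ?_
      rw [star_mul, ← map_star, star_star, hG, ← S.expect_bimodule]
      simp only [mul_assoc]
  obtain ⟨C, hC⟩ := exists_eq_star_mul_self h0
  refine ⟨fun k i => C k i, fun i j => ?_⟩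
  rw [← hG, hC, CStarMatrix.mul_apply]
  simp only [CStarMatrix.star_apply]

end ProbSpace

namespace PreBimodule

variable (N : PreBimodule B)

/-- The completion is separated, so it also divides out null vectors. -/
theorem coe_eq_coe {v w : N.V} (h : ∀ u, N.form u v = N.form u w) :
    (v : UniformSpace.Completion N.V) = w := by
  rw [← sub_eq_zero, ← UniformSpace.Completion.coe_sub, ← norm_eq_zero,
    UniformSpace.Completion.norm_coe, N.norm_def, map_sub, h, sub_self, norm_zero, Real.sqrt_zero]

/-- The vectors of the original bimodule in the completion. -/
noncomputable def toCompletion (v : N.V) : N.completion.carrier :=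
  (v : UniformSpace.Completion N.V)

theorem operators_ext {S T : N.completion.operators}
    (h : ∀ v, S.1 (N.toCompletion v) = T.1 (N.toCompletion v)) : S = T :=
  Subtype.ext (N.clm_ext h)

theorem inner_toCompletion (v w : N.V) :
    N.completion.inner (N.toCompletion v) (N.toCompletion w) = N.form v w :=
  N.completionForm_coe v w

theorem toCompletion_eq {v w : N.V} (h : ∀ u, N.form u v = N.form u w) :
    N.toCompletion v = N.toCompletion w := N.coe_eq_coe h

/-- The extension of a `⋆`-representation to the completion. -/
noncomputable def rep {D : Type*} [CStarAlgebra D] (π : D →ₗ[ℂ] Module.End ℂ N.V)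
    (hm : ∀ d d', π (d * d') = π d * π d')
    (hs : ∀ d v w, N.form (π d v) w = N.form v (π (star d) w)) :
    D →⋆ₙₐ[ℂ] N.completion.operators where
  toFun d := ⟨N.extendBounded ⟨π d, N.mem_bounded_of_rep π hm hs d⟩,
    N.extendBounded ⟨π (star d), N.mem_bounded_of_rep π hm hs _⟩,
    N.completionForm_extendBounded (hs d)⟩
  map_smul' z d := by
    refine N.operators_ext fun v => ?_
    refine (N.extendBounded_coe _ v).trans ?_
    refine Eq.trans ?_ (congrArg (z • ·) (N.extendBounded_coe _ v).symm)
    change ((π (z • d) v : N.V) : UniformSpace.Completion N.V) = _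
    rw [map_smul, LinearMap.smul_apply]
    exact UniformSpace.Completion.coe_smul z _
  map_zero' := by
    refine N.operators_ext fun v => ?_
    refine (N.extendBounded_coe _ v).trans ?_
    change ((π 0 v : N.V) : UniformSpace.Completion N.V) = _
    rw [map_zero, LinearMap.zero_apply]
    exact UniformSpace.Completion.coe_zero
  map_add' d d' := by
    refine N.operators_ext fun v => ?_
    refine (N.extendBounded_coe _ v).trans ?_
    refine Eq.trans ?_ (congrArg₂ (· + ·) (N.extendBounded_coe _ v).symm
      (N.extendBounded_coe _ v).symm)
    change ((π (d + d') v : N.V) : UniformSpace.Completion N.V) = _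
    rw [map_add, LinearMap.add_apply]
    exact UniformSpace.Completion.coe_add _ _
  map_mul' d d' := by
    refine N.operators_ext fun v => ?_
    change N.extendBounded _ (v : UniformSpace.Completion N.V) =
      N.extendBounded _ (N.extendBounded _ (v : UniformSpace.Completion N.V))
    rw [extendBounded_coe, extendBounded_coe, extendBounded_coe]
    exact congrArg (fun T : Module.End ℂ N.V => ((T v : N.V) : UniformSpace.Completion N.V))
      (hm d d')
  map_star' d := by
    rw [PointedBimodule.eq_star_iff]
    exact N.completionForm_extendBounded (hs d)

theorem rep_apply {D : Type*} [CStarAlgebra D] (π : D →ₗ[ℂ] Module.End ℂ N.V)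
    (hm : ∀ d d', π (d * d') = π d * π d')
    (hs : ∀ d v w, N.form (π d v) w = N.form v (π (star d) w)) (d : D) (v : N.V) :
    (N.rep π hm hs d).1 (N.toCompletion v) = N.toCompletion (π d v) :=
  N.extendBounded_coe _ v

/-- The extensions of the scalar multiples of a projection to the completion. -/
noncomputable def repProj (p : Module.End ℂ N.V) (hp : p * p = p)
    (hs : ∀ v w, N.form (p v) w = N.form v (p w)) : ℂ →⋆ₙₐ[ℂ] N.completion.operators :=
  N.rep (LinearMap.toSpanSingleton ℂ _ p)
    (fun z w => by simp [hp, mul_smul, smul_comm z w])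
    (fun z v w => by simp [hs])

theorem repProj_apply (p : Module.End ℂ N.V) (hp : p * p = p)
    (hs : ∀ v w, N.form (p v) w = N.form v (p w)) (v : N.V) :
    (N.repProj p hp hs 1).1 (N.toCompletion v) = N.toCompletion (p v) :=
  (N.rep_apply _ _ _ _ _).trans (by simp)

theorem leftOperator_toCompletion (b : B) (v : N.V) :
    (N.completion.leftOperator b).1 (N.toCompletion v) = N.toCompletion (N.left b v) :=
  N.leftHom_coe b v

end PreBimodule

/-- The `C⋆`-operator probability spaces `S₁`, `S₂` act on a common space: `Y` on
`M₂ ⊗ M₁` through the first factor, `X` on the subspace `ξ₂ ⊗ M₁`, and `Q` is the projection onto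
`M₂ ⊗ ξ₁`. -/
structure JointModel (S₁ S₂ : ProbSpace B) where
  S : ProbSpace B
  X : S₁.A →⋆ₙₐ[ℂ] S.A
  Y : S₂.A →⋆ₐ[ℂ] S.A
  Q : S.A
  Y_incl : ∀ b, Y (S₂.incl b) = S.incl b
  X_incl : ∀ b, X (S₁.incl b) = S.incl b * X 1
  compress : ∀ a, X 1 * Y a * X 1 = X (S₁.incl (S₂.expect a))
  star_Q : star Q = Q
  Q_mul_Q : Q * Q = Q
  Q_comm : ∀ a, Q * Y a = Y a * Q
  Q_comm_one : Q * X 1 = X 1 * Q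
  expect_mul : ∀ a a', S.expect (a * (X 1 * Q) * a') = S.expect a * S.expect a'
  expect_Y : ∀ a, S.expect (Y a) = S₂.expect a
  expect_X : ∀ a, S.expect (X a) = S₁.expect a

/-! ### The joint model on the completed tensor product -/

namespace TensorModel

open scoped TensorProduct

variable (S₁ S₂ : ProbSpace B)

/-- `⟨a ⊗ c, a' ⊗ c'⟩ = E₁(c⋆ E₂(a⋆ a') c')` as a linear functional of the second argument. -/
noncomputable def formRight (a : S₂.A) (c : S₁.A) : S₂.A ⊗[ℂ] S₁.A →ₗ[ℂ] B :=
  TensorProduct.lift (LinearMap.mk₂ ℂ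
    (fun a' c' => S₁.expect (star c * S₁.incl (S₂.expect (star a * a')) * c'))
    (by intros; simp only [mul_add, add_mul, map_add])
    (by intros; simp only [mul_smul_comm, smul_mul_assoc, map_smul])
    (by intros; simp only [mul_add, map_add])
    (by intros; simp only [mul_smul_comm, map_smul]))

theorem formRight_tmul (a a' : S₂.A) (c c' : S₁.A) :
    formRight S₁ S₂ a c (a' ⊗ₜ c') =
      S₁.expect (star c * S₁.incl (S₂.expect (star a * a')) * c') := rfl

/-- The sesquilinear form on `A₂ ⊗ A₁`. -/
noncomputable def form : S₂.A ⊗[ℂ] S₁.A →ₗ⋆[ℂ] S₂.A ⊗[ℂ] S₁.A →ₗ[ℂ] B :=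
  TensorProduct.lift (LinearMap.mk₂'ₛₗ (starRingEnd ℂ) (starRingEnd ℂ)
    (fun a c => formRight S₁ S₂ a c)
    (by
      intros; ext
      simp only [TensorProduct.AlgebraTensorModule.curry_apply, LinearMap.restrictScalars_self,
        TensorProduct.curry_apply, LinearMap.add_apply, formRight_tmul, star_add, mul_add, add_mul,
        map_add])
    (by
      intros; ext
      simp only [TensorProduct.AlgebraTensorModule.curry_apply, LinearMap.restrictScalars_self,
        TensorProduct.curry_apply, LinearMap.smul_apply, formRight_tmul, star_smul, mul_smul_comm,
        smul_mul_assoc, map_smul, starRingEnd_apply])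
    (by
      intros; ext
      simp only [TensorProduct.AlgebraTensorModule.curry_apply, LinearMap.restrictScalars_self,
        TensorProduct.curry_apply, LinearMap.add_apply, formRight_tmul, star_add, add_mul,
        map_add])
    (by
      intros; ext
      simp only [TensorProduct.AlgebraTensorModule.curry_apply, LinearMap.restrictScalars_self,
        TensorProduct.curry_apply, LinearMap.smul_apply, formRight_tmul, star_smul,
        smul_mul_assoc, map_smul, starRingEnd_apply]))

theorem form_tmul (a a' : S₂.A) (c c' : S₁.A) :
    form S₁ S₂ (a ⊗ₜ c) (a' ⊗ₜ c') =
      S₁.expect (star c * S₁.incl (S₂.expect (star a * a')) * c') := rfl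

theorem star_form (v w : S₂.A ⊗[ℂ] S₁.A) : star (form S₁ S₂ w v) = form S₁ S₂ v w := by
  induction v using TensorProduct.induction_on with
  | zero => simp
  | add v v' h h' => rw [map_add, star_add, h, h', map_add, LinearMap.add_apply]
  | tmul a c =>
    induction w using TensorProduct.induction_on with
    | zero => simp
    | add w w' h h' => rw [map_add, map_add, LinearMap.add_apply, star_add, h, h']
    | tmul a' c' =>
      rw [form_tmul, form_tmul, ← S₁.expect_star, star_mul, star_mul, star_star, ← map_star,
        ← S₂.expect_star, star_mul, star_star, mul_assoc]

/-- With $\mathbb E_2[a_i^*a_j]=\sum_kC_{ki}^*C_{kj}$, the form at $\sum_ia_i\otimes c_i$ is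
$\sum_k\mathbb E_1[d_k^*d_k]$, where $d_k=\sum_jC_{kj}c_j$. -/
theorem form_nonneg (v : S₂.A ⊗[ℂ] S₁.A) : 0 ≤ form S₁ S₂ v v := by
  classical
  obtain ⟨s, rfl⟩ := TensorProduct.exists_finset v
  obtain ⟨C, hC⟩ := S₂.exists_gram fun i : s => i.1.1
  rw [← Finset.sum_coe_sort]
  have e : form S₁ S₂ (∑ i : s, i.1.1 ⊗ₜ i.1.2) (∑ i : s, i.1.1 ⊗ₜ i.1.2) =
      ∑ k : s, S₁.expect (star (∑ i : s, S₁.incl (C k i) * i.1.2) *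
        ∑ j : s, S₁.incl (C k j) * j.1.2) := by
    simp only [map_sum, LinearMap.sum_apply, form_tmul, hC, star_sum, Finset.mul_sum,
      Finset.sum_mul, map_mul, star_mul, map_star]
    rw [Finset.sum_comm_cycle]
    simp only [mul_assoc]
  rw [e]
  exact Finset.sum_nonneg fun k _ => S₁.expect_star_mul_self_nonneg _

/-- `a ↦ a ⊗ 1` acting by left multiplication. -/
noncomputable def leftMul : S₂.A →ₐ[ℂ] Module.End ℂ (S₂.A ⊗[ℂ] S₁.A) :=
  (Algebra.lmul ℂ (S₂.A ⊗[ℂ] S₁.A)).comp Algebra.TensorProduct.includeLeft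

theorem leftMul_tmul (a a' : S₂.A) (c : S₁.A) :
    leftMul S₁ S₂ a (a' ⊗ₜ c) = (a * a') ⊗ₜ c := by
  simp [leftMul]

/-- `b ↦ 1 ⊗ b` acting by right multiplication. -/
noncomputable def rightMul : Bᵐᵒᵖ →ₐ[ℂ] Module.End ℂ (S₂.A ⊗[ℂ] S₁.A) :=
  (Algebra.lsmul ℂ ℂ (S₂.A ⊗[ℂ] S₁.A)).comp
    (AlgHom.op ((Algebra.TensorProduct.includeRight : S₁.A →ₐ[ℂ] S₂.A ⊗[ℂ] S₁.A).comp
      S₁.incl.toAlgHom))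

theorem rightMul_tmul (b : B) (a : S₂.A) (c : S₁.A) :
    rightMul S₁ S₂ (MulOpposite.op b) (a ⊗ₜ c) = a ⊗ₜ (c * S₁.incl b) := by
  simp [rightMul]

theorem form_leftMul (a : S₂.A) (v w : S₂.A ⊗[ℂ] S₁.A) :
    form S₁ S₂ (leftMul S₁ S₂ a v) w = form S₁ S₂ v (leftMul S₁ S₂ (star a) w) := by
  induction v using TensorProduct.induction_on with
  | zero => simp
  | add v v' h h' => simp only [map_add, LinearMap.add_apply, h, h']
  | tmul a' c' =>
    induction w using TensorProduct.induction_on with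
    | zero => simp
    | add w w' h h' => simp only [map_add, h, h']
    | tmul a'' c'' => simp only [leftMul_tmul, form_tmul, star_mul, mul_assoc]

/-- The semi-inner product bimodule `A₂ ⊗ A₁`. -/
noncomputable def preBimodule : PreBimodule B where
  V := S₂.A ⊗[ℂ] S₁.A
  form := form S₁ S₂
  star_form := star_form S₁ S₂
  form_nonneg := form_nonneg S₁ S₂
  left := (leftMul S₁ S₂).comp S₂.incl.toAlgHom
  right := rightMul S₁ S₂
  left_right b c v := by
    induction v using TensorProduct.induction_on with
    | zero => simp
    | add v v' h h' => simp only [map_add, h, h']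
    | tmul a c' =>
      obtain ⟨c, rfl⟩ := MulOpposite.op_surjective c
      simp [leftMul_tmul, rightMul_tmul]
  form_right v w b := by
    induction v using TensorProduct.induction_on with
    | zero => simp
    | add v v' h h' => simp only [map_add, LinearMap.add_apply, h, h', add_mul]
    | tmul a c =>
      induction w using TensorProduct.induction_on with
      | zero => simp
      | add w w' h h' => simp only [map_add, h, h', add_mul]
      | tmul a' c' => rw [rightMul_tmul, form_tmul, form_tmul, ← mul_assoc, S₁.expect_mul_incl]
  form_left v w b := by
    have := form_leftMul S₁ S₂ (S₂.incl b) v w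
    rwa [← map_star] at this
  vac := 1 ⊗ₜ 1
  form_vac b := by
    change form S₁ S₂ (1 ⊗ₜ 1) (leftMul S₁ S₂ (S₂.incl b) (1 ⊗ₜ 1)) = b
    rw [leftMul_tmul, form_tmul]
    simp [S₁.expect_incl, S₂.expect_incl]

/-- `c₀` acts by `a ⊗ c ↦ 1 ⊗ c₀ E₂(a) c`. -/
noncomputable def lowerMul : S₁.A →ₗ[ℂ] Module.End ℂ (S₂.A ⊗[ℂ] S₁.A) where
  toFun c₀ := TensorProduct.lift (LinearMap.mk₂ ℂ
    (fun a c => (1 : S₂.A) ⊗ₜ[ℂ] (c₀ * S₁.incl (S₂.expect a) * c))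
    (by intros; simp only [mul_add, add_mul, map_add, TensorProduct.tmul_add])
    (by intros; simp only [mul_smul_comm, smul_mul_assoc, map_smul, TensorProduct.tmul_smul])
    (by intros; simp only [mul_add, TensorProduct.tmul_add])
    (by intros; simp only [mul_smul_comm, TensorProduct.tmul_smul]))
  map_add' c c' := by
    ext a d
    simp [add_mul, TensorProduct.tmul_add]
  map_smul' z c := by
    ext a d
    simp

theorem lowerMul_tmul (c₀ : S₁.A) (a : S₂.A) (c : S₁.A) :
    lowerMul S₁ S₂ c₀ (a ⊗ₜ c) = 1 ⊗ₜ (c₀ * S₁.incl (S₂.expect a) * c) := rfl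

theorem lowerMul_mul (c d : S₁.A) :
    lowerMul S₁ S₂ (c * d) = lowerMul S₁ S₂ c * lowerMul S₁ S₂ d := by
  ext a c'
  simp [lowerMul_tmul, S₂.expect_one, mul_assoc]

theorem form_lowerMul (c : S₁.A) (v w : S₂.A ⊗[ℂ] S₁.A) :
    form S₁ S₂ (lowerMul S₁ S₂ c v) w = form S₁ S₂ v (lowerMul S₁ S₂ (star c) w) := by
  induction v using TensorProduct.induction_on with
  | zero => simp
  | add v v' h h' => simp only [map_add, LinearMap.add_apply, h, h']
  | tmul a' c' =>
    induction w using TensorProduct.induction_on with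
    | zero => simp
    | add w w' h h' => simp only [map_add, h, h']
    | tmul a'' c'' =>
      simp only [lowerMul_tmul, form_tmul, star_mul, star_one, one_mul, mul_one, ← map_star,
        ← S₂.expect_star, mul_assoc]

/-- The map `a ⊗ c ↦ a ⊗ E₁(c)`. -/
noncomputable def vacRight : Module.End ℂ (S₂.A ⊗[ℂ] S₁.A) :=
  TensorProduct.map LinearMap.id (S₁.incl.toAlgHom.toLinearMap ∘ₗ S₁.expect)

theorem vacRight_tmul (a : S₂.A) (c : S₁.A) :
    vacRight S₁ S₂ (a ⊗ₜ c) = a ⊗ₜ S₁.incl (S₁.expect c) := rfl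

theorem vacRight_mul_vacRight : vacRight S₁ S₂ * vacRight S₁ S₂ = vacRight S₁ S₂ := by
  ext a c
  simp [vacRight_tmul, S₁.expect_incl]

theorem form_vacRight (v w : S₂.A ⊗[ℂ] S₁.A) :
    form S₁ S₂ (vacRight S₁ S₂ v) w = form S₁ S₂ v (vacRight S₁ S₂ w) := by
  induction v using TensorProduct.induction_on with
  | zero => simp
  | add v v' h h' => simp only [map_add, LinearMap.add_apply, h, h']
  | tmul a' c' =>
    induction w using TensorProduct.induction_on with
    | zero => simp
    | add w w' h h' => simp only [map_add, h, h']
    | tmul a'' c'' =>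
      rw [vacRight_tmul, form_tmul, vacRight_tmul, form_tmul, ← map_star, mul_assoc,
        S₁.expect_incl_mul, S₁.expect_incl_mul, S₁.expect_mul_incl, S₁.expect_mul_incl,
        ← S₁.expect_star, mul_assoc]

/-- The tensor product is taken over $\mathbb C$; the relation $b\otimes c=1\otimes bc$ holds only
modulo null vectors and is therefore stated through the form. -/
theorem form_leftMul_lowerMul (b : B) (u v : S₂.A ⊗[ℂ] S₁.A) :
    form S₁ S₂ u (leftMul S₁ S₂ (S₂.incl b) (lowerMul S₁ S₂ 1 v)) =
      form S₁ S₂ u (lowerMul S₁ S₂ (S₁.incl b) v) := by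
  induction v using TensorProduct.induction_on with
  | zero => simp
  | add v v' h h' => simp only [map_add, h, h']
  | tmul a c =>
    induction u using TensorProduct.induction_on with
    | zero => simp
    | add w w' h h' => simp only [map_add, LinearMap.add_apply, h, h']
    | tmul a' c' =>
      simp only [lowerMul_tmul, leftMul_tmul, form_tmul, mul_one, one_mul, S₂.expect_mul_incl,
        map_mul, mul_assoc]

/-- The composite is $a\otimes c\mapsto1\otimes\mathbb E_2[a]\,\mathbb E_1[c]$, so modulo null
vectors it is the projection $v\mapsto\xi\langle\xi,v\rangle$. -/
theorem form_vac (u v : S₂.A ⊗[ℂ] S₁.A) :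
    form S₁ S₂ u (lowerMul S₁ S₂ 1 (vacRight S₁ S₂ v)) =
      form S₁ S₂ u (1 ⊗ₜ 1) * form S₁ S₂ (1 ⊗ₜ 1) v := by
  induction v using TensorProduct.induction_on with
  | zero => simp
  | add v v' h h' => simp only [map_add, h, h', mul_add]
  | tmul a c =>
    induction u using TensorProduct.induction_on with
    | zero => simp
    | add w w' h h' => simp only [map_add, LinearMap.add_apply, h, h', add_mul]
    | tmul a' c' =>
      simp only [lowerMul_tmul, vacRight_tmul, form_tmul, mul_one, one_mul, star_one,
        S₁.expect_incl_mul, ← S₁.expect_mul_incl, map_mul, mul_assoc]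

theorem operators_ext {T T' : (preBimodule S₁ S₂).completion.operators}
    (h : ∀ a c, T.1 ((preBimodule S₁ S₂).toCompletion (a ⊗ₜ[ℂ] c)) =
      T'.1 ((preBimodule S₁ S₂).toCompletion (a ⊗ₜ[ℂ] c))) : T = T' := by
  refine (preBimodule S₁ S₂).operators_ext fun v => ?_
  change S₂.A ⊗[ℂ] S₁.A at v
  induction v using TensorProduct.induction_on with
  | zero =>
    have : (preBimodule S₁ S₂).toCompletion (0 : S₂.A ⊗[ℂ] S₁.A) = 0 :=
      UniformSpace.Completion.coe_zero
    rw [this, map_zero, map_zero]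
  | add v w hv hw =>
    have : (preBimodule S₁ S₂).toCompletion (v + w) =
        (preBimodule S₁ S₂).toCompletion v + (preBimodule S₁ S₂).toCompletion w :=
      UniformSpace.Completion.coe_add _ _
    rw [this, map_add, map_add, hv, hw]
  | tmul a c => exact h a c

/-- The action of `A₁` on the completion. -/
noncomputable def repX : S₁.A →⋆ₙₐ[ℂ] (preBimodule S₁ S₂).completion.operators :=
  (preBimodule S₁ S₂).rep (lowerMul S₁ S₂) (lowerMul_mul S₁ S₂) (form_lowerMul S₁ S₂)

theorem repX_apply (c : S₁.A) (v : S₂.A ⊗[ℂ] S₁.A) :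
    (repX S₁ S₂ c).1 ((preBimodule S₁ S₂).toCompletion v) =
      (preBimodule S₁ S₂).toCompletion (lowerMul S₁ S₂ c v) :=
  (preBimodule S₁ S₂).rep_apply _ _ _ _ _

/-- The action of `A₂` on the completion, as a non-unital homomorphism. -/
noncomputable def repY₀ : S₂.A →⋆ₙₐ[ℂ] (preBimodule S₁ S₂).completion.operators :=
  (preBimodule S₁ S₂).rep (leftMul S₁ S₂).toLinearMap (map_mul (leftMul S₁ S₂))
    (form_leftMul S₁ S₂)

theorem repY₀_apply (a : S₂.A) (v : S₂.A ⊗[ℂ] S₁.A) :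
    (repY₀ S₁ S₂ a).1 ((preBimodule S₁ S₂).toCompletion v) =
      (preBimodule S₁ S₂).toCompletion (leftMul S₁ S₂ a v) :=
  (preBimodule S₁ S₂).rep_apply _ _ _ _ _

/-- The action of `A₂` on the completion. -/
noncomputable def repY : S₂.A →⋆ₐ[ℂ] (preBimodule S₁ S₂).completion.operators where
  toFun := repY₀ S₁ S₂
  map_one' := operators_ext S₁ S₂ fun a c => by
    rw [repY₀_apply, map_one]; rfl
  map_mul' := map_mul _
  map_zero' := map_zero _
  map_add' := map_add _
  commutes' z := by
    rw [Algebra.algebraMap_eq_smul_one, map_smul, Algebra.algebraMap_eq_smul_one]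
    congr 1
    exact operators_ext S₁ S₂ fun a c => by rw [repY₀_apply, map_one]; rfl
  map_star' := map_star _

theorem repY_apply (a : S₂.A) (v : S₂.A ⊗[ℂ] S₁.A) :
    (repY S₁ S₂ a).1 ((preBimodule S₁ S₂).toCompletion v) =
      (preBimodule S₁ S₂).toCompletion (leftMul S₁ S₂ a v) :=
  repY₀_apply S₁ S₂ a v

/-- The projection onto the closure of `A₂ ⊗ B`. -/
noncomputable def repQ : (preBimodule S₁ S₂).completion.operators :=
  (preBimodule S₁ S₂).repProj (vacRight S₁ S₂) (vacRight_mul_vacRight S₁ S₂)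
    (form_vacRight S₁ S₂) 1

theorem repQ_apply (v : S₂.A ⊗[ℂ] S₁.A) :
    (repQ S₁ S₂).1 ((preBimodule S₁ S₂).toCompletion v) =
      (preBimodule S₁ S₂).toCompletion (vacRight S₁ S₂ v) :=
  (preBimodule S₁ S₂).repProj_apply _ _ _ _

theorem inner_vacProj (u w : (preBimodule S₁ S₂).completion.carrier) :
    (preBimodule S₁ S₂).completion.inner u ((repX S₁ S₂ 1 * repQ S₁ S₂).1 w) =
      (preBimodule S₁ S₂).completion.inner u (preBimodule S₁ S₂).completion.vac *
        (preBimodule S₁ S₂).completion.inner (preBimodule S₁ S₂).completion.vac w := by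
  change (preBimodule S₁ S₂).completionForm u _ = (preBimodule S₁ S₂).completionForm u _ *
    (preBimodule S₁ S₂).completionForm _ w
  refine UniformSpace.Completion.induction_on₂ u w ?_ fun u w => ?_
  · refine isClosed_eq ?_ ?_
    · exact (preBimodule S₁ S₂).continuous_completionForm_comp continuous_fst
        ((repX S₁ S₂ 1 * repQ S₁ S₂).1.continuous.comp continuous_snd)
    · exact ((preBimodule S₁ S₂).continuous_completionForm_comp continuous_fst
        continuous_const).mul
        ((preBimodule S₁ S₂).continuous_completionForm_comp continuous_const continuous_snd)
  · have h : (repX S₁ S₂ 1 * repQ S₁ S₂).1 ((preBimodule S₁ S₂).toCompletion w) =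
        (preBimodule S₁ S₂).toCompletion (lowerMul S₁ S₂ 1 (vacRight S₁ S₂ w)) := by
      rw [← repX_apply]
      exact congrArg _ (repQ_apply S₁ S₂ w)
    refine (congrArg _ h).trans ?_
    refine ((preBimodule S₁ S₂).inner_toCompletion _ _).trans ?_
    refine (form_vac S₁ S₂ u w).trans ?_
    exact (congrArg₂ (· * ·) ((preBimodule S₁ S₂).inner_toCompletion _ _)
      ((preBimodule S₁ S₂).inner_toCompletion _ _)).symm

theorem repY_incl (b : B) :
    repY S₁ S₂ (S₂.incl b) = (preBimodule S₁ S₂).completion.leftOperator b :=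
  operators_ext S₁ S₂ fun a c => by
    rw [repY_apply]
    exact ((preBimodule S₁ S₂).leftOperator_toCompletion b _).symm

theorem repX_incl (b : B) :
    repX S₁ S₂ (S₁.incl b) =
      (preBimodule S₁ S₂).completion.leftOperator b * repX S₁ S₂ 1 :=
  operators_ext S₁ S₂ fun a c => by
    rw [repX_apply]
    refine Eq.trans ?_ (congrArg ((preBimodule S₁ S₂).completion.leftOperator b).1
      (repX_apply S₁ S₂ 1 _).symm)
    refine Eq.trans ?_ ((preBimodule S₁ S₂).leftOperator_toCompletion b _).symm
    exact (preBimodule S₁ S₂).toCompletion_eq fun u => (form_leftMul_lowerMul S₁ S₂ b u _).symm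

theorem repX_one_mul_repY_mul (a : S₂.A) :
    repX S₁ S₂ 1 * repY S₁ S₂ a * repX S₁ S₂ 1 = repX S₁ S₂ (S₁.incl (S₂.expect a)) :=
  operators_ext S₁ S₂ fun a' c => by
    refine (congrArg (fun w => (repX S₁ S₂ 1).1 ((repY S₁ S₂ a).1 w))
      (repX_apply S₁ S₂ 1 _)).trans ?_
    simp only [repY_apply, repX_apply, lowerMul_tmul, leftMul_tmul, mul_one, one_mul, mul_assoc]

theorem star_repQ : star (repQ S₁ S₂) = repQ S₁ S₂ := by
  rw [repQ, ← map_star, star_one]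

theorem repQ_mul_repQ : repQ S₁ S₂ * repQ S₁ S₂ = repQ S₁ S₂ := by
  rw [repQ, ← map_mul, one_mul]

theorem repQ_mul_repY (a : S₂.A) :
    repQ S₁ S₂ * repY S₁ S₂ a = repY S₁ S₂ a * repQ S₁ S₂ :=
  operators_ext S₁ S₂ fun a' c => by
    refine (congrArg (repQ S₁ S₂).1 (repY_apply S₁ S₂ a _)).trans ?_
    refine Eq.trans ?_ (congrArg (repY S₁ S₂ a).1 (repQ_apply S₁ S₂ _)).symm
    rw [repQ_apply, repY_apply, leftMul_tmul, vacRight_tmul, vacRight_tmul, leftMul_tmul]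

theorem repQ_mul_repX_one :
    repQ S₁ S₂ * repX S₁ S₂ 1 = repX S₁ S₂ 1 * repQ S₁ S₂ :=
  operators_ext S₁ S₂ fun a' c => by
    refine (congrArg (repQ S₁ S₂).1 (repX_apply S₁ S₂ 1 _)).trans ?_
    refine Eq.trans ?_ (congrArg (repX S₁ S₂ 1).1 (repQ_apply S₁ S₂ _)).symm
    rw [repQ_apply, repX_apply, lowerMul_tmul, vacRight_tmul, vacRight_tmul, lowerMul_tmul,
      one_mul, S₁.expect_incl_mul, map_mul]

theorem inner_mul_vacProj_mul (a a' : (preBimodule S₁ S₂).completion.operators) :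
    (preBimodule S₁ S₂).completion.inner (preBimodule S₁ S₂).completion.vac
      ((a * (repX S₁ S₂ 1 * repQ S₁ S₂) * a').1 (preBimodule S₁ S₂).completion.vac) =
    (preBimodule S₁ S₂).completion.inner (preBimodule S₁ S₂).completion.vac
      (a.1 (preBimodule S₁ S₂).completion.vac) *
    (preBimodule S₁ S₂).completion.inner (preBimodule S₁ S₂).completion.vac
      (a'.1 (preBimodule S₁ S₂).completion.vac) := by
  have h := inner_vacProj S₁ S₂ ((star a).1 (preBimodule S₁ S₂).completion.vac)
    (a'.1 (preBimodule S₁ S₂).completion.vac)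
  rw [PointedBimodule.inner_star, PointedBimodule.inner_star, star_star] at h
  exact h

/-- The joint model on the completion of `A₂ ⊗ A₁`. -/
noncomputable def jointModel : JointModel S₁ S₂ where
  S := (preBimodule S₁ S₂).completion.probSpace
  X := repX S₁ S₂
  Y := repY S₁ S₂
  Q := repQ S₁ S₂
  Y_incl := repY_incl S₁ S₂
  X_incl := repX_incl S₁ S₂
  compress := repX_one_mul_repY_mul S₁ S₂
  star_Q := star_repQ S₁ S₂
  Q_mul_Q := repQ_mul_repQ S₁ S₂
  Q_comm := repQ_mul_repY S₁ S₂
  Q_comm_one := repQ_mul_repX_one S₁ S₂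
  expect_mul a a' := by
    exact inner_mul_vacProj_mul S₁ S₂ a a'
  expect_Y a := by
    refine (congrArg ((preBimodule S₁ S₂).completion.inner _) (repY_apply S₁ S₂ a _)).trans ?_
    refine ((preBimodule S₁ S₂).inner_toCompletion _ _).trans ?_
    refine (congrArg _ (leftMul_tmul S₁ S₂ a 1 1)).trans ?_
    refine (form_tmul S₁ S₂ _ _ _ _).trans ?_
    simp [S₁.expect_incl]
  expect_X c := by
    refine (congrArg ((preBimodule S₁ S₂).completion.inner _) (repX_apply S₁ S₂ c _)).trans ?_
    refine ((preBimodule S₁ S₂).inner_toCompletion _ _).trans ?_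
    refine (congrArg _ (lowerMul_tmul S₁ S₂ c 1 1)).trans ?_
    refine (form_tmul S₁ S₂ _ _ _ _).trans ?_
    simp [S₂.expect_one]

end TensorModel

end Model

end OpValued

namespace OpValued

/-! ### Convolutions in the joint model -/

section Consequences

set_option linter.unusedSectionVars false

variable {B : Type u} [CStarAlgebra B] [PartialOrder B] [StarOrderedRing B]

/-- On the range of an idempotent $q$ that commutes with $y$ and with the coefficients, $yq$ acts as
$y$. -/
theorem evalPoly_mul_commute {A : Type*} [Ring A] [Algebra ℂ A] {f : B →ₐ[ℂ] A} {y q : A}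
    (hq : q * q = q) (hf : ∀ b, q * f b = f b * q) (hy : q * y = y * q) (p : NCPoly B) :
    evalPoly f (y * q) p * q = evalPoly f y p * q := by
  have hc : ∀ p, q * evalPoly f y p = evalPoly f y p * q := by
    intro p
    induction p using poly_induction with
    | hC b => rw [evalPoly_polyC, hf]
    | hX => rw [evalPoly_polyX, hy]
    | hadd p r hp hr => rw [map_add, mul_add, add_mul, hp, hr]
    | hmul p r hp hr => rw [map_mul, ← mul_assoc, hp, mul_assoc, hr, mul_assoc]
  induction p using poly_induction with
  | hC b => simp
  | hX => rw [evalPoly_polyX, evalPoly_polyX, mul_assoc, hq]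
  | hadd p r hp hr => rw [map_add, map_add, add_mul, add_mul, hp, hr]
  | hmul p r hp hr =>
    rw [map_mul, map_mul, mul_assoc, hr, ← hc, ← mul_assoc, hp, mul_assoc, hc, mul_assoc]

namespace ProbSpace

theorem alg₀_induction {S : ProbSpace B} {x : S.A} {C : S.A → Prop}
    (hX : ∀ b c : B, C (S.incl b * x * S.incl c))
    (hadd : ∀ p q, C p → C q → C (p + q)) (hsmul : ∀ (z : ℂ) p, C p → C (z • p))
    (hmul : ∀ p q, C p → C q → C (p * q)) {a : S.A} (ha : a ∈ S.alg₀ x) : C a := by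
  unfold alg₀ at ha
  induction ha using NonUnitalAlgebra.adjoin_induction with
  | mem x hx =>
    obtain ⟨b, c, rfl⟩ := hx
    exact hX b c
  | add x y _ _ hx hy => exact hadd x y hx hy
  | zero => simpa using hsmul 0 _ (hX 1 1)
  | mul x y _ _ hx hy => exact hmul x y hx hy
  | smul z x _ hx => exact hsmul z x hx

theorem alg₀_mul_eq_self {S : ProbSpace B} {x q a : S.A} (hx : x * q = x)
    (hq : ∀ b, q * S.incl b = S.incl b * q) (ha : a ∈ S.alg₀ x) : a * q = a := by
  refine alg₀_induction (C := fun a => a * q = a) ?_ ?_ ?_ ?_ ha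
  · intro b c
    rw [mul_assoc, ← hq, ← mul_assoc, mul_assoc (S.incl b), hx]
  · intro r s hr hs
    rw [add_mul, hr, hs]
  · intro z r hr
    rw [smul_mul_assoc, hr]
  · intro r s hr hs
    rw [mul_assoc, hs]

theorem mul_alg₀_eq_self {S : ProbSpace B} {x q a : S.A} (hx : q * x = x)
    (hq : ∀ b, q * S.incl b = S.incl b * q) (ha : a ∈ S.alg₀ x) : q * a = a := by
  refine alg₀_induction (C := fun a => q * a = a) ?_ ?_ ?_ ?_ ha
  · intro b c
    rw [← mul_assoc, ← mul_assoc, hq, mul_assoc (S.incl b), hx]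
  · intro r s hr hs
    rw [mul_add, hr, hs]
  · intro z r hr
    rw [mul_smul_comm, hr]
  · intro r s hr hs
    rw [← mul_assoc, hr]

/-- Variables that live under projections whose products are the vacuum projection are Boolean
independent. -/
theorem booleanIndep_of_proj {S : ProbSpace B} {I : Type} {x : I → S.A} {e : S.A} (q : I → S.A)
    (he : ∀ a a', S.expect (a * e * a') = S.expect a * S.expect a')
    (hq : ∀ i b, q i * S.incl b = S.incl b * q i) (hx : ∀ i, x i * q i = x i)
    (hx' : ∀ i, q i * x i = x i) (hqe : ∀ i j, i ≠ j → q i * q j = e) : S.BooleanIndep x := by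
  intro l
  induction l with
  | nil => intro _ _; simp [S.expect_one]
  | cons p l ih =>
    intro hl hc
    cases l with
    | nil => simp
    | cons p' l =>
      have ih' := ih (fun r hr => hl r (List.mem_cons_of_mem _ hr)) (List.isChain_cons_cons.mp hc).2
      have h1 : p.2 * q p.1 = p.2 := alg₀_mul_eq_self (hx _) (hq _) (hl p (by simp))
      have h2 : q p'.1 * p'.2 = p'.2 := mul_alg₀_eq_self (hx' _) (hq _) (hl p' (by simp))
      have h3 := hqe _ _ (List.isChain_cons_cons.mp hc).1
      have h4 : ((p :: p' :: l).map fun p => S.expect p.2).prod =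
          S.expect p.2 * ((p' :: l).map fun p => S.expect p.2).prod := by
        rw [List.map_cons, List.prod_cons]
      -- For the first two factors $a,a'$, with projections $q,q'$, one has $aa'=aqq'a'=aea'$. The
      -- expectation thus splits off $\mathbb E[a]$.
      rw [h4, ← ih', ← he]
      congr 1
      simp only [List.map_cons, List.prod_cons]
      rw [← h3, mul_assoc, mul_assoc, ← mul_assoc (q p'.1), h2, ← mul_assoc p.2 (q p.1), h1]

end ProbSpace

namespace JointModel

variable {S₁ S₂ : ProbSpace B} (J : JointModel S₁ S₂)

theorem X_one_mul (a : S₁.A) : J.X 1 * J.X a = J.X a := by rw [← map_mul, one_mul]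

theorem X_mul_one (a : S₁.A) : J.X a * J.X 1 = J.X a := by rw [← map_mul, mul_one]

/-- The adjoint of `X_incl` puts $X(1)$ on the other side of $b$; compare the two expressions for
$X(b)$. -/
theorem X_one_comm (b : B) : J.X 1 * J.S.incl b = J.S.incl b * J.X 1 := by
  have h := congrArg star (J.X_incl (star b))
  rw [star_mul, ← map_star, ← map_star, ← map_star, ← map_star, star_star, star_one, J.X_incl] at h
  exact h.symm

theorem Q_comm_incl (b : B) : J.Q * J.S.incl b = J.S.incl b * J.Q := by
  rw [← J.Y_incl, J.Q_comm]

/-- The projection onto the vacuum vector. -/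
noncomputable def vacProj : J.S.A := J.X 1 * J.Q

theorem vacProj_comm (b : B) : J.vacProj * J.S.incl b = J.S.incl b * J.vacProj := by
  rw [vacProj, mul_assoc, J.Q_comm_incl, ← mul_assoc, J.X_one_comm, mul_assoc]

theorem X_one_mul_vacProj : J.X 1 * J.vacProj = J.vacProj := by
  rw [vacProj, ← mul_assoc, J.X_one_mul]

theorem vacProj_mul_X_one : J.vacProj * J.X 1 = J.vacProj := by
  rw [vacProj, mul_assoc, J.Q_comm_one, ← mul_assoc, J.X_one_mul]

theorem Q_mul_vacProj : J.Q * J.vacProj = J.vacProj := by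
  rw [vacProj, ← mul_assoc, J.Q_comm_one, mul_assoc, J.Q_mul_Q]

theorem vacProj_mul_Q : J.vacProj * J.Q = J.vacProj := by
  rw [vacProj, mul_assoc, J.Q_mul_Q]

theorem expect_vacProj (a a' : J.S.A) :
    J.S.expect (a * J.vacProj * a') = J.S.expect a * J.S.expect a' := J.expect_mul a a'

/-- Such a $p$ fixes $\xi$, so it can be inserted at the right end of any expectation. The
factorization along the vacuum projection proves this without vectors. -/
theorem expect_mul_of_vacProj {p : J.S.A} (hp : p * J.vacProj = J.vacProj) (a : J.S.A) :
    J.S.expect (a * p) = J.S.expect a := by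
  have h := J.expect_vacProj (a * p) 1
  have h' := J.expect_vacProj a 1
  rw [mul_assoc a, hp, h', J.S.expect_one, mul_one, mul_one] at h
  exact h.symm

theorem expect_mul_of_vacProj' {p : J.S.A} (hp : J.vacProj * p = J.vacProj) (a : J.S.A) :
    J.S.expect (p * a) = J.S.expect a := by
  have h := J.expect_vacProj 1 (p * a)
  have h' := J.expect_vacProj 1 a
  rw [one_mul, ← mul_assoc, hp, ← one_mul J.vacProj, h', J.S.expect_one, one_mul, one_mul] at h
  exact h.symm

theorem compress_Y (a : S₂.A) :
    J.X 1 * J.Y a * J.X 1 = J.S.incl (S₂.expect a) * J.X 1 := by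
  rw [J.compress, J.X_incl]

theorem evalPoly_Y (y : S₂.A) (p : NCPoly B) :
    evalPoly J.S.incl.toAlgHom (J.Y y) p = J.Y (evalPoly S₂.incl.toAlgHom y p) :=
  evalPoly_map S₂.incl.toAlgHom J.S.incl.toAlgHom J.Y.toAlgHom J.Y_incl y p

/-- $X$ is not unital, so constants agree only after multiplication by $X(1)$. -/
theorem evalPoly_X (x : S₁.A) (p : NCPoly B) :
    evalPoly J.S.incl.toAlgHom (J.X x) p * J.X 1 = J.X (evalPoly S₁.incl.toAlgHom x p) := by
  induction p using poly_induction with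
  | hC b =>
    rw [evalPoly_polyC, evalPoly_polyC]
    exact (J.X_incl b).symm
  | hX => rw [evalPoly_polyX, evalPoly_polyX, J.X_mul_one]
  | hadd p r hp hr => rw [map_add, map_add, add_mul, hp, hr, map_add]
  | hmul p r hp hr =>
    rw [map_mul, map_mul, mul_assoc, hr, map_mul, ← hp, mul_assoc, J.X_one_mul]

theorem dist_Y (y : S₂.A) : J.S.dist (J.Y y) = S₂.dist y := by
  ext p
  rw [ProbSpace.dist_apply, J.evalPoly_Y, J.expect_Y, ProbSpace.dist_apply]

theorem dist_X (x : S₁.A) : J.S.dist (J.X x) = S₁.dist x := by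
  ext p
  rw [ProbSpace.dist_apply, ← J.expect_mul_of_vacProj J.X_one_mul_vacProj, J.evalPoly_X,
    J.expect_X, ProbSpace.dist_apply]

theorem dist_Y_mul_Q (y : S₂.A) : J.S.dist (J.Y y * J.Q) = S₂.dist y := by
  ext p
  rw [ProbSpace.dist_apply, ← J.expect_mul_of_vacProj J.Q_mul_vacProj,
    evalPoly_mul_commute J.Q_mul_Q J.Q_comm_incl (J.Q_comm y),
    J.expect_mul_of_vacProj J.Q_mul_vacProj, ← ProbSpace.dist_apply, J.dist_Y]

theorem exists_Y_of_mem (y : S₂.A) {a : J.S.A} (ha : a ∈ J.S.alg₀ (J.Y y)) : ∃ c, a = J.Y c := by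
  refine ProbSpace.alg₀_induction (C := fun a => ∃ c, a = J.Y c) ?_ ?_ ?_ ?_ ha
  · intro b c
    exact ⟨S₂.incl b * y * S₂.incl c, by rw [map_mul, map_mul, J.Y_incl, J.Y_incl]⟩
  · rintro _ _ ⟨c, rfl⟩ ⟨d, rfl⟩
    exact ⟨c + d, (map_add _ _ _).symm⟩
  · rintro z _ ⟨c, rfl⟩
    exact ⟨z • c, (map_smul _ _ _).symm⟩
  · rintro _ _ ⟨c, rfl⟩ ⟨d, rfl⟩
    exact ⟨c * d, (map_mul _ _ _).symm⟩

/-- Factors from `alg₀` of $X(x)$ absorb $P=X(1)$, and so does the vacuum. A factor $Y(c)$ with only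
such neighbours thus has $P$ on both sides, and $P\,Y(c)\,P=\mathbb E_2[c]\,P$. -/
theorem monotoneIndep (x : S₁.A) (y : S₂.A) : J.S.MonotoneIndep ![J.X x, J.Y y] := by
  intro (l : List (Fin 2 × J.S.A)) (r : List (Fin 2 × J.S.A)) (i : Fin 2) a hl hr ha hl' hr'
  have hL : ∀ t, J.S.expect ((l.map Prod.snd).prod * t) =
      J.S.expect ((l.map Prod.snd).prod * (J.X 1 * t)) := by
    intro t
    rcases List.eq_nil_or_concat l with rfl | ⟨l, p, rfl⟩
    · simp only [List.map_nil, List.prod_nil, one_mul]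
      rw [J.expect_mul_of_vacProj' J.vacProj_mul_X_one]
    · have h0 : p.1 = 0 := by
        have := hl' p (by simp)
        omega
      have hp := hl p (by simp)
      rw [h0] at hp
      have h1 : p.2 * J.X 1 = p.2 := ProbSpace.alg₀_mul_eq_self (J.X_mul_one x) J.X_one_comm hp
      simp only [List.concat_eq_append, List.map_append, List.map_cons, List.map_nil,
        List.prod_append, List.prod_cons, List.prod_nil, mul_one]
      rw [← mul_assoc (_ * p.2), mul_assoc _ p.2 (J.X 1), h1]
  have hR : ∀ t, J.S.expect (t * (r.map Prod.snd).prod) =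
      J.S.expect (t * (J.X 1 * (r.map Prod.snd).prod)) := by
    intro t
    cases r with
    | nil =>
      simp only [List.map_nil, List.prod_nil, mul_one]
      rw [J.expect_mul_of_vacProj J.X_one_mul_vacProj]
    | cons p r =>
      have h0 : p.1 = 0 := by
        have := hr' p (by simp)
        omega
      have hp := hr p (by simp)
      rw [h0] at hp
      have h1 : J.X 1 * p.2 = p.2 := ProbSpace.mul_alg₀_eq_self (J.X_one_mul x) J.X_one_comm hp
      rw [List.map_cons, List.prod_cons, ← mul_assoc (J.X 1), h1]
  have h01 : i = 0 ∨ i = 1 := by omega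
  rcases h01 with rfl | rfl
  -- No index lies below $0$, so a factor of index $0$ can have no neighbours here.
  · have hl0 : l = [] := by
      rcases List.eq_nil_or_concat l with rfl | ⟨l, p, rfl⟩
      · rfl
      · exact absurd (hl' p (by simp)) (by simp)
    have hr0 : r = [] := by
      cases r with
      | nil => rfl
      | cons p r =>
        exact absurd (hr' p (by simp)) (by simp)
    subst hl0 hr0
    simp [J.S.expect_incl]
  · obtain ⟨c, rfl⟩ := J.exists_Y_of_mem y ha
    have key : ∀ t, J.S.expect ((l.map Prod.snd).prod * t * (r.map Prod.snd).prod) =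
        J.S.expect ((l.map Prod.snd).prod * (J.X 1 * t * J.X 1) * (r.map Prod.snd).prod) := by
      intro t
      rw [mul_assoc, hL, ← mul_assoc, ← mul_assoc, hR]
      simp only [mul_assoc]
    rw [key, J.compress_Y, J.expect_Y, key (J.S.incl _), J.X_one_comm, mul_assoc _ (J.X 1) (J.X 1),
      J.X_one_mul]

/-- The variable whose distribution is the orthogonal convolution. -/
noncomputable def orth (x : S₁.A) (y : S₂.A) : J.S.A := J.X x + J.Y y * (1 - J.Q)

theorem add_orth (x : S₁.A) (y : S₂.A) : J.Y y * J.Q + J.orth x y = J.X x + J.Y y := by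
  rw [orth, mul_sub, mul_one]
  abel

theorem Q_mul_one_sub_Q : J.Q * (1 - J.Q) = 0 := by rw [mul_sub, mul_one, J.Q_mul_Q, sub_self]

theorem one_sub_Q_mul_Q : (1 - J.Q) * J.Q = 0 := by rw [sub_mul, one_mul, J.Q_mul_Q, sub_self]

theorem one_sub_Q_comm_Y (y : S₂.A) : (1 - J.Q) * J.Y y = J.Y y * (1 - J.Q) := by
  rw [sub_mul, mul_sub, one_mul, mul_one, J.Q_comm]

theorem one_sub_Q_comm_incl (b : B) : (1 - J.Q) * J.S.incl b = J.S.incl b * (1 - J.Q) := by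
  rw [← J.Y_incl, J.one_sub_Q_comm_Y]

theorem one_sub_Q_comm_X_one : (1 - J.Q) * J.X 1 = J.X 1 * (1 - J.Q) := by
  rw [sub_mul, mul_sub, one_mul, mul_one, J.Q_comm_one]

theorem one_sub_Q_mul_self : (1 - J.Q) * (1 - J.Q) = 1 - J.Q := by
  rw [mul_sub, J.one_sub_Q_mul_Q, mul_one, sub_zero]

theorem vacProj_mul_Y (y : S₂.A) : J.vacProj * (J.Y y * (1 - J.Q)) = 0 := by
  rw [vacProj, mul_assoc, ← mul_assoc J.Q, J.Q_comm, mul_assoc (J.Y y), J.Q_mul_one_sub_Q, mul_zero,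
    mul_zero]

theorem Y_mul_vacProj (y : S₂.A) : J.Y y * (1 - J.Q) * J.vacProj = 0 := by
  rw [vacProj, ← J.Q_comm_one, mul_assoc, ← mul_assoc (1 - J.Q), J.one_sub_Q_mul_Q, zero_mul,
    mul_zero]

/-- $Y(y)Q$ lives under $Q$. The other variable lives under $1-Q+e$, because $P\le1-Q+e$ covers
$X(x)$ and $e$ annihilates $Y(y)(1-Q)$. The two projections multiply to $e$ in either order. -/
theorem booleanIndep (x : S₁.A) (y : S₂.A) :
    J.S.BooleanIndep ![J.Y y * J.Q, J.orth x y] := by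
  have hQ0 : J.Q * (1 - J.Q + J.vacProj) = J.vacProj := by
    rw [mul_add, J.Q_mul_one_sub_Q, zero_add, J.Q_mul_vacProj]
  have hQ1 : (1 - J.Q + J.vacProj) * J.Q = J.vacProj := by
    rw [add_mul, J.one_sub_Q_mul_Q, zero_add, J.vacProj_mul_Q]
  have hX0 : J.X 1 * (1 - J.Q + J.vacProj) = J.X 1 := by
    rw [mul_add, mul_sub, J.X_one_mul_vacProj, mul_one, vacProj, sub_add_cancel]
  have hX1 : (1 - J.Q + J.vacProj) * J.X 1 = J.X 1 := by
    rw [add_mul, sub_mul, J.vacProj_mul_X_one, one_mul, vacProj, J.Q_comm_one, sub_add_cancel]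
  refine ProbSpace.booleanIndep_of_proj (e := J.vacProj) ![J.Q, 1 - J.Q + J.vacProj]
    J.expect_vacProj ?_ ?_ ?_ ?_
  · intro i b
    fin_cases i
    · exact J.Q_comm_incl b
    · change (1 - J.Q + J.vacProj) * _ = _ * (1 - J.Q + J.vacProj)
      rw [add_mul, mul_add, J.one_sub_Q_comm_incl, J.vacProj_comm]
  · intro i
    fin_cases i
    · change J.Y y * J.Q * J.Q = J.Y y * J.Q
      rw [mul_assoc, J.Q_mul_Q]
    · change J.orth x y * (1 - J.Q + J.vacProj) = J.orth x y
      rw [orth, add_mul, ← J.X_mul_one, mul_assoc, hX0, mul_add (J.Y y * _), mul_assoc,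
        J.one_sub_Q_mul_self, J.Y_mul_vacProj, add_zero]
  · intro i
    fin_cases i
    · change J.Q * (J.Y y * J.Q) = J.Y y * J.Q
      rw [← mul_assoc, J.Q_comm, mul_assoc, J.Q_mul_Q]
    · change (1 - J.Q + J.vacProj) * J.orth x y = J.orth x y
      rw [orth, mul_add, ← J.X_one_mul, ← mul_assoc, hX1, add_mul (1 - J.Q), ← mul_assoc,
        J.one_sub_Q_comm_Y, mul_assoc, J.one_sub_Q_mul_self, J.vacProj_mul_Y, add_zero]
  · intro i j hij
    fin_cases i <;> fin_cases j
    · exact absurd rfl hij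
    · exact hQ0
    · exact hQ1
    · exact absurd rfl hij

/-- Since $1-Q$ commutes with $Y$, $P$ and $\mathcal B$, the compression of $r(Y(y)(1-Q))$ to $P$ is
$P\,r(Y(y))\,P(1-Q)=\nu(r)(P-e)$ for $r$ without constant term. -/
theorem isOrthogonalModel (x : S₁.A) (y : S₂.A) :
    IsOrthogonalModel (S₁.dist x) (S₂.dist y) J.S.incl.toAlgHom J.S.expect
      ![J.X x, J.Y y * (1 - J.Q)] (J.X 1) J.vacProj where
  map_left := J.S.expect_incl_mul
  map_mul_mul := J.expect_vacProj
  map_one := J.S.expect_one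
  left_mul := J.X_one_mul x
  mul_right := J.X_mul_one x
  comm := J.X_one_comm
  comm_vac := J.vacProj_comm
  vac_mul := J.vacProj_mul_Y y
  mul_vac := J.Y_mul_vacProj y
  compress r hr := by
    change J.X 1 * evalPoly J.S.incl.toAlgHom (J.Y y * (1 - J.Q)) r * J.X 1 =
      J.S.incl (S₂.dist y r) * (J.X 1 - J.vacProj)
    have h : J.Y y * (1 - J.Q) * (1 - J.Q) = J.Y y * (1 - J.Q) := by
      rw [mul_assoc, J.one_sub_Q_mul_self]
    rw [← evalPoly_mul_eq_self h J.one_sub_Q_comm_incl hr,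
      evalPoly_mul_commute J.one_sub_Q_mul_self J.one_sub_Q_comm_incl (J.one_sub_Q_comm_Y y),
      J.evalPoly_Y, mul_assoc, mul_assoc, J.one_sub_Q_comm_X_one, ← mul_assoc, ← mul_assoc,
      J.compress_Y, mul_assoc, ProbSpace.dist_apply, mul_sub (J.X 1), mul_one, vacProj]
  dist q _ := by
    change J.S.dist (J.X x) q = _
    rw [J.dist_X]

theorem isSelfAdjoint_orth {x : S₁.A} {y : S₂.A} (hx : IsSelfAdjoint x) (hy : IsSelfAdjoint y) :
    IsSelfAdjoint (J.orth x y) := by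
  rw [IsSelfAdjoint, orth, star_add, star_mul, star_sub, star_one, J.star_Q, ← map_star, ← map_star,
    hx, hy, J.one_sub_Q_comm_Y]

end JointModel

end Consequences

end OpValued

namespace OpValued

/-! ### Existence and uniqueness of the convolutions -/

section Existence

set_option linter.unusedSectionVars false

variable {B : Type u} [CStarAlgebra B] [PartialOrder B] [StarOrderedRing B]

namespace ProbSpace

variable (S : ProbSpace B)

/-- The algebra of a probability space as a semi-inner product bimodule. -/
noncomputable def preBimodule : PreBimodule B where
  V := S.A
  form := LinearMap.mk₂'ₛₗ (starRingEnd ℂ) (RingHom.id ℂ) (fun a c => S.expect (star a * c))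
    (by intros; simp only [star_add, add_mul, map_add])
    (by intros; simp only [star_smul, smul_mul_assoc, map_smul, starRingEnd_apply])
    (by intros; simp only [mul_add, map_add])
    (by intros; simp only [mul_smul_comm, map_smul, RingHom.id_apply])
  star_form a c := by
    change star (S.expect (star c * a)) = S.expect (star a * c)
    rw [← S.expect_star, star_mul, star_star]
  form_nonneg := S.expect_star_mul_self_nonneg
  left := (Algebra.lmul ℂ S.A).comp S.incl.toAlgHom
  right := (Algebra.lsmul ℂ ℂ S.A).comp (AlgHom.op S.incl.toAlgHom)
  left_right b c v := (mul_assoc _ _ _).symm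
  form_right x y b := by
    change S.expect (star x * (y * S.incl b)) = S.expect (star x * y) * b
    rw [← mul_assoc, S.expect_mul_incl]
  form_left x y b := by
    change S.expect (star (S.incl b * x) * y) = S.expect (star x * (S.incl (star b) * y))
    rw [star_mul, map_star, mul_assoc]
  vac := 1
  form_vac b := by
    change S.expect (star 1 * (S.incl b * 1)) = b
    rw [star_one, one_mul, mul_one, S.expect_incl]

/-- The left regular representation on the completion. -/
noncomputable def regular : S.A →⋆ₙₐ[ℂ] S.preBimodule.completion.operators :=
  S.preBimodule.rep (Algebra.lmul ℂ S.A).toLinearMap (map_mul (Algebra.lmul ℂ S.A))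
    (fun d (v : S.A) (w : S.A) => by
      change S.expect (star (d * v) * w) = S.expect (star v * (star d * w))
      rw [star_mul, mul_assoc])

theorem regular_apply (a c : S.A) :
    (S.regular a).1 (S.preBimodule.toCompletion c) = S.preBimodule.toCompletion (a * c : S.A) :=
  S.preBimodule.rep_apply _ _ _ _ _

/-- An element of a probability space as an adjointable operator. -/
noncomputable def regularAdjointable (a : S.A) : S.preBimodule.completion.adjointable :=
  ⟨(S.regular a).1.toLinearMap, (star (S.regular a)).1.toLinearMap,
    S.preBimodule.completion.inner_star _⟩

theorem dist_regularAdjointable (a : S.A) :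
    S.preBimodule.completion.dist (S.regularAdjointable a) = S.dist a := by
  ext p
  have h : ∀ v : S.A, S.preBimodule.toCompletion (evalPoly S.incl.toAlgHom a p • v : S.A) =
      evalPoly (Algebra.lsmul ℂ ℂ S.preBimodule.completion.carrier)
        (S.regularAdjointable a : Module.End ℂ S.preBimodule.completion.carrier) p •
        S.preBimodule.toCompletion v := fun v =>
    evalPoly_intertwine S.incl.toAlgHom
      (Algebra.lsmul ℂ ℂ S.preBimodule.completion.carrier) (fun v : S.A => S.preBimodule.toCompletion v)
      (fun v w => UniformSpace.Completion.coe_add (α := S.preBimodule.V) v w)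
      (fun b v => (S.preBimodule.leftOperator_toCompletion b v).symm)
      (fun v => (S.regular_apply a v).symm) p v
  refine (congrArg (S.preBimodule.completion.inner _) (h 1).symm).trans ?_
  refine (S.preBimodule.inner_toCompletion _ _).trans ?_
  change S.expect (star 1 * (_ * 1)) = _
  rw [star_one, one_mul, mul_one, dist_apply]

end ProbSpace

theorem IsOrthogonalConv.eq_dist_orth {S₁ S₂ : ProbSpace B} (J : JointModel S₁ S₂) {x : S₁.A}
    {y : S₂.A} {ρ : Distribution B} (h : IsOrthogonalConv (S₁.dist x) (S₂.dist y) ρ) :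
    ρ = J.S.dist (J.orth x y) := by
  obtain ⟨M, z, hz, rfl⟩ := h
  have h1 := FreeProd.isOrthogonalModel z
  rw [hz 0, hz 1] at h1
  ext p
  rw [Fin.sum_univ_two]
  exact h1.eval_add_eq (J.isOrthogonalModel x y) p

/-- The GNS bimodule of a probability space realizes the distribution of any element by its left
regular representation. -/
theorem exists_isOrthogonalConv (S₁ S₂ : ProbSpace B) (x : S₁.A) (y : S₂.A) :
    ∃ ρ, IsOrthogonalConv (S₁.dist x) (S₂.dist y) ρ := by
  refine ⟨_, Fin.cons S₁.preBimodule.completion (fun _ => S₂.preBimodule.completion),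
    Fin.cons (S₁.regularAdjointable x) (fun _ => S₂.regularAdjointable y), ?_, rfl⟩
  intro i
  fin_cases i
  · exact S₁.dist_regularAdjointable x
  · exact S₂.dist_regularAdjointable y

theorem isOrthogonalConv_iff {S₁ S₂ : ProbSpace B} (J : JointModel S₁ S₂) (x : S₁.A)
    (y : S₂.A) (ρ : Distribution B) :
    IsOrthogonalConv (S₁.dist x) (S₂.dist y) ρ ↔ ρ = J.S.dist (J.orth x y) := by
  refine ⟨fun h => h.eq_dist_orth J, ?_⟩
  rintro rfl
  obtain ⟨ρ, h⟩ := exists_isOrthogonalConv S₁ S₂ x y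
  rwa [← h.eq_dist_orth J]

theorem isMonotoneConv_iff {S₁ S₂ : ProbSpace B} (J : JointModel S₁ S₂) (x : S₁.A)
    (y : S₂.A) (τ : Distribution B) :
    IsMonotoneConv (S₁.dist x) (S₂.dist y) τ ↔ τ = J.S.dist (J.X x + J.Y y) := by
  constructor
  · rintro ⟨S, x', y', hx, hy, h, rfl⟩
    have key (i : Fin 2) : S.dist (![x', y'] i) = J.S.dist (![J.X x, J.Y y] i) := by
      fin_cases i
      · exact hx.trans (J.dist_X x).symm
      · exact hy.trans (J.dist_Y y).symm
    have := h.dist_add (J.monotoneIndep x y) key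
    simpa only [Matrix.cons_val_zero, Matrix.cons_val_one] using this
  · rintro rfl
    exact ⟨J.S, J.X x, J.Y y, J.dist_X x, J.dist_Y y, J.monotoneIndep x y, rfl⟩

/-- By `add_orth` the Boolean independent pair and the monotone independent pair have the same sum.
This is the identity $\mu\rhd\nu=\nu\uplus(\mu\vdash\nu)$. -/
theorem isBooleanConv_iff {S₁ S₂ : ProbSpace B} (J : JointModel S₁ S₂) (x : S₁.A)
    (y : S₂.A) (τ : Distribution B) :
    IsBooleanConv (S₂.dist y) (J.S.dist (J.orth x y)) τ ↔ τ = J.S.dist (J.X x + J.Y y) := by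
  rw [← J.add_orth]
  constructor
  · rintro ⟨S, x', y', hx, hy, h, rfl⟩
    have key (i : Fin 2) : S.dist (![x', y'] i) = J.S.dist (![J.Y y * J.Q, J.orth x y] i) := by
      fin_cases i
      · exact hx.trans (J.dist_Y_mul_Q y).symm
      · exact hy
    have := h.dist_add (J.booleanIndep x y) key
    simpa only [Matrix.cons_val_zero, Matrix.cons_val_one] using this
  · rintro rfl
    exact ⟨J.S, J.Y y * J.Q, J.orth x y, J.dist_Y_mul_Q y, rfl, J.booleanIndep x y, rfl⟩

end Existence

end OpValued

namespace OpValued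

/-! ### A resolvent identity -/

section Resolvent

/-- The compression of the resolvent of `x + y (1 - Q)`, in terms of the resolvents `U` of `y` and
`V` of `x`. -/
theorem resolvent_compression {R T : Type*} [Ring R] [Ring T] (ι : T →+* R) (φ : R →+ T)
    {P Q x y U V W : R} {b b' g F : T} (hP : P * P = P) (hQ : Q * Q = Q) (hQP : Q * P = P * Q)
    (hιP : ∀ c, P * ι c = ι c * P) (hιQ : ∀ c, Q * ι c = ι c * Q)
    (hφ : ∀ a a', φ (a * (P * Q) * a') = φ a * φ a') (hφP : ∀ a, φ (P * a) = φ a)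
    (hφP' : ∀ a, φ (a * P) = φ a) (hφι : ∀ a c, φ (a * ι c) = φ a * c)
    (hPx : P * x = x) (hxP : x * P = x) (hyQ : Q * y = y * Q) (hU : U * (ι b - y) = 1)
    (hb : b' * b = 1) (hb' : b * b' = 1) (hPU : P * U * P = ι g * P) (hFg : F * g = 1)
    (hV : V * (ι F * P - x) = P) (hW : (ι b - (x + y * (1 - Q))) * W = 1) :
    φ W = φ V + φ V * (F - b) * φ W := by
  have hQ1 : Q * (1 - Q) = 0 := by rw [mul_sub, mul_one, hQ, sub_self]
  have h1Q : (1 - Q) * (1 - Q) = 1 - Q := by rw [sub_mul, hQ1, one_mul, sub_zero]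
  have h1P : (1 - Q) * P = P * (1 - Q) := by rw [sub_mul, mul_sub, hQP, one_mul, mul_one]
  set e := P * Q with he
  set K := U * (1 - Q) + ι b' * Q with hK
  set W' := P * W * P with hW'
  -- $Q$ commutes with $y$ and with the scalars. On the range of $1-Q$ the element $y(1-Q)$ is $y$,
  -- with resolvent $U$; on the range of $Q$ it is $0$, with resolvent $b^{-1}$.
  have hK1 : K * (ι b - y * (1 - Q)) = 1 := by
    have c1 : (1 - Q) * (ι b - y * (1 - Q)) = (ι b - y) * (1 - Q) := by
      have : (1 - Q) * (y * (1 - Q)) = y * (1 - Q) := by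
        rw [← mul_assoc, sub_mul 1 Q y, hyQ, one_mul, ← mul_one_sub, mul_assoc, h1Q]
      rw [mul_sub (1 - Q), this, sub_mul 1 Q, hιQ, one_mul, sub_mul (ι b), mul_sub (ι b), mul_one]
    have c2 : Q * (ι b - y * (1 - Q)) = ι b * Q := by
      rw [mul_sub Q, ← mul_assoc, hyQ, mul_assoc, hQ1, mul_zero, sub_zero, hιQ]
    rw [hK, add_mul, mul_assoc, c1, mul_assoc, c2, ← mul_assoc, hU, ← mul_assoc, ← map_mul, hb,
      map_one, one_mul, one_mul, sub_add_cancel]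
  have hKW : W = K * (1 + x * W) := by
    have h : (ι b - y * (1 - Q)) * W = 1 + x * W := by
      rw [← sub_eq_iff_eq_add, ← sub_mul, sub_sub, add_comm _ x, hW]
    rw [← h, ← mul_assoc, hK1, one_mul]
  have he1 : e * P = e := by rw [he, mul_assoc, hQP, ← mul_assoc, hP]
  have he2 : P * e = e := by rw [he, ← mul_assoc, hP]
  have he3 : e * e = e := by
    nth_rewrite 2 [he]
    rw [← mul_assoc, he1, he, mul_assoc, hQ]
  have hιe : ∀ c, e * ι c = ι c * e := fun c => by
    rw [he, mul_assoc, hιQ, ← mul_assoc, hιP, mul_assoc]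
  have hPKP : P * K * P = ι g * (P - e) + ι b' * e := by
    rw [hK, mul_add, add_mul, ← mul_assoc, mul_assoc _ (1 - Q), h1P, ← mul_assoc, hPU, ← mul_assoc,
      hιP, mul_assoc (ι b'), mul_assoc (ι b'), ← he, he1, mul_assoc, mul_sub P, mul_one]
  have hP1 : (P - e) * (P - e) = P - e := by
    rw [mul_sub, sub_mul, sub_mul, hP, he1, he2, he3, sub_self, sub_zero]
  have hP2 : (P - e) * e = 0 := by rw [sub_mul, he2, he3, sub_self]
  have hP3 : e * (P - e) = 0 := by rw [mul_sub, he1, he3, sub_self]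
  have hιPe : ∀ c, (P - e) * ι c = ι c * (P - e) := fun c => by
    rw [sub_mul, mul_sub, hιP, hιe]
  -- $PKP=g(P-e)+b^{-1}e$ is block diagonal, and $F=g^{-1}$ gives its inverse on the range of $P$.
  have hT : (ι F * (P - e) + ι b * e) * (P * K * P) = P := by
    rw [hPKP, add_mul, mul_add, mul_add, mul_assoc, ← mul_assoc (P - e), hιPe, mul_assoc, hP1,
      mul_assoc (ι F), ← mul_assoc (P - e), hιPe, mul_assoc (ι b'), hP2, mul_zero, mul_zero,
      add_zero, mul_assoc (ι b), ← mul_assoc e, hιe, mul_assoc, hP3, mul_zero, mul_zero, zero_add,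
      mul_assoc (ι b), ← mul_assoc e, hιe, mul_assoc, he3, ← mul_assoc, ← map_mul, hFg, ← mul_assoc,
      ← map_mul, hb', map_one, one_mul, one_mul, sub_add_cancel]
  have hPW' : P * W' = W' := by rw [hW', ← mul_assoc, ← mul_assoc, hP]
  have hxW' : x * W' = x * W * P := by
    rw [hW', ← mul_assoc, ← mul_assoc, hxP]
  have hW1 : W' = P * K * P * (P + x * W') := by
    have h2 : P * K * P * (x * W') = P * K * (x * W * P) := by
      rw [hxW', mul_assoc (P * K), mul_assoc x, ← mul_assoc P, hPx]
    rw [mul_add, h2, mul_assoc (P * K), hP, hW']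
    nth_rewrite 1 [hKW]
    simp only [mul_add, add_mul, mul_one, mul_assoc]
  have hW2 : (ι F * (P - e) + ι b * e) * W' = P + x * W' := by
    nth_rewrite 1 [hW1]
    rw [← mul_assoc, hT, mul_add, hP, ← mul_assoc, hPx]
  -- The inverse of $PKP$ differs from $FP$ only on the vacuum, by $(b-F)e$. The compressed equation
  -- is thus the resolvent equation of $x$ at $F$ with a perturbation along $e$. Multiplying by $V$
  -- and applying $\varphi$ gives the claim, since $\varphi$ factors at $e$.
  have hW3 : (ι F * P - x) * W' = P + ι (F - b) * e * W' := by
    have : ι F * P - x = (ι F * (P - e) + ι b * e) - x + ι (F - b) * e := by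
      rw [map_sub, sub_mul, mul_sub]
      abel
    rw [this, add_mul, sub_mul, hW2, add_sub_cancel_right]
  have hW4 : W' = V * P + V * ι (F - b) * e * W' := by
    calc W' = V * (ι F * P - x) * W' := by rw [hV, hPW']
      _ = V * P + V * ι (F - b) * e * W' := by
        rw [mul_assoc, hW3, mul_add]
        simp only [mul_assoc]
  have hφW : φ W' = φ W := by rw [hW', hφP', hφP]
  have := congrArg φ hW4
  rw [map_add, hφ, hφP' V, hφι, hφW] at this
  exact this

end Resolvent

/-! ### Matricial Cauchy transforms -/

section Cauchy

set_option linter.unusedSectionVars false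

variable {n : Type*} [Fintype n] [DecidableEq n]

/-- The matrix with the entry `a` on the diagonal. -/
def diag {A : Type*} [Zero A] (n : Type*) [DecidableEq n] (a : A) : CStarMatrix n n A :=
  CStarMatrix.ofMatrix (Matrix.diagonal fun _ => a)

theorem diag_apply {A : Type*} [Zero A] (a : A) (i j : n) :
    diag n a i j = if i = j then a else 0 := Matrix.diagonal_apply ..

section Ring

variable {A A' : Type*} [Ring A] [Ring A']

theorem diag_mul_apply (a : A) (M : CStarMatrix n n A) (i j : n) :
    (diag n a * M) i j = a * M i j := Matrix.diagonal_mul _ _ _ _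

theorem mul_diag_apply (a : A) (M : CStarMatrix n n A) (i j : n) :
    (M * diag n a) i j = M i j * a := Matrix.mul_diagonal _ _ _ _

theorem diag_mul (a c : A) : diag n (a * c) = diag n a * diag n c := by
  ext i j
  rw [diag_mul_apply, diag_apply, diag_apply, mul_ite, mul_zero]

theorem diag_one : diag n (1 : A) = 1 := rfl

theorem diag_add (a c : A) : diag n (a + c) = diag n a + diag n c := by
  ext i j
  simp [diag_apply, ite_add_ite]

theorem diag_sub (a c : A) : diag n (a - c) = diag n a - diag n c := by
  ext i j
  simp [diag_apply, ite_sub_ite]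

/-- A ring homomorphism applied to the entries of a matrix. -/
def mapMat (n : Type*) [Fintype n] [DecidableEq n] (f : A →+* A') :
    CStarMatrix n n A →+* CStarMatrix n n A' :=
  f.mapMatrix

end Ring

/-! ### Half-planes, and dependence of the Cauchy transform on the distribution alone -/

section Positive

variable {B : Type u} [CStarAlgebra B] [PartialOrder B] [StarOrderedRing B]

namespace ProbSpace

noncomputable instance instPartialOrder (S : ProbSpace B) : PartialOrder S.A :=
  CStarAlgebra.spectralOrder S.A

instance instStarOrderedRing (S : ProbSpace B) : StarOrderedRing S.A :=
  CStarAlgebra.spectralOrderedRing S.A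

variable (S : ProbSpace B)

/-- The inclusion of `M_n(B)` into `M_n(A)`. -/
noncomputable def inclMat (n : Type*) [Fintype n] [DecidableEq n] :
    CStarMatrix n n B →+* CStarMatrix n n S.A :=
  mapMat n (S.incl : B →+* S.A)

theorem inclMat_apply (b : CStarMatrix n n B) (i j : n) :
    S.inclMat n b i j = S.incl (b i j) := rfl

/-- The conditional expectation of `M_n(A)` onto `M_n(B)`. -/
noncomputable def expectMat (n : Type*) [Fintype n] :
    CStarMatrix n n S.A →ₗ[ℂ] CStarMatrix n n B :=
  CStarMatrix.mapₗ S.expect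

theorem expectMat_apply (a : CStarMatrix n n S.A) (i j : n) :
    S.expectMat n a i j = S.expect (a i j) := rfl

theorem star_inclMat (b : CStarMatrix n n B) : S.inclMat n (star b) = star (S.inclMat n b) := by
  ext i j
  rw [inclMat_apply, CStarMatrix.star_apply, CStarMatrix.star_apply, inclMat_apply, map_star]

theorem star_expectMat (a : CStarMatrix n n S.A) :
    S.expectMat n (star a) = star (S.expectMat n a) := by
  ext i j
  rw [expectMat_apply, CStarMatrix.star_apply, CStarMatrix.star_apply, expectMat_apply,
    S.expect_star]

theorem inclMat_smul (z : ℂ) (b : CStarMatrix n n B) :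
    S.inclMat n (z • b) = z • S.inclMat n b := by
  ext i j
  rw [inclMat_apply, CStarMatrix.smul_apply, CStarMatrix.smul_apply, inclMat_apply, map_smul]

theorem expectMat_one : S.expectMat n 1 = 1 := by
  ext i j
  rw [expectMat_apply, CStarMatrix.one_apply, CStarMatrix.one_apply]
  split_ifs
  · exact S.expect_one
  · exact map_zero _

/-- For $a=s^*s$ the quadratic form at $v$ is $\sum_k\mathbb E[d_k^*d_k]$ with
$d_k=\sum_is_{ki}v_i^*$. -/
theorem expectMat_nonneg {a : CStarMatrix n n S.A} (ha : 0 ≤ a) : 0 ≤ S.expectMat n a := by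
  obtain ⟨s, rfl⟩ := exists_eq_star_mul_self ha
  refine cstarMatrix_nonneg ?_ fun v => ?_
  · rw [IsSelfAdjoint, ← star_expectMat, star_mul, star_star]
  · have e : ∑ i, ∑ j, v i * S.expectMat n (star s * s) i j * star (v j) =
        ∑ k, S.expect (star (∑ i, s k i * S.incl (star (v i))) *
          ∑ i, s k i * S.incl (star (v i))) := by
      simp only [expectMat_apply, CStarMatrix.mul_apply, CStarMatrix.star_apply, star_sum, star_mul,
        map_sum, Finset.mul_sum, Finset.sum_mul, ← map_star, star_star, ← S.expect_bimodule,
        mul_assoc]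
      rw [Finset.sum_comm_cycle]
      refine Finset.sum_congr rfl fun k _ => ?_
      rw [Finset.sum_comm]
    rw [e]
    exact Finset.sum_nonneg fun k _ => S.expect_star_mul_self_nonneg _

theorem imPos_inclMat {b : CStarMatrix n n B} (hb : ImPos b) : ImPos (S.inclMat n b) := by
  let f : CStarMatrix n n B →ₗ[ℂ] CStarMatrix n n S.A :=
    { toFun := S.inclMat n, map_add' := map_add _, map_smul' := S.inclMat_smul }
  refine ImPos.map f (map_one (S.inclMat n)) S.star_inclMat (fun d hd => ?_) hb
  obtain ⟨s, rfl⟩ := exists_eq_star_mul_self hd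
  change 0 ≤ S.inclMat n (star s * s)
  rw [map_mul, star_inclMat]
  exact star_mul_self_nonneg _

theorem isSelfAdjoint_diag {a : S.A} (ha : IsSelfAdjoint a) : IsSelfAdjoint (diag n a) := by
  ext i j
  rw [CStarMatrix.star_apply, diag_apply, diag_apply]
  by_cases h : i = j
  · rw [if_pos h, if_pos h.symm, ha.star_eq]
  · rw [if_neg h, if_neg (Ne.symm h), star_zero]

theorem imPos_sub_diag {b : CStarMatrix n n B} (hb : ImPos b) {a : S.A} (ha : IsSelfAdjoint a) :
    ImPos (S.inclMat n b - diag n a) :=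
  (S.imPos_inclMat hb).sub_of_isSelfAdjoint (S.isSelfAdjoint_diag ha)

theorem continuous_expect : Continuous S.expect := by
  let f : S.A →ₚ[ℂ] B := PositiveLinearMap.mk₀ S.expect fun a ha => by
    obtain ⟨s, rfl⟩ := exists_eq_star_mul_self ha
    exact S.expect_star_mul_self_nonneg s
  exact map_continuous f

theorem cauchy_eq {m : ℕ} (a : S.A) (b : CStarMatrix (Fin m) (Fin m) B) :
    S.cauchy a m b =
      S.expectMat (Fin m) (Ring.inverse (S.inclMat (Fin m) b - diag (Fin m) a)) := rfl

/-- Subtracting a selfadjoint element keeps $b$ in the half-plane, inversion moves it to the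
opposite one, and the unital positive map $\mathbb E\otimes I$ respects half-planes. Invertibility
of $G$ and $F\in\mathbb H_n^+$ both follow. -/
theorem imPos_neg_cauchy {m : ℕ} {a : S.A} (ha : IsSelfAdjoint a)
    {b : CStarMatrix (Fin m) (Fin m) B} (hb : b ∈ upperHalf B m) : ImPos (-S.cauchy a m b) := by
  rw [cauchy_eq, ← map_neg]
  exact ImPos.map _ S.expectMat_one S.star_expectMat (fun _ => S.expectMat_nonneg)
    (S.imPos_sub_diag hb ha).neg_inverse

theorem isUnit_cauchy {m : ℕ} {a : S.A} (ha : IsSelfAdjoint a)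
    {b : CStarMatrix (Fin m) (Fin m) B} (hb : b ∈ upperHalf B m) : IsUnit (S.cauchy a m b) := by
  simpa using (S.imPos_neg_cauchy ha hb).isUnit.neg

theorem recipCauchy_mem {m : ℕ} {a : S.A} (ha : IsSelfAdjoint a)
    {b : CStarMatrix (Fin m) (Fin m) B} (hb : b ∈ upperHalf B m) :
    S.recipCauchy a m b ∈ upperHalf B m := by
  have h := (S.imPos_neg_cauchy ha hb).neg_inverse
  obtain ⟨U, hU⟩ := S.isUnit_cauchy ha hb
  have e : -Ring.inverse (-S.cauchy a m b) = S.recipCauchy a m b := by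
    rw [recipCauchy, ← hU, ← Units.val_neg, Ring.inverse_unit, Ring.inverse_unit, inv_neg,
      Units.val_neg, neg_neg]
  rw [e] at h
  exact h

/-- The entries of the powers in the geometric series are noncommutative polynomials in $a$ that do
not depend on the probability space, so their expectations are moments. -/
theorem evalPoly_mat (a : S.A) (b : CStarMatrix n n B) (c : ℂ) (k : ℕ) (i j : n) :
    ((1 + c • (S.inclMat n b - diag n a)) ^ k) i j =
      evalPoly S.incl.toAlgHom a (((1 + c • (Matrix.map b polyC -
        Matrix.diagonal fun _ => polyX B)) ^ k : Matrix n n (NCPoly B)) i j) := by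
  have h : (1 + c • (S.inclMat n b - diag n a) : CStarMatrix n n S.A) =
      (evalPoly S.incl.toAlgHom a).mapMatrix (1 + c • (Matrix.map b polyC -
        Matrix.diagonal fun _ => polyX B)) := by
    rw [map_add, map_one, map_smul, map_sub]
    congr 3
    · ext i j
      change S.incl _ = evalPoly _ _ (polyC _)
      rw [evalPoly_polyC]
      rfl
    · ext i j
      rw [diag_apply]
      change _ = evalPoly _ _ (Matrix.diagonal _ i j)
      rw [Matrix.diagonal_apply]
      split_ifs
      · rw [evalPoly_polyX]
      · rw [map_zero]
  rw [h]
  change ((AlgHom.mapMatrix (evalPoly S.incl.toAlgHom a) _ : Matrix n n S.A) ^ k) i j = _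
  rw [← map_pow]
  rfl

/-- The Cauchy transform depends only on the distribution. -/
theorem cauchy_congr {S S' : ProbSpace B} {a : S.A} {a' : S'.A} (ha : IsSelfAdjoint a)
    (ha' : IsSelfAdjoint a') (h : S.dist a = S'.dist a') {m : ℕ}
    {b : CStarMatrix (Fin m) (Fin m) B} (hb : b ∈ upperHalf B m) :
    S.cauchy a m b = S'.cauchy a' m b := by
  obtain ⟨r₁, hr₁, h₁⟩ := (S.imPos_sub_diag hb ha).norm_lt_one
  obtain ⟨r₂, hr₂, h₂⟩ := (S'.imPos_sub_diag hb ha').norm_lt_one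
  -- One $r$ serves both elements, so that the two geometric series involve the same polynomials.
  obtain ⟨r, hr, hlt⟩ := exists_between (lt_min hr₁ hr₂)
  have hs := ImPos.hasSum_inverse hr (h₁ r hr (hlt.trans_le (min_le_left _ _)))
  have hs' := ImPos.hasSum_inverse hr (h₂ r hr (hlt.trans_le (min_le_right _ _)))
  ext i j
  have key : ∀ (T : ProbSpace B) (t : T.A), HasSum (fun k : ℕ => (-(Complex.I * r)) •
      (1 + (Complex.I * r) • (T.inclMat (Fin m) b - diag (Fin m) t)) ^ k)
        (Ring.inverse (T.inclMat (Fin m) b - diag (Fin m) t)) →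
      HasSum (fun k : ℕ => (-(Complex.I * r)) • T.dist t
        (((1 + (Complex.I * r) • (Matrix.map b polyC -
          Matrix.diagonal fun _ => polyX B)) ^ k : Matrix _ _ (NCPoly B)) i j))
        (T.cauchy t m b i j) := by
    intro T t ht
    have h1 : HasSum (fun k : ℕ => ((-(Complex.I * r)) •
        (1 + (Complex.I * r) • (T.inclMat (Fin m) b - diag (Fin m) t)) ^ k) i j)
        (Ring.inverse (T.inclMat (Fin m) b - diag (Fin m) t) i j) :=
      Pi.hasSum.mp (Pi.hasSum.mp ht i) j
    refine (h1.map T.expect T.continuous_expect).congr_fun ?_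
    intro k
    simp only [Function.comp_apply, CStarMatrix.smul_apply, evalPoly_mat, map_smul, dist_apply]
  have h3 := key S a hs
  rw [h] at h3
  exact h3.unique (key S' a' hs')

end ProbSpace

end Positive

end Cauchy

end OpValued

namespace OpValued

/-! ### The Cauchy transform of the orthogonal convolution -/

section OrthogonalCauchy

set_option linter.unusedSectionVars false

variable {B : Type u} [CStarAlgebra B] [PartialOrder B] [StarOrderedRing B]

namespace JointModel

variable {S₁ S₂ : ProbSpace B} (J : JointModel S₁ S₂) {n : Type*} [Fintype n] [DecidableEq n]

/-- `X` applied to the entries of a matrix. -/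
noncomputable def matX (n : Type*) [Fintype n] :
    CStarMatrix n n S₁.A →⋆ₙₐ[ℂ] CStarMatrix n n J.S.A :=
  CStarMatrix.mapₙₐ J.X

theorem matX_apply (M : CStarMatrix n n S₁.A) (i j : n) : J.matX n M i j = J.X (M i j) := rfl

/-- `Y` applied to the entries of a matrix. -/
noncomputable def matY (n : Type*) [Fintype n] [DecidableEq n] :
    CStarMatrix n n S₂.A →+* CStarMatrix n n J.S.A :=
  mapMat n (J.Y : S₂.A →+* J.S.A)

theorem matY_apply (M : CStarMatrix n n S₂.A) (i j : n) : J.matY n M i j = J.Y (M i j) := rfl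

theorem matX_diag (a : S₁.A) : J.matX n (diag n a) = diag n (J.X a) := by
  ext i j
  rw [matX_apply, diag_apply, diag_apply]
  split_ifs
  · rfl
  · exact map_zero _

theorem matY_diag (a : S₂.A) : J.matY n (diag n a) = diag n (J.Y a) := by
  ext i j
  rw [matY_apply, diag_apply, diag_apply]
  split_ifs
  · rfl
  · exact map_zero _

theorem matX_inclMat (b : CStarMatrix n n B) :
    J.matX n (S₁.inclMat n b) = J.S.inclMat n b * diag n (J.X 1) := by
  ext i j
  rw [matX_apply, mul_diag_apply, S₁.inclMat_apply, J.X_incl, J.S.inclMat_apply]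

theorem matY_inclMat (b : CStarMatrix n n B) :
    J.matY n (S₂.inclMat n b) = J.S.inclMat n b := by
  ext i j
  rw [matY_apply, S₂.inclMat_apply, J.Y_incl, J.S.inclMat_apply]

theorem diag_mul_inclMat {p : J.S.A} (hp : ∀ b, p * J.S.incl b = J.S.incl b * p)
    (b : CStarMatrix n n B) : diag n p * J.S.inclMat n b = J.S.inclMat n b * diag n p := by
  ext i j
  rw [diag_mul_apply, mul_diag_apply, J.S.inclMat_apply, hp]

theorem compress_matY (M : CStarMatrix n n S₂.A) :
    diag n (J.X 1) * J.matY n M * diag n (J.X 1) =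
      J.S.inclMat n (S₂.expectMat n M) * diag n (J.X 1) := by
  ext i j
  rw [mul_diag_apply, diag_mul_apply, mul_diag_apply, matY_apply, J.compress_Y, J.S.inclMat_apply,
    S₂.expectMat_apply]

theorem expectMat_matX (M : CStarMatrix n n S₁.A) :
    J.S.expectMat n (J.matX n M) = S₁.expectMat n M := by
  ext i j
  rw [J.S.expectMat_apply, matX_apply, J.expect_X, S₁.expectMat_apply]

theorem expectMat_vacProj (M N : CStarMatrix n n J.S.A) :
    J.S.expectMat n (M * (diag n (J.X 1) * diag n J.Q) * N) =
      J.S.expectMat n M * J.S.expectMat n N := by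
  ext i j
  rw [← diag_mul, J.S.expectMat_apply, CStarMatrix.mul_apply, CStarMatrix.mul_apply, map_sum]
  refine Finset.sum_congr rfl fun k _ => ?_
  rw [mul_diag_apply, J.expect_mul, J.S.expectMat_apply, J.S.expectMat_apply]

theorem expectMat_diag_mul (M : CStarMatrix n n J.S.A) :
    J.S.expectMat n (diag n (J.X 1) * M) = J.S.expectMat n M := by
  ext i j
  rw [J.S.expectMat_apply, diag_mul_apply, J.expect_mul_of_vacProj' J.vacProj_mul_X_one,
    J.S.expectMat_apply]

theorem expectMat_mul_diag (M : CStarMatrix n n J.S.A) :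
    J.S.expectMat n (M * diag n (J.X 1)) = J.S.expectMat n M := by
  ext i j
  rw [J.S.expectMat_apply, mul_diag_apply, J.expect_mul_of_vacProj J.X_one_mul_vacProj,
    J.S.expectMat_apply]

theorem expectMat_mul_inclMat (M : CStarMatrix n n J.S.A) (b : CStarMatrix n n B) :
    J.S.expectMat n (M * J.S.inclMat n b) = J.S.expectMat n M * b := by
  ext i j
  rw [J.S.expectMat_apply, CStarMatrix.mul_apply, CStarMatrix.mul_apply, map_sum]
  refine Finset.sum_congr rfl fun k _ => ?_
  rw [J.S.inclMat_apply, J.S.expect_mul_incl, J.S.expectMat_apply]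

/-- All relations of the joint model pass to matrices entrywise, with $P$, $Q$, $X(x)$, $Y(y)$ on
the diagonal. The resolvent identity then applies over $M_m(\mathcal B)$, with $g=G_\nu(b)$ and
$F=F_\nu(b)$. -/
theorem recipCauchy_orth {x : S₁.A} {y : S₂.A} (hx : IsSelfAdjoint x) (hy : IsSelfAdjoint y)
    {m : ℕ} {b : CStarMatrix (Fin m) (Fin m) B} (hb : b ∈ upperHalf B m) :
    J.S.recipCauchy (J.orth x y) m b =
      S₁.recipCauchy x m (S₂.recipCauchy y m b) - S₂.recipCauchy y m b + b := by
  have hz := J.isSelfAdjoint_orth hx hy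
  have hF := S₂.recipCauchy_mem hy hb
  have hG := J.S.isUnit_cauchy hz hb
  have hG₁ := S₁.isUnit_cauchy hx hF
  have hG₂ := S₂.isUnit_cauchy hy hb
  have hbu : IsUnit b := ImPos.isUnit hb
  set F := S₂.recipCauchy y m b with hFdef
  have key := resolvent_compression (J.S.inclMat (Fin m)) (J.S.expectMat (Fin m)).toAddMonoidHom
    (P := diag (Fin m) (J.X 1)) (Q := diag (Fin m) J.Q) (x := diag (Fin m) (J.X x))
    (y := diag (Fin m) (J.Y y))
    (U := J.matY (Fin m) (Ring.inverse (S₂.inclMat (Fin m) b - diag (Fin m) y)))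
    (V := J.matX (Fin m) (Ring.inverse (S₁.inclMat (Fin m) F - diag (Fin m) x)))
    (W := Ring.inverse (J.S.inclMat (Fin m) b - diag (Fin m) (J.orth x y)))
    (b := b) (b' := Ring.inverse b) (g := S₂.cauchy y m b) (F := F)
    (by rw [← diag_mul, J.X_one_mul]) (by rw [← diag_mul, J.Q_mul_Q])
    (by rw [← diag_mul, ← diag_mul, J.Q_comm_one]) (J.diag_mul_inclMat J.X_one_comm)
    (J.diag_mul_inclMat J.Q_comm_incl) J.expectMat_vacProj J.expectMat_diag_mul
    J.expectMat_mul_diag J.expectMat_mul_inclMat (by rw [← diag_mul, J.X_one_mul])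
    (by rw [← diag_mul, J.X_mul_one]) (by rw [← diag_mul, ← diag_mul, J.Q_comm])
    (by
      rw [← J.matY_inclMat, ← J.matY_diag, ← map_sub, ← map_mul,
        Ring.inverse_mul_cancel _ (S₂.imPos_sub_diag hb hy).isUnit, map_one])
    (Ring.inverse_mul_cancel _ hbu) (Ring.mul_inverse_cancel _ hbu) (J.compress_matY _)
    (Ring.inverse_mul_cancel _ hG₂)
    (by
      rw [← J.matX_inclMat, ← J.matX_diag, ← map_sub, ← map_mul,
        Ring.inverse_mul_cancel _ (S₁.imPos_sub_diag hF hx).isUnit, ← diag_one, J.matX_diag])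
    (by
      rw [← diag_one, ← diag_sub, ← diag_mul, ← diag_add, diag_one]
      exact Ring.mul_inverse_cancel _ (J.S.imPos_sub_diag hb hz).isUnit)
  have e1 : J.S.cauchy (J.orth x y) m b = S₁.cauchy x m F +
      S₁.cauchy x m F * (F - b) * J.S.cauchy (J.orth x y) m b := by
    have hV : (J.S.expectMat (Fin m)).toAddMonoidHom (J.matX (Fin m)
        (Ring.inverse (S₁.inclMat (Fin m) F - diag (Fin m) x))) = S₁.cauchy x m F :=
      J.expectMat_matX _
    rw [hV] at key
    exact key
  set G := J.S.cauchy (J.orth x y) m b with hGdef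
  -- Multiplying by $F_\mu(F)=G_\mu(F)^{-1}$ from the left gives $F_\mu(F)\,G=1+(F-b)\,G$.
  have e2 : (S₁.recipCauchy x m F - F + b) * G = 1 := by
    have h := congrArg (S₁.recipCauchy x m F * ·) e1
    simp only [mul_add, ← mul_assoc] at h
    rw [ProbSpace.recipCauchy, Ring.inverse_mul_cancel _ hG₁, one_mul] at h
    rw [ProbSpace.recipCauchy, sub_add, sub_mul, h, add_sub_cancel_right]
  rw [ProbSpace.recipCauchy, ← hGdef, ← one_mul (Ring.inverse G), ← e2, mul_assoc,
    Ring.mul_inverse_cancel _ hG, mul_one]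

end JointModel

end OrthogonalCauchy

end OpValued

theorem mainTheorem9 {B : Type u} [CStarAlgebra B] [PartialOrder B] [StarOrderedRing B]
    (μ ν : Distribution B) (hμ : IsCStarDist μ) (hν : IsCStarDist ν) :
    ∃ ρ τ : Distribution B,
      -- `ρ = μ ⊢ ν` and `τ = μ ▷ ν` are well defined, and `τ = ν ⊎ ρ`
      (∀ ρ', IsOrthogonalConv μ ν ρ' ↔ ρ' = ρ) ∧
      (∀ τ', IsMonotoneConv μ ν τ' ↔ τ' = τ) ∧
      (∀ τ', IsBooleanConv ν ρ τ' ↔ τ' = τ) ∧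
      IsCStarDist ρ ∧
      -- the formula for the reciprocal Cauchy transforms
      (IsSelfAdjointDist μ → IsSelfAdjointDist ν → IsSelfAdjointDist ρ) ∧
      ∀ (S₁ S₂ S₃ : ProbSpace B) (x : S₁.A) (y : S₂.A) (z : S₃.A),
        IsSelfAdjoint x → IsSelfAdjoint y → IsSelfAdjoint z →
        S₁.dist x = μ → S₂.dist y = ν → S₃.dist z = ρ →
        ∀ (n : ℕ), ∀ b ∈ upperHalf B n,
          IsUnit (S₂.cauchy y n b) ∧ S₂.recipCauchy y n b ∈ upperHalf B n ∧
          IsUnit (S₁.cauchy x n (S₂.recipCauchy y n b)) ∧ IsUnit (S₃.cauchy z n b) ∧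
          S₃.recipCauchy z n b =
            S₁.recipCauchy x n (S₂.recipCauchy y n b) - S₂.recipCauchy y n b + b := by
  obtain ⟨S, x₀, rfl⟩ := hμ
  obtain ⟨S', y₀, rfl⟩ := hν
  have hJ := isOrthogonalConv_iff (TensorModel.jointModel S S') x₀ y₀
  refine ⟨_, _, hJ, isMonotoneConv_iff (TensorModel.jointModel S S') x₀ y₀,
    isBooleanConv_iff (TensorModel.jointModel S S') x₀ y₀, ⟨_, _, rfl⟩, ?_, ?_⟩
  -- The elements that produced $\rho$ need not be selfadjoint. The joint model is rebuilt from
  -- selfadjoint representatives, and uniqueness of $\mu\vdash\nu$ shows that its variable `orth`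
  -- again has distribution $\rho$.
  · rintro ⟨S₁, x, hx, hxμ⟩ ⟨S₂, y, hy, hyν⟩
    refine ⟨_, (TensorModel.jointModel S₁ S₂).orth x y,
      (TensorModel.jointModel S₁ S₂).isSelfAdjoint_orth hx hy, ?_⟩
    rw [← hJ, ← hxμ, ← hyν, isOrthogonalConv_iff]
  · intro S₁ S₂ S₃ x y z hx hy hz hxμ hyν hzρ n b hb
    have hF := S₂.recipCauchy_mem hy hb
    refine ⟨S₂.isUnit_cauchy hy hb, hF, S₁.isUnit_cauchy hx hF, S₃.isUnit_cauchy hz hb, ?_⟩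
    -- The formula is known for `orth` in the model of $x$ and $y$. Since $z$ has the same
    -- distribution and both are selfadjoint, their Cauchy transforms agree.
    have h : S₃.dist z = (TensorModel.jointModel S₁ S₂).S.dist
        ((TensorModel.jointModel S₁ S₂).orth x y) := by
      rw [← isOrthogonalConv_iff, hxμ, hyν, hJ, hzρ]
    rw [← (TensorModel.jointModel S₁ S₂).recipCauchy_orth hx hy hb, ProbSpace.recipCauchy,
      ProbSpace.cauchy_congr hz ((TensorModel.jointModel S₁ S₂).isSelfAdjoint_orth hx hy) h hb]
    rfl
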